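/- Let $(E,\mathcal E)$ be a Borel space (a standard Borel space), $\alpha$ a finite measure on $E$, and $c:E\times E\to[0,\infty)$ a bounded, measurable, symmetric function. Let $\mathbf N$ be the space of finite $\mathbb N_0$-valued measures on $E$ with the $\sigma$-algebra generated by the maps $\eta\mapsto\eta(B)$, $B\in\mathcal E$, and for bounded measurable $f:\mathbf N\to\mathbb R$ put $$Lf(\eta)=\iint\bigl(f(\eta-\delta_x+\delta_y)-f(\eta)\bigr)\,c(x,y)\,(\alpha+\eta)(\mathrm dy)\,\eta(\mathrm dx).$$ There is exactly one family $(P_t)_{t\ge0}$ of sub-Markov kernels on $\mathbf N$ that solves the backward Kolmogorov equation $\partial_tP_t(\eta,B)=(LP_t(\cdot,B))(\eta)$, $P_0(\eta,\cdot)=\delta_\eta$, for all $t\ge0$, $\eta\in\mathbf N$ and measurable $B\subset\mathbf N$. It is a semigroup of Markov kernels, and it is the transition function of a Markov process $(\eta_t)_{t\ge0}$ on $\mathbf N$, the generalized symmetric inclusion process with generator $L$. Moreover: (i) The process conserves the number of particles ($\eta_t(E)=\eta(E)$ $\mathbb P_\eta$-a.s. for all $t\ge 0$ and $\eta\in\mathbf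 N$) and is consistent: $P_t\mathcal Af=\mathcal AP_tf$ for all $t\ge0$ and all bounded measurable $f:\mathbf N\to\mathbb R$, where $\mathcal Af(\eta)=\int f(\eta-\delta_x)\,\eta(\mathrm dx)$. Consequently the falling factorial intertwining relation $$P_tJ_n(f_n,\cdot)(\eta)=J_n(p_t^{[n]}f_n,\eta),\qquad \eta\in\mathbf N,$$ holds for all $t\ge0$, $n\in\mathbb N_0$ and $f_n\in\mathcal F_n$. Here $\mathcal F_n$ is the set of bounded, measurable, permutation invariant functions on $E^n$; $J_n(f_n,\eta)=\int f_n\,\mathrm d\eta^{(n)}$, where for $\eta=\delta_{x_1}+\dots+\delta_{x_m}$ the factorial measure $\eta^{(n)}$ is the sum of $\delta_{(x_{i_1},\dots,x_{i_n})}$ over all $n$-tuples of pairwise different indices; and $p_t^{[n]}f_n\in\mathcal F_n$ is given by $(p_t^{[n]}f_n)(x_1,\dots,x_n)=(P_tF)(\delta_{x_1}+\dots+\delta_{x_n})$, where $F(\delta_{y_1}+\dots+\delta_{y_n})=f_n(y_1,\dots,y_n)$. (ii) Let $p\in(0,1)$. There is a Pascal distribution with parameters $\alpha$ and $p$, i.e.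 a probability measure $\rho$ on $\mathbf N$ under which $\eta(B_1),\dots,\eta(B_m)$ are independent for pairwise disjoint $B_1,\dots,B_m\in\mathcal E$ and $$\rho(\eta(B)=k)=(1-p)^{\alpha(B)}\,\alpha(B)(\alpha(B)+1)\cdots(\alpha(B)+k-1)\,\frac{p^k}{k!},\qquad B\in\mathcal E,\ k\in\mathbb N_0.$$ Every such $\rho$ is reversible for $(P_t)_{t\ge0}$, and $\int\eta(E)^n\rho(\mathrm d\eta)<\infty$ for all $n\in\mathbb N_0$. Consequently the orthogonal polynomial intertwining relation $$P_tI_n(f_n,\cdot)(\eta)=I_n(p_t^{[n]}f_n,\eta)\qquad\text{for }\rho\text{-almost all }\eta$$ holds for all $t\ge0$, $n\in\mathbb N_0$ and $f_n\in\mathcal F_n$. Here $I_n(f_n,\cdot)$ is the orthogonal projection in $L^2(\rho)$ of $\eta\mapsto\int f_n\,\mathrm d\eta^{\otimes n}$ onto $\overline{\mathcal P_{n-1}}^{\perp}$, where $\mathcal P_{n-1}$ is the linear span of the maps $\eta\mapsto\int g\,\mathrm d\eta^{\otimes k}$ with $0\le k\le n-1$ and $g:E^k\to\mathbb R$ bounded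 and measurable ($\mathcal P_{-1}=\{0\}$). -/

import Mathlib

open MeasureTheory ProbabilityTheory Set
open scoped NNReal ENNReal

noncomputable section

namespace GSIP

universe u

/-! ### Finite counting measures -/

/-- The space of finite counting measures on `E`: measures with values in `ℕ` on measurable sets.
Its `σ`-algebra is inherited from `Measure E`, i.e. generated by the evaluations `η ↦ η B`
with `B` measurable. -/
abbrev Config (E : Type u) [MeasurableSpace E] : Type u :=
  {η : Measure E // ∀ B, MeasurableSet B → ∃ n : ℕ, η B = n}

section Config

variable {E : Type u} [MeasurableSpace E]

/-- The configuration `δ_{x 0} + ⋯ + δ_{x (n-1)}` (the zero measure for `n = 0`). -/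
def ofTuple {n : ℕ} (x : Fin n → E) : Config E :=
  ⟨∑ i, Measure.dirac (x i), fun B hB => by
    classical
    refine ⟨∑ i, if x i ∈ B then 1 else 0, ?_⟩
    rw [Measure.finsetSum_apply]
    push_cast
    refine Finset.sum_congr rfl fun i _ => ?_
    rw [Measure.dirac_apply' _ hB, Set.indicator_apply]
    simp⟩

/-- The configuration `η + δ_y`. -/
def addPoint (η : Config E) (y : E) : Config E :=
  ⟨η.1 + Measure.dirac y, fun B hB => by
    classical
    obtain ⟨n, hn⟩ := η.2 B hB
    refine ⟨n + if y ∈ B then 1 else 0, ?_⟩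
    rw [Measure.add_apply, hn, Measure.dirac_apply' _ hB, Set.indicator_apply]
    split_ifs <;> simp⟩

open Classical in
/-- The configuration `η - δ_x`, if `η` has a particle at `x`. (Otherwise, which happens for
`η`-almost no `x`, it is `η`.) -/
def removePoint (η : Config E) (x : E) : Config E :=
  if h : Measure.dirac x ≤ η.1 then
    ⟨η.1 - Measure.dirac x, fun B hB => by
      obtain ⟨n, hn⟩ := η.2 B hB
      refine ⟨n - if x ∈ B then 1 else 0, ?_⟩
      rw [Measure.sub_apply hB h, hn, Measure.dirac_apply' _ hB, Set.indicator_apply]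
      split_ifs <;> simp⟩
  else η

/-- A non-zero counting measure on a Borel space has an atom. -/
theorem exists_dirac_le [StandardBorelSpace E] (η : Config E) (h0 : η.1 ≠ 0) :
    ∃ x, Measure.dirac x ≤ η.1 := by
  classical
  have hex : ∃ m : ℕ, 1 ≤ m ∧ ∃ A, MeasurableSet A ∧ η.1 A = m := by
    obtain ⟨n, hn⟩ := η.2 univ MeasurableSet.univ
    refine ⟨n, Nat.one_le_iff_ne_zero.2 fun h => h0 ?_, univ, MeasurableSet.univ, hn⟩
    rw [← Measure.measure_univ_eq_zero, hn, h, Nat.cast_zero]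
  obtain ⟨hm, A, hA, hAm⟩ := Nat.find_spec hex
  set m := Nat.find hex with hm_def
  have hmin : ∀ C, MeasurableSet C → η.1 C < m → η.1 C = 0 := by
    intro C hC hlt
    obtain ⟨k, hk⟩ := η.2 C hC
    rw [hk] at hlt ⊢
    by_contra hne
    have hk1 : 1 ≤ k := Nat.one_le_iff_ne_zero.2 fun h => hne (by simp [h])
    exact Nat.find_min hex (Nat.cast_lt.1 hlt) ⟨hk1, C, hC, hk⟩
  have hne : A.Nonempty := by
    rw [nonempty_iff_ne_empty]
    rintro rfl
    rw [measure_empty] at hAm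
    exact absurd (Nat.cast_eq_zero.1 hAm.symm) (by omega)
  have : Nonempty E := hne.to_type
  obtain ⟨x, hx⟩ : ∃ x, {x} ∈ ae (η.1.restrict A) := by
    refine Filter.exists_singleton_mem_of_forall_separating (p := MeasurableSet) fun U hU => ?_
    rw [mem_ae_iff, mem_ae_iff, compl_compl, Measure.restrict_apply hU.compl,
      Measure.restrict_apply hU]
    by_contra! hcon
    have h1 := not_lt.1 (mt (hmin _ (hU.compl.inter hA)) hcon.1)
    have h2 := not_lt.1 (mt (hmin _ (hU.inter hA)) hcon.2)
    have h3 : η.1 (U ∩ A) + η.1 (Uᶜ ∩ A) = m := by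
      rw [← hAm, inter_comm U, inter_comm Uᶜ, ← sdiff_eq, measure_inter_add_sdiff A hU]
    have h4 : ((m + m : ℕ) : ℝ≥0∞) ≤ (m : ℕ) := by
      rw [← h3, Nat.cast_add]
      exact add_le_add h2 h1
    have h5 := Nat.cast_le.1 h4
    omega
  refine ⟨x, Measure.le_iff.2 fun s hs => ?_⟩
  rw [Measure.dirac_apply' _ hs, Set.indicator_apply]
  split_ifs with hxs
  · have hs' : η.1 (sᶜ ∩ A) = 0 := by
      rw [← Measure.restrict_apply hs.compl]
      refine measure_mono_null ?_ (mem_ae_iff.1 hx)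
      exact compl_subset_compl.2 (singleton_subset_iff.2 hxs)
    have : (m : ℝ≥0∞) ≤ η.1 s := by
      rw [← hAm, ← measure_inter_add_sdiff A hs, sdiff_eq, inter_comm A sᶜ, hs', add_zero]
      exact measure_mono inter_subset_right
    refine le_trans ?_ this
    simpa using (Nat.cast_le (α := ℝ≥0∞)).2 hm
  · exact bot_le

/-- On a Borel space every finite counting measure is a finite sum of Dirac measures. -/
theorem exists_ofTuple_eq [StandardBorelSpace E] (η : Config E) :
    ∃ (n : ℕ) (x : Fin n → E), ofTuple x = η := by
  obtain ⟨m, hm⟩ := η.2 univ MeasurableSet.univ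
  induction m generalizing η with
  | zero =>
    refine ⟨0, Fin.elim0, Subtype.ext ?_⟩
    have : η.1 = 0 := by rw [← Measure.measure_univ_eq_zero, hm, Nat.cast_zero]
    simp [ofTuple, this]
  | succ m ih =>
    have h0 : η.1 ≠ 0 := fun h => by
      rw [h] at hm
      simp at hm
      norm_cast at hm
    obtain ⟨x, hx⟩ := exists_dirac_le η h0
    have hsub : (removePoint η x).1 = η.1 - Measure.dirac x := by
      simp [removePoint, hx]
    obtain ⟨n, y, hy⟩ := ih (removePoint η x) (by
      rw [hsub, Measure.sub_apply MeasurableSet.univ hx, hm]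
      simp)
    refine ⟨n + 1, Fin.cons x y, Subtype.ext ?_⟩
    have hy' : ∑ i, Measure.dirac (y i) = η.1 - Measure.dirac x := by
      rw [← hsub, ← hy]
      rfl
    simp only [ofTuple, Fin.sum_univ_succ, Fin.cons_zero, Fin.cons_succ]
    rw [hy', add_comm, Measure.sub_add_cancel_of_le hx]

end Config

variable {E : Type u} [MeasurableSpace E]

/-! ### Markov processes on configurations -/

/-- A Markov process with state space `Config E`: a measurable space `Ω`, random configurations
`X t`, and probability measures `law η` on `Ω` under which `X 0 = η` almost surely and the Markov
property holds with respect to the natural filtration. -/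
structure MarkovProcess (E : Type u) [MeasurableSpace E] where
  Ω : Type u
  [mΩ : MeasurableSpace Ω]
  X : ℝ≥0 → Ω → Config E
  measurable_X : ∀ t, Measurable (X t)
  law : Kernel (Config E) Ω
  [isMarkovKernel_law : IsMarkovKernel law]
  law_start : ∀ η, ∀ᵐ ω ∂(law η), X 0 ω = η
  markov : ∀ (η : Config E) (s t : ℝ≥0) (B : Set (Config E)), MeasurableSet B →
    (law η)⟦X (s + t) ⁻¹' B | ⨆ r : Iic s, MeasurableSpace.comap (X r) inferInstance⟧
      =ᵐ[law η] fun ω => (law (X s ω)).real (X t ⁻¹' B)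

attribute [instance] MarkovProcess.mΩ MarkovProcess.isMarkovKernel_law

/-- The transition kernels `P_t(η, B) = P_η(X_t ∈ B)`. -/
def MarkovProcess.transition (M : MarkovProcess E) (t : ℝ≥0) : Kernel (Config E) (Config E) :=
  M.law.map (M.X t)

/-- `(P_t)` is a semigroup of Markov kernels. -/
structure IsMarkovSemigroup (P : ℝ≥0 → Kernel (Config E) (Config E)) : Prop where
  isMarkovKernel : ∀ t, IsMarkovKernel (P t)
  zero : P 0 = Kernel.id
  add : ∀ s t, P (s + t) = P t ∘ₖ P s

/-- The process conserves the number of particles. -/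
def IsConservative (P : ℝ≥0 → Kernel (Config E) (Config E)) : Prop :=
  ∀ t η, ∀ᵐ ξ ∂(P t η), ξ.1 univ = η.1 univ

/-- The lowering operator `𝒜 f(η) = ∫ f(η - δ_x) η(dx)`. -/
def lowering (f : Config E → ℝ) (η : Config E) : ℝ :=
  ∫ x, f (removePoint η x) ∂η.1

/-- Consistency: `P_t 𝒜 f = 𝒜 P_t f` for bounded measurable `f`. -/
def IsConsistent (P : ℝ≥0 → Kernel (Config E) (Config E)) : Prop :=
  ∀ (t : ℝ≥0) (f : Config E → ℝ), Measurable f → (∃ C, ∀ η, |f η| ≤ C) → ∀ η,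
    Integrable (lowering f) (P t η) ∧
    ∫ ξ, lowering f ξ ∂(P t η) = lowering (fun ζ => ∫ ξ, f ξ ∂(P t ζ)) η

/-! ### The generalized symmetric inclusion process -/

/-- The formal generator
`L f(η) = ∬ (f(η - δ_x + δ_y) - f(η)) c(x,y) (α + η)(dy) η(dx)`. -/
def generator (α : Measure E) (c : E → E → ℝ≥0) (f : Config E → ℝ) (η : Config E) : ℝ :=
  ∫ x, ∫ y, (f (addPoint (removePoint η x) y) - f η) * (c x y : ℝ) ∂(α + η.1) ∂η.1

/-- `(P_t)` is a (sub-Markov) solution of the backward Kolmogorov equation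
`∂_t P_t(η, B) = (L P_t(·, B))(η)`, `P_0(η, ·) = δ_η`, for the generator `L` of the generalized
symmetric inclusion process; the time derivative at `t = 0` is one-sided. -/
structure IsBackwardSolution (α : Measure E) (c : E → E → ℝ≥0)
    (P : ℝ≥0 → Kernel (Config E) (Config E)) : Prop where
  le_one : ∀ t η, P t η univ ≤ 1
  zero : P 0 = Kernel.id
  hasDeriv : ∀ (t : ℝ≥0) (η : Config E) (B : Set (Config E)), MeasurableSet B →
    HasDerivWithinAt (fun s : ℝ => (P s.toNNReal η).real B)
      (generator α c (fun ξ => (P t ξ).real B) η) (Ici 0) (t : ℝ)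

/-! ### Labelled particles and generalized falling factorials -/

/-- The space `ℱ_n` of bounded measurable permutation invariant functions on `E^n`. -/
structure IsSymmBdd {n : ℕ} (f : (Fin n → E) → ℝ) : Prop where
  measurable : Measurable f
  bounded : ∃ C, ∀ x, |f x| ≤ C
  symm : ∀ (σ : Equiv.Perm (Fin n)) (x : Fin n → E), f (x ∘ σ) = f x

open Classical in
/-- The function `F` on `n`-particle configurations with `F(δ_{x_1} + ⋯ + δ_{x_n}) = f(x)`,
for permutation invariant `f` (and `F = 0` on configurations with other particle numbers). -/
def descend {n : ℕ} (f : (Fin n → E) → ℝ) (η : Config E) : ℝ :=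
  if h : ∃ x : Fin n → E, ofTuple x = η then f h.choose else 0

/-- The semigroup `p_t^{[n]}` on `ℱ_n`, given by
`(p_t^{[n]} f)(x_1, …, x_n) = (P_t F)(δ_{x_1} + ⋯ + δ_{x_n})` for
`f(x) = F(δ_{x_1} + ⋯ + δ_{x_n})`. -/
def labelled (P : ℝ≥0 → Kernel (Config E) (Config E)) (t : ℝ≥0) {n : ℕ}
    (f : (Fin n → E) → ℝ) (x : Fin n → E) : ℝ :=
  ∫ ξ, descend f ξ ∂(P t (ofTuple x))

/-- The number of points of `η`. -/
def numPoints [StandardBorelSpace E] (η : Config E) : ℕ := (exists_ofTuple_eq η).choose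

/-- An arbitrary enumeration of the points of `η`, with multiplicities. -/
def points [StandardBorelSpace E] (η : Config E) : Fin (numPoints η) → E :=
  (exists_ofTuple_eq η).choose_spec.choose

/-- The `n`-th factorial measure `η^{(n)}` of `η = ∑ δ_{x_i}`: the sum of
`δ_{(x_{i_1}, …, x_{i_n})}` over tuples of pairwise different indices. -/
def factorialMeasure [StandardBorelSpace E] (n : ℕ) (η : Config E) : Measure (Fin n → E) :=
  ∑ i : Fin n ↪ Fin (numPoints η), Measure.dirac (points η ∘ i)

/-- The generalized falling factorial polynomial `J_n(f, η) = ∫ f dη^{(n)}`. -/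
def fallingFactorial [StandardBorelSpace E] {n : ℕ} (f : (Fin n → E) → ℝ) (η : Config E) : ℝ :=
  ∫ x, f x ∂(factorialMeasure n η)

/-- The intertwining relation `P_t J_n(f, ·)(η) = J_n(p_t^{[n]} f, η)` for all `η`, `f ∈ ℱ_n`,
`n` and `t` (with `p_t^{[n]} f ∈ ℱ_n`). -/
def FactorialIntertwining [StandardBorelSpace E]
    (P : ℝ≥0 → Kernel (Config E) (Config E)) : Prop :=
  ∀ (n : ℕ) (f : (Fin n → E) → ℝ), IsSymmBdd f → ∀ t : ℝ≥0, IsSymmBdd (labelled P t f) ∧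
    ∀ η, Integrable (fallingFactorial f) (P t η) ∧
      ∫ ξ, fallingFactorial f ξ ∂(P t η) = fallingFactorial (labelled P t f) η

/-! ### Generalized orthogonal polynomials -/

/-- The monomial `η ↦ η^{⊗ n}(f)`. -/
def monomial {n : ℕ} (f : (Fin n → E) → ℝ) (η : Config E) : ℝ :=
  ∫ x, f x ∂(Measure.pi fun _ : Fin n => η.1)

/-- The space of generalized polynomials of degree less than `n` (with bounded coefficients),
as a subspace of `L²(ρ)`; it is `{0}` for `n = 0`. -/
def polyLT (ρ : Measure (Config E)) (n : ℕ) : Submodule ℝ (Lp ℝ 2 ρ) :=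
  Submodule.span ℝ {F | ∃ k < n, ∃ f : (Fin k → E) → ℝ,
    Measurable f ∧ (∃ C, ∀ x, |f x| ≤ C) ∧ F =ᵐ[ρ] monomial f}

open Classical in
/-- The generalized orthogonal polynomial `I_n(f, ·)`: the orthogonal projection in `L²(ρ)` of
`η ↦ η^{⊗ n}(f)` onto the orthogonal complement of the closure of the space of polynomials of
degree less than `n`. (If all moments of `η(E)` under `ρ` are finite and `f` is bounded and
measurable then the monomial is in `L²(ρ)`.) -/
def orthPoly (ρ : Measure (Config E)) {n : ℕ} (f : (Fin n → E) → ℝ) : Lp ℝ 2 ρ :=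
  if h : MemLp (monomial f) 2 ρ then
    ((polyLT ρ n).topologicalClosureᗮ).starProjection (h.toLp (monomial f))
  else 0

/-- All moments of the total number of particles are finite. -/
def FiniteMoments (ρ : Measure (Config E)) : Prop :=
  ∀ n : ℕ, ∫⁻ η, (η.1 univ) ^ n ∂ρ < ∞

/-- The intertwining relation `P_t I_n(f, ·)(η) = I_n(p_t^{[n]} f, η)` for `ρ`-almost all `η`,
for all `f ∈ ℱ_n`, `n` and `t`. -/
def OrthogonalIntertwining (P : ℝ≥0 → Kernel (Config E) (Config E))
    (ρ : Measure (Config E)) : Prop :=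
  ∀ (n : ℕ) (f : (Fin n → E) → ℝ), IsSymmBdd f → ∀ t : ℝ≥0,
    ∀ᵐ η ∂ρ, Integrable (orthPoly ρ f) (P t η) ∧
      ∫ ξ, orthPoly ρ f ξ ∂(P t η) = orthPoly ρ (labelled P t f) η

/-! ### The Pascal distribution -/

/-- `ρ` is the distribution of a Pascal (negative binomial) point process with parameters `α`
and `p`. -/
structure IsPascal (α : Measure E) (p : ℝ) (ρ : Measure (Config E)) : Prop where
  isProbabilityMeasure : IsProbabilityMeasure ρ
  indep : ∀ (m : ℕ) (B : Fin m → Set E), (∀ i, MeasurableSet (B i)) →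
    Pairwise (fun i j => Disjoint (B i) (B j)) →
    iIndepFun (fun (i : Fin m) (η : Config E) => η.1 (B i)) ρ
  negBinomial : ∀ B : Set E, MeasurableSet B → ∀ k : ℕ,
    ρ {η | η.1 B = k} = ENNReal.ofReal ((1 - p) ^ (α.real B) *
      (ascPochhammer ℝ k).eval (α.real B) * (p ^ k / (k.factorial : ℝ)))

end GSIP

end

noncomputable section

namespace GSIP

universe u

variable {E : Type u} [MeasurableSpace E]

/-! ### Counting points -/

/-! Jumps preserve the number n of particles, and on n-particle configurations the total jump rate
is at most `rateBound α K n`. So L = Λ(Q − 1), where Q is a Markov kernel (`jumpKernel`) and the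
rate Λ depends only on the conserved quantity (`generator_eq`). The solution is therefore explicit:
P_t(η, ·) is the mixture of the powers of Q with Poisson(Λt) weights (`poissonized`).
Differentiating the series gives the backward equation, and a Picard estimate gives uniqueness among
solutions that are bounded on each level (`backward_unique`). The semigroup property and consistency
then follow by recognizing both sides as solutions with the same initial value. The process is the
Q-chain run along an independent Poisson clock of rate Λ (`subordinated`).

Consistency rests on L𝒜 = 𝒜L (`generator_lowering`): the generator of a configuration with one
particle deleted misses only the jumps onto that particle, and by symmetry of c the missing terms
cancel in pairs. On m-particle configurations J_n is an eigenfunction of 𝒜 with eigenvalue m − n, so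
for m > n the factorial intertwining reduces to m − 1 particles, and finally to m = n, where it is
the definition of p_t^{[n]} (`integral_gsip_fallingFactorial`).

Pascal laws are handled through the Mecke equation with Papangelou kernel p(α + η). A solution is
built by adding points one at a time (`isMecke_gibbsMeasure`). The equation gives a recursion for
the counts in disjoint sets, hence independence and the negative binomial law; since these determine
a law on configurations (`IsPascal.unique`), every Pascal law satisfies the Mecke equation. Detailed
balance then becomes the symmetry in (x, y) of c(x, y) (α + ξ)(dx) (α + ξ + δ_x)(dy). With
Papangelou kernel α the same construction yields the Poisson process that serves as the clock.

For the orthogonal intertwining, reversibility makes P_t a symmetric operator on L²(ρ)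
(`exists_kernelOperator`). By the factorial intertwining it preserves the polynomials of degree less
than n, and it sends the monomial of f to that of p_t^{[n]} f up to such polynomials. A symmetric
operator with these two properties intertwines the projections (`map_starProjection_orthogonal`). -/

/-- The number of points of `η` in `B`. -/
def count (B : Set E) (η : Config E) : ℕ := ⌊(η.1 B).toReal⌋₊

theorem coe_count {B : Set E} (hB : MeasurableSet B) (η : Config E) :
    (count B η : ℝ≥0∞) = η.1 B := by
  obtain ⟨n, hn⟩ := η.2 B hB
  simp [count, hn]

theorem count_eq_iff {B : Set E} (hB : MeasurableSet B) {η : Config E} {k : ℕ} :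
    count B η = k ↔ η.1 B = k := by
  rw [← coe_count hB, Nat.cast_inj]

/-- The total number of points. -/
abbrev size (η : Config E) : ℕ := count univ η

theorem coe_size (η : Config E) : (size η : ℝ≥0∞) = η.1 univ := coe_count MeasurableSet.univ η

instance isFiniteMeasure_config (η : Config E) : IsFiniteMeasure η.1 :=
  ⟨by rw [← coe_size]; exact ENNReal.natCast_lt_top _⟩

theorem measurable_eval {B : Set E} (hB : MeasurableSet B) :
    Measurable fun η : Config E => η.1 B :=
  (Measure.measurable_coe hB).comp measurable_subtype_coe

theorem measurable_count {B : Set E} (hB : MeasurableSet B) :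
    Measurable (count B : Config E → ℕ) :=
  Nat.measurable_floor.comp (measurable_eval hB).ennreal_toReal

theorem measurable_size : Measurable (size : Config E → ℕ) := measurable_count MeasurableSet.univ

theorem measurable_config_iff {X : Type*} [MeasurableSpace X] {f : X → Config E} :
    Measurable f ↔ ∀ B, MeasurableSet B → Measurable fun x => (f x).1 B := by
  refine ⟨fun h B hB => (measurable_eval hB).comp h, fun h => ?_⟩
  exact Measurable.subtype_mk (Measure.measurable_of_measurable_coe _ h)

open Classical in
theorem count_addPoint {B : Set E} (hB : MeasurableSet B) (η : Config E) (y : E) :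
    count B (addPoint η y) = count B η + if y ∈ B then 1 else 0 := by
  rw [count_eq_iff hB]
  simp only [addPoint, Measure.add_apply, ← coe_count hB, Measure.dirac_apply' _ hB,
    Set.indicator_apply]
  split_ifs <;> simp

@[simp] theorem size_addPoint (η : Config E) (y : E) : size (addPoint η y) = size η + 1 := by
  simp [count_addPoint MeasurableSet.univ]

open Classical in
theorem count_ofTuple {B : Set E} (hB : MeasurableSet B) {n : ℕ} (x : Fin n → E) :
    count B (ofTuple x) = ∑ i, if x i ∈ B then 1 else 0 := by
  rw [count_eq_iff hB]
  simp only [ofTuple, Measure.finsetSum_apply, Measure.dirac_apply' _ hB, Set.indicator_apply]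
  simp

@[simp] theorem size_ofTuple {n : ℕ} (x : Fin n → E) : size (ofTuple x) = n := by
  simp [count_ofTuple MeasurableSet.univ]

theorem exists_ofTuple_size [StandardBorelSpace E] (η : Config E) {n : ℕ} (hn : size η = n) :
    ∃ x : Fin n → E, ofTuple x = η := by
  obtain ⟨m, x, rfl⟩ := exists_ofTuple_eq η
  rw [size_ofTuple] at hn
  subst hn
  exact ⟨x, rfl⟩

theorem ofTuple_comp_perm {n : ℕ} (x : Fin n → E) (σ : Equiv.Perm (Fin n)) :
    ofTuple (x ∘ σ) = ofTuple x := by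
  refine Subtype.ext ?_
  simp only [ofTuple, Function.comp_apply]
  exact Equiv.sum_comp σ fun i => Measure.dirac (x i)

/-- The mass of `{a}` counts the indices with value a, so x and y have fibres of equal size over
every point; bijections of the fibres glue to a permutation of the indices. -/
theorem exists_perm_of_ofTuple_eq [MeasurableSingletonClass E] {n : ℕ} {x y : Fin n → E}
    (h : ofTuple x = ofTuple y) : ∃ σ : Equiv.Perm (Fin n), x ∘ σ = y := by
  classical
  have hcard : ∀ a, Fintype.card {i // x i = a} = Fintype.card {i // y i = a} := by
    intro a
    have := congrArg (count {a}) h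
    rw [count_ofTuple (measurableSet_singleton a), count_ofTuple (measurableSet_singleton a)] at this
    simpa [Fintype.card_subtype, Finset.sum_boole] using this
  let e : ∀ a, {i // y i = a} ≃ {i // x i = a} := fun a => Fintype.equivOfCardEq (hcard a).symm
  let σ : Fin n ≃ Fin n := (Equiv.sigmaFiberEquiv y).symm.trans
    ((Equiv.sigmaCongrRight e).trans (Equiv.sigmaFiberEquiv x))
  refine ⟨σ, funext fun i => ?_⟩
  exact (e (y i) ⟨i, rfl⟩).2

theorem addPoint_comm (η : Config E) (y z : E) :
    addPoint (addPoint η y) z = addPoint (addPoint η z) y :=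
  Subtype.ext (add_right_comm _ _ _)

theorem removePoint_addPoint (η : Config E) (y : E) : removePoint (addPoint η y) y = η := by
  have h : Measure.dirac y ≤ (addPoint η y).1 := Measure.le_add_left le_rfl
  rw [removePoint, dif_pos h]
  refine Subtype.ext ?_
  exact Measure.add_sub_cancel

theorem ofTuple_eq_addPoint {n : ℕ} (x : Fin (n + 1) → E) (i : Fin (n + 1)) :
    ofTuple x = addPoint (ofTuple (x ∘ i.succAbove)) (x i) := by
  refine Subtype.ext ?_
  simp only [ofTuple, addPoint, Function.comp_apply, Fin.sum_univ_succAbove _ i]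
  rw [add_comm]

theorem removePoint_ofTuple {n : ℕ} (x : Fin (n + 1) → E) (i : Fin (n + 1)) :
    removePoint (ofTuple x) (x i) = ofTuple (x ∘ i.succAbove) := by
  rw [ofTuple_eq_addPoint x i, removePoint_addPoint]

/-- Moving a particle from `x` to `y`. -/
def move (η : Config E) (x y : E) : Config E := addPoint (removePoint η x) y

theorem move_ofTuple {n : ℕ} (x : Fin n → E) (i : Fin n) (y : E) :
    move (ofTuple x) (x i) y = ofTuple (Function.update x i y) := by
  cases n with
  | zero => exact i.elim0
  | succ n =>
    rw [move, removePoint_ofTuple, ofTuple_eq_addPoint (Function.update x i y) i]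
    congr 1
    · congr 1
      ext j
      simp [Fin.succAbove_ne]
    · simp

theorem move_addPoint (η : Config E) (x y : E) : move (addPoint η x) x y = addPoint η y := by
  rw [move, removePoint_addPoint]

theorem integrable_ofTuple [MeasurableSingletonClass E] {n : ℕ} (x : Fin n → E) (f : E → ℝ) :
    Integrable f (ofTuple x).1 := by
  rw [ofTuple, integrable_finsetSum_measure]
  exact fun i _ => integrable_dirac enorm_lt_top

theorem integral_ofTuple [MeasurableSingletonClass E] {n : ℕ} (x : Fin n → E) (f : E → ℝ) :
    ∫ y, f y ∂(ofTuple x).1 = ∑ i, f (x i) := by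
  rw [ofTuple, integral_finsetSum_measure fun i _ => integrable_dirac enorm_lt_top]
  simp

theorem ae_size_move [StandardBorelSpace E] (η : Config E) :
    ∀ᵐ x ∂η.1, ∀ y, size (move η x y) = size η := by
  obtain ⟨n, x, rfl⟩ := exists_ofTuple_eq η
  have h : ∀ s : Set E, (∀ i, x i ∈ s) → ∀ᵐ z ∂(ofTuple x).1, z ∈ s := by
    intro s hs
    rw [ae_iff, ofTuple, Measure.finsetSum_apply]
    exact Finset.sum_eq_zero fun i _ => by simpa using hs i
  refine h {z | ∀ y, size (move (ofTuple x) z y) = size (ofTuple x)} fun i y => ?_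
  rw [move_ofTuple, size_ofTuple, size_ofTuple]

/-! ### Measurability -/

theorem measurable_addPoint : Measurable fun z : Config E × E => addPoint z.1 z.2 := by
  refine measurable_config_iff.2 fun B hB => ?_
  simp only [addPoint, Measure.add_apply]
  exact ((measurable_eval hB).comp measurable_fst).add
    (((Measure.measurable_coe hB).comp Measure.measurable_dirac).comp measurable_snd)

theorem measurable_ofTuple {n : ℕ} : Measurable (ofTuple : (Fin n → E) → Config E) := by
  refine measurable_config_iff.2 fun B hB => ?_
  simp only [ofTuple, Measure.finsetSum_apply]
  exact Finset.measurable_sum _ fun i _ =>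
    ((Measure.measurable_coe hB).comp Measure.measurable_dirac).comp (measurable_pi_apply i)

/-- The identity, as a kernel from configurations to points. -/
def pointKernel (E : Type u) [MeasurableSpace E] : Kernel (Config E) E :=
  ⟨Subtype.val, measurable_subtype_coe⟩

@[simp] theorem pointKernel_apply (η : Config E) : pointKernel E η = η.1 := rfl

/-- Restricting to configurations with exactly n points gives a kernel of mass at most n; the kernel
is the sum of these pieces. This makes parametric integrals against configurations measurable. -/
instance : IsSFiniteKernel (pointKernel E) := by
  classical
  have hm : ∀ n : ℕ, MeasurableSet {η : Config E | size η = n} := fun n =>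
    measurable_size (measurableSet_singleton n)
  refine ⟨⟨fun n => Kernel.piecewise (hm n) (pointKernel E) 0, fun n => ⟨n, by simp, ?_⟩, ?_⟩⟩
  · intro η
    rw [Kernel.piecewise_apply]
    split_ifs with h
    · rw [pointKernel_apply, ← coe_size, h]
    · simp
  · ext η B hB
    rw [Kernel.sum_apply, Measure.sum_apply _ hB, tsum_eq_single (size η)]
    · simp [Kernel.piecewise_apply]
    · intro n hn
      simp [Kernel.piecewise_apply, hn.symm]

theorem measurable_lintegral_config {X : Type*} [MeasurableSpace X] {g : X → Config E}
    (hg : Measurable g) {f : X → E → ℝ≥0∞} (hf : Measurable (Function.uncurry f)) :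
    Measurable fun z => ∫⁻ y, f z y ∂(g z).1 :=
  hf.lintegral_kernel_prod_right (κ := (pointKernel E).comap g hg)

-- Sets avoiding x impose no condition, and a set containing x has at least the mass of `{x}`. The
-- singleton form is what makes the condition measurable in (η, x).
open Classical in
theorem dirac_le_iff [MeasurableSingletonClass E] (η : Config E) (x : E) :
    Measure.dirac x ≤ η.1 ↔ 1 ≤ η.1 {x} := by
  refine ⟨fun h => by simpa using h {x}, fun h => Measure.le_iff.2 fun s hs => ?_⟩
  rw [Measure.dirac_apply' _ hs, Set.indicator_apply]
  split_ifs with hxs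
  · exact h.trans (measure_mono (singleton_subset_iff.2 hxs))
  · exact bot_le

theorem measurable_removePoint [StandardBorelSpace E] :
    Measurable fun z : Config E × E => removePoint z.1 z.2 := by
  classical
  have hD : MeasurableSet {z : Config E × E | Measure.dirac z.2 ≤ z.1.1} := by
    simp only [dirac_le_iff]
    have h1 : Measurable fun z : Config E × E => ∫⁻ y, ({z.2} : Set E).indicator 1 y ∂z.1.1 := by
      refine measurable_lintegral_config measurable_fst (f := fun z y => ({z.2} : Set E).indicator 1 y) ?_
      have : MeasurableSet {w : (Config E × E) × E | w.2 = w.1.2} :=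
        measurableSet_eq_fun measurable_snd (measurable_snd.comp measurable_fst)
      exact measurable_one.indicator this
    have h2 : ∀ z : Config E × E, ∫⁻ y, ({z.2} : Set E).indicator 1 y ∂z.1.1 = z.1.1 {z.2} :=
      fun z => lintegral_indicator_one (measurableSet_singleton _)
    simp only [h2] at h1
    exact measurableSet_le measurable_const h1
  refine measurable_config_iff.2 fun B hB => ?_
  have : (fun z : Config E × E => (removePoint z.1 z.2).1 B) =
      fun z => if z ∈ {z : Config E × E | Measure.dirac z.2 ≤ z.1.1} then
        z.1.1 B - Measure.dirac z.2 B else z.1.1 B := by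
    ext z
    by_cases h : Measure.dirac z.2 ≤ z.1.1
    · simp [removePoint, h, Measure.sub_apply hB h]
    · simp [removePoint, h]
  rw [this]
  have h3 : Measurable fun z : Config E × E => z.1.1 B := (measurable_eval hB).comp measurable_fst
  exact Measurable.ite hD (h3.sub
    (((Measure.measurable_coe hB).comp Measure.measurable_dirac).comp measurable_snd)) h3

theorem measurable_move [StandardBorelSpace E] :
    Measurable fun z : Config E × E × E => move z.1 z.2.1 z.2.2 :=
  measurable_addPoint.comp ((measurable_removePoint.comp
    (measurable_fst.prodMk measurable_snd.fst)).prodMk measurable_snd.snd)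

/-- The partitions refine each other: a set of the coarser one is a union of sets of the finer one.
-/
theorem countablePartition_subset_or_disjoint [MeasurableSpace.CountablyGenerated E] {n m : ℕ}
    (hnm : n ≤ m) {s t : Set E} (hs : s ∈ MeasurableSpace.countablePartition E n)
    (ht : t ∈ MeasurableSpace.countablePartition E m) : t ⊆ s ∨ Disjoint t s := by
  have hmono : Monotone fun n => MeasurableSpace.generateFrom
      (MeasurableSpace.countablePartition E n) :=
    monotone_nat_of_le_succ fun n => MeasurableSpace.generateFrom_countablePartition_le_succ E n
  have h := hmono hnm s (MeasurableSpace.measurableSet_generateFrom hs)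
  rw [MeasurableSpace.measurableSet_generateFrom_countablePartition_iff] at h
  obtain ⟨S, hS, rfl⟩ := h
  by_cases htS : t ∈ (S : Set (Set E))
  · exact Or.inl (subset_sUnion_of_mem htS)
  · refine Or.inr (disjoint_sUnion_right.2 fun a ha => ?_)
    refine MeasurableSpace.disjoint_countablePartition ht (hS ha) ?_
    rintro rfl
    exact htS ha

/-- The atoms of an increasing sequence of finite partitions generating the `σ`-algebra. -/
def partitionSets (E : Type u) [MeasurableSpace E] [MeasurableSpace.CountablyGenerated E] :
    Set (Set E) := ⋃ n, MeasurableSpace.countablePartition E n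

/-! ### Counts on a countable π-system separate configurations. -/

section Partition

variable [MeasurableSpace.CountablyGenerated E]

theorem countable_partitionSets : (partitionSets E).Countable :=
  countable_iUnion fun n => (MeasurableSpace.finite_countablePartition E n).countable

theorem measurableSet_partitionSets {B : Set E} (hB : B ∈ partitionSets E) : MeasurableSet B := by
  obtain ⟨n, hn⟩ := mem_iUnion.1 hB
  exact MeasurableSpace.measurableSet_countablePartition n hn

theorem isPiSystem_partitionSets : IsPiSystem (partitionSets E) := by
  have key : ∀ n m, n ≤ m → ∀ s ∈ MeasurableSpace.countablePartition E n,
      ∀ t ∈ MeasurableSpace.countablePartition E m, (s ∩ t).Nonempty → s ∩ t ∈ partitionSets E := by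
    intro n m hnm s hs t ht hst
    rcases countablePartition_subset_or_disjoint hnm hs ht with h | h
    · rw [inter_eq_right.2 h]
      exact mem_iUnion.2 ⟨m, ht⟩
    · exact absurd hst (not_nonempty_iff_eq_empty.2 (disjoint_iff_inter_eq_empty.1 h.symm))
  intro s hs t ht hst
  obtain ⟨n, hn⟩ := mem_iUnion.1 hs
  obtain ⟨m, hm⟩ := mem_iUnion.1 ht
  rcases le_total n m with h | h
  · exact key n m h s hn t hm hst
  · rw [inter_comm] at hst ⊢
    exact key m n h t hm s hn hst

theorem generateFrom_partitionSets :
    MeasurableSpace.generateFrom (partitionSets E) = ‹MeasurableSpace E› :=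
  MeasurableSpace.generateFrom_iUnion_countablePartition E

theorem univ_mem_partitionSets [Nonempty E] : univ ∈ partitionSets E := by
  obtain ⟨x⟩ := ‹Nonempty E›
  refine mem_iUnion.2 ⟨0, ?_⟩
  have h := MeasurableSpace.sUnion_countablePartition E 0
  simp [MeasurableSpace.countablePartition, memPartition]

/-- Finite measures are determined by their values on the generating π-system `partitionSets E`, so
the countably many events `count B η = k` with B in it separate points. -/
instance : MeasurableSpace.CountablySeparated (Config E) := by
  let T : Set (Set (Config E)) :=
    (fun p : Set E × ℕ => {η | count p.1 η = p.2}) '' ((partitionSets E) ×ˢ univ)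
  refine ⟨⟨T, (countable_partitionSets.prod countable_univ).image _, ?_, ?_⟩⟩
  · rintro _ ⟨⟨B, k⟩, ⟨hB, -⟩, rfl⟩
    exact measurable_count (measurableSet_partitionSets hB) (measurableSet_singleton k)
  · intro η _ ξ _ h
    have h1 : ∀ B ∈ partitionSets E, η.1 B = ξ.1 B := by
      intro B hB
      rw [← coe_count (measurableSet_partitionSets hB), ← coe_count (measurableSet_partitionSets hB)]
      congr 1
      exact ((h _ ⟨⟨B, count B η⟩, ⟨hB, mem_univ _⟩, rfl⟩).1 rfl).symm
    refine Subtype.ext ?_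
    rcases isEmpty_or_nonempty E with hE | hE
    · exact Subsingleton.elim _ _
    · exact ext_of_generate_finite _ generateFrom_partitionSets.symm isPiSystem_partitionSets h1
        (h1 univ univ_mem_partitionSets)

end Partition

/-- A function of configurations is measurable if it is measurable in the positions of the points,
for each number of points. -/
theorem measurable_of_ofTuple [StandardBorelSpace E] {Y : Type*} [MeasurableSpace Y]
    {F : Config E → Y} (h : ∀ n, Measurable fun x : Fin n → E => F (ofTuple x)) :
    Measurable F := by
  intro s hs
  have key : ∀ n : ℕ, MeasurableSet (F ⁻¹' s ∩ {η | size η = n}) := by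
    intro n
    have hn : MeasurableSet {η : Config E | size η = n} :=
      measurable_size (measurableSet_singleton n)
    let g : (Fin n → E) → {η : Config E | size η = n} := fun x => ⟨ofTuple x, size_ofTuple x⟩
    have hg : Measurable g := measurable_ofTuple.subtype_mk
    have hsurj : Function.Surjective g := by
      rintro ⟨η, hη⟩
      obtain ⟨x, hx⟩ := exists_ofTuple_size η hη
      exact ⟨x, Subtype.ext hx⟩
    have : MeasurableSpace.CountablySeparated {η : Config E | size η = n} :=
      MeasurableSpace.Subtype.countablySeparated (α := Config E)
    -- The domain of g is standard Borel and its target countably separated, so measurability of a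
    -- set can be tested on its preimage under the surjection g: the set and its complement are both
    -- analytic.
    have h1 : MeasurableSet (Subtype.val ⁻¹' (F ⁻¹' s) : Set {η : Config E | size η = n}) :=
      (hg.measurableSet_preimage_iff_of_surjective hsurj).1 (h n hs)
    have h2 : MeasurableSet (Subtype.val '' (Subtype.val ⁻¹' (F ⁻¹' s) :
        Set {η : Config E | size η = n})) := hn.subtype_image h1
    rwa [Subtype.image_preimage_coe, inter_comm] at h2
  have : F ⁻¹' s = ⋃ n : ℕ, F ⁻¹' s ∩ {η | size η = n} := by
    ext η
    simp
  rw [this]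
  exact MeasurableSet.iUnion key

end GSIP

end

noncomputable section

namespace GSIP

/-! ### Poissonization of a Markov chain with a conserved quantity -/

section Poissonization

variable {S : Type*} [MeasurableSpace S] {σ : S → ℕ} {Q : Kernel S S} {Λ : ℕ → ℝ≥0}

/-- Measurable functions that are bounded on the level sets of `σ`. -/
structure LevelBdd (σ : S → ℕ) (f : S → ℝ) : Prop where
  measurable : Measurable f
  bounded : ∀ n, ∃ C, ∀ η, σ η = n → |f η| ≤ C

theorem LevelBdd.of_bounded {f : S → ℝ} (hf : Measurable f) (hb : ∃ C, ∀ η, |f η| ≤ C) :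
    LevelBdd σ f :=
  ⟨hf, fun _ => hb.imp fun _ hC η _ => hC η⟩

theorem LevelBdd.integrable {f : S → ℝ} (hf : LevelBdd σ f) {μ : Measure S} [IsFiniteMeasure μ]
    {n : ℕ} (h : ∀ᵐ ξ ∂μ, σ ξ = n) : Integrable f μ := by
  obtain ⟨C, hC⟩ := hf.bounded n
  exact Integrable.of_bound hf.measurable.aestronglyMeasurable C (h.mono fun ξ hξ => hC ξ hξ)

theorem abs_integral_le_of_level {f : S → ℝ} {C : ℝ} {n : ℕ} {μ : Measure S}
    [IsProbabilityMeasure μ] (hC : ∀ η, σ η = n → |f η| ≤ C) (h : ∀ᵐ ξ ∂μ, σ ξ = n) :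
    |∫ ξ, f ξ ∂μ| ≤ C := by
  have := norm_integral_le_of_norm_le_const (μ := μ) (f := f) (C := C) (h.mono fun ξ hξ => hC ξ hξ)
  simpa using this

instance isMarkovKernel_pow [IsMarkovKernel Q] (k : ℕ) : IsMarkovKernel (Q ^ k) := by
  induction k with
  | zero => rw [pow_zero]; exact inferInstanceAs (IsMarkovKernel Kernel.id)
  | succ k ih => rw [pow_succ]; exact inferInstanceAs (IsMarkovKernel ((Q ^ k) ∘ₖ Q))

theorem pow_succ_eq_comp (Q : Kernel S S) (k : ℕ) : Q ^ (k + 1) = (Q ^ k) ∘ₖ Q := pow_succ Q k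

theorem ae_pow_level (hσ : Measurable σ) (hQ : ∀ η, ∀ᵐ ξ ∂Q η, σ ξ = σ η) (k : ℕ) (η : S) :
    ∀ᵐ ξ ∂(Q ^ k) η, σ ξ = σ η := by
  induction k generalizing η with
  | zero =>
    change ∀ᵐ ξ ∂(Kernel.id η), σ ξ = σ η
    rw [Kernel.id_apply, ae_dirac_iff (measurableSet_eq_fun hσ measurable_const)]
  | succ k ih =>
    rw [pow_succ_eq_comp, Kernel.ae_comp_iff (measurableSet_eq_fun hσ measurable_const)]
    filter_upwards [hQ η] with ξ hξ
    rw [← hξ]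
    exact ih ξ

/-- The Poisson weights. -/
def poissonWeight (r : ℝ≥0) (k : ℕ) : ℝ≥0∞ := poissonMeasure r {k}

theorem toReal_poissonWeight (r : ℝ≥0) (k : ℕ) :
    (poissonWeight r k).toReal = Real.exp (-r) * r ^ k / k.factorial :=
  poissonMeasure_real_singleton r k

theorem tsum_poissonWeight (r : ℝ≥0) : ∑' k, poissonWeight r k = 1 := by
  have h := Measure.tsum_indicator_apply_singleton (poissonMeasure r) univ MeasurableSet.univ
  simpa [poissonWeight] using h

theorem summable_poissonWeight (r : ℝ≥0) : Summable fun k => (poissonWeight r k).toReal :=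
  ENNReal.summable_toReal (by simp [tsum_poissonWeight])

/-- The transition kernels of the continuous time Markov chain that makes a step of the chain `Q`
with rate `Λ (σ η)`. -/
def poissonized (hσ : Measurable σ) (Q : Kernel S S) (Λ : ℕ → ℝ≥0) (t : ℝ≥0) : Kernel S S where
  toFun η := Measure.sum fun k => poissonWeight (Λ (σ η) * t) k • (Q ^ k) η
  measurable' := by
    refine Measure.measurable_of_measurable_coe _ fun B hB => ?_
    simp only [Measure.sum_apply _ hB, Measure.smul_apply, smul_eq_mul]
    refine Measurable.tsum fun k => Measurable.mul ?_ ((Q ^ k).measurable_coe hB)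
    exact (measurable_of_countable fun n => poissonWeight (Λ n * t) k).comp hσ

theorem poissonized_apply (hσ : Measurable σ) (t : ℝ≥0) (η : S) :
    poissonized hσ Q Λ t η = Measure.sum fun k => poissonWeight (Λ (σ η) * t) k • (Q ^ k) η := rfl

theorem poissonized_apply' (hσ : Measurable σ) (t : ℝ≥0) (η : S) {B : Set S}
    (hB : MeasurableSet B) :
    poissonized hσ Q Λ t η B = ∑' k, poissonWeight (Λ (σ η) * t) k * (Q ^ k) η B := by
  simp [poissonized_apply, Measure.sum_apply _ hB]

instance isMarkovKernel_poissonized [IsMarkovKernel Q] (hσ : Measurable σ) (t : ℝ≥0) :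
    IsMarkovKernel (poissonized hσ Q Λ t) :=
  ⟨fun η => ⟨by simp [poissonized_apply' hσ t η MeasurableSet.univ, tsum_poissonWeight]⟩⟩

theorem ae_poissonized_level (hσ : Measurable σ) (hQ : ∀ η, ∀ᵐ ξ ∂Q η, σ ξ = σ η) (t : ℝ≥0)
    (η : S) : ∀ᵐ ξ ∂poissonized hσ Q Λ t η, σ ξ = σ η := by
  rw [poissonized_apply, Measure.ae_sum_iff]
  exact fun k => Measure.ae_smul_measure (ae_pow_level hσ hQ k η) _

theorem lintegral_poissonized (hσ : Measurable σ) (t : ℝ≥0) (η : S) (f : S → ℝ≥0∞) :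
    ∫⁻ ξ, f ξ ∂poissonized hσ Q Λ t η =
      ∑' k, poissonWeight (Λ (σ η) * t) k * ∫⁻ ξ, f ξ ∂(Q ^ k) η := by
  simp [poissonized_apply, lintegral_sum_measure]

theorem poissonWeight_zero (k : ℕ) : poissonWeight 0 k = if k = 0 then 1 else 0 := by
  rw [poissonWeight, poissonMeasure_singleton]
  rcases k with _ | k <;> simp

theorem poissonized_zero (hσ : Measurable σ) : poissonized hσ Q Λ 0 = Kernel.id := by
  ext η B hB
  rw [poissonized_apply' hσ 0 η hB, tsum_eq_single 0]
  · simp [poissonWeight_zero]; rfl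
  · intro k hk
    simp [poissonWeight_zero, hk]

section Integral

variable [IsMarkovKernel Q] (hσ : Measurable σ) (hQ : ∀ η, ∀ᵐ ξ ∂Q η, σ ξ = σ η)
include hσ hQ

theorem integral_poissonized {f : S → ℝ} (hf : LevelBdd σ f) (t : ℝ≥0) (η : S) :
    ∫ ξ, f ξ ∂poissonized hσ Q Λ t η =
      ∑' k, (poissonWeight (Λ (σ η) * t) k).toReal * ∫ ξ, f ξ ∂(Q ^ k) η := by
  have h := hf.integrable (ae_poissonized_level (Λ := Λ) hσ hQ t η)
  rw [poissonized_apply] at h ⊢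
  rw [integral_sum_measure h]
  simp [integral_smul_measure]

theorem LevelBdd.poissonized {f : S → ℝ} (hf : LevelBdd σ f) (t : ℝ≥0) :
    LevelBdd σ fun η => ∫ ξ, f ξ ∂poissonized hσ Q Λ t η := by
  refine ⟨?_, fun n => ?_⟩
  · exact (hf.measurable.stronglyMeasurable.integral_kernel
      (κ := GSIP.poissonized hσ Q Λ t)).measurable
  · obtain ⟨C, hC⟩ := hf.bounded n
    refine ⟨C, fun η hη => ?_⟩
    subst hη
    exact abs_integral_le_of_level hC (ae_poissonized_level hσ hQ t η)

theorem integral_pow_succ {f : S → ℝ} (hf : LevelBdd σ f) (k : ℕ) (η : S) :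
    ∫ ξ, f ξ ∂(Q ^ (k + 1)) η = ∫ ζ, ∫ ξ, f ξ ∂(Q ^ k) ζ ∂Q η := by
  have h := hf.integrable (ae_pow_level hσ hQ (k + 1) η)
  rw [pow_succ_eq_comp] at h ⊢
  exact Kernel.integral_comp h

/-- A step of Q does not change σ, hence not the Poisson weights, so averaging over this step only
shifts the exponent of Q by one. Boundedness of f on the level justifies exchanging sum and
integral. -/
theorem integral_integral_poissonized {f : S → ℝ} (hf : LevelBdd σ f) (t : ℝ≥0) (η : S) :
    ∫ ζ, ∫ ξ, f ξ ∂poissonized hσ Q Λ t ζ ∂Q η =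
      ∑' k, (poissonWeight (Λ (σ η) * t) k).toReal * ∫ ξ, f ξ ∂(Q ^ (k + 1)) η := by
  obtain ⟨C, hC⟩ := hf.bounded (σ η)
  have h1 : ∫ ζ, ∫ ξ, f ξ ∂poissonized hσ Q Λ t ζ ∂Q η =
      ∫ ζ, ∑' k, (poissonWeight (Λ (σ η) * t) k).toReal * ∫ ξ, f ξ ∂(Q ^ k) ζ ∂Q η := by
    refine integral_congr_ae ((hQ η).mono fun ζ hζ => ?_)
    simp only
    rw [integral_poissonized hσ hQ hf, hζ]
  have hb : ∀ k, ∀ᵐ ζ ∂Q η, |∫ ξ, f ξ ∂(Q ^ k) ζ| ≤ C := by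
    intro k
    filter_upwards [hQ η] with ζ hζ
    refine abs_integral_le_of_level hC ?_
    rw [← hζ]
    exact ae_pow_level hσ hQ k ζ
  have hm : ∀ k, AEStronglyMeasurable (fun ζ => ∫ ξ, f ξ ∂(Q ^ k) ζ) (Q η) := fun k =>
    (hf.measurable.stronglyMeasurable.integral_kernel (κ := Q ^ k)).aestronglyMeasurable
  have hint : ∀ k, Integrable (fun ζ => (poissonWeight (Λ (σ η) * t) k).toReal *
      ∫ ξ, f ξ ∂(Q ^ k) ζ) (Q η) := fun k =>
    (Integrable.of_bound (hm k) C (hb k)).const_mul _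
  rw [h1, ← integral_tsum_of_summable_integral_norm hint]
  · refine tsum_congr fun k => ?_
    rw [integral_const_mul, integral_pow_succ hσ hQ hf]
  · refine Summable.of_nonneg_of_le (fun k => integral_nonneg fun _ => norm_nonneg _) (fun k => ?_)
      ((summable_poissonWeight (Λ (σ η) * t)).mul_right C)
    calc ∫ ζ, ‖(poissonWeight (Λ (σ η) * t) k).toReal * ∫ ξ, f ξ ∂(Q ^ k) ζ‖ ∂Q η
        ≤ ∫ _, (poissonWeight (Λ (σ η) * t) k).toReal * C ∂Q η := by
          refine integral_mono_ae (hint k).norm (integrable_const _) ?_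
          filter_upwards [hb k] with ζ hζ
          rw [norm_mul, Real.norm_of_nonneg ENNReal.toReal_nonneg]
          exact mul_le_mul_of_nonneg_left hζ ENNReal.toReal_nonneg
      _ = _ := by simp

end Integral

/-- The weights π_k satisfy π_k' = r(π_{k-1} − π_k), and reindexing moves the shift onto g. The
exponential is factored out, so only a power series has to be differentiated term by term. -/
theorem hasDerivAt_poisson_series {g : ℕ → ℝ} {C : ℝ} (hg : ∀ k, |g k| ≤ C) (r t : ℝ) :
    HasDerivAt (fun s : ℝ => ∑' k : ℕ, Real.exp (-(r * s)) * (r * s) ^ k / k.factorial * g k)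
      (r * ((∑' k : ℕ, Real.exp (-(r * t)) * (r * t) ^ k / k.factorial * g (k + 1)) -
        ∑' k : ℕ, Real.exp (-(r * t)) * (r * t) ^ k / k.factorial * g k)) t := by
  have hC : 0 ≤ C := (abs_nonneg _).trans (hg 0)
  have hsum : ∀ (y : ℝ) (a : ℕ → ℝ), (∀ k, |a k| ≤ C) →
      Summable fun k : ℕ => y ^ k / k.factorial * a k := by
    intro y a ha
    refine Summable.of_norm_bounded ((Real.summable_pow_div_factorial |y|).mul_right C) fun k => ?_
    rw [norm_mul, norm_div, norm_pow, Real.norm_eq_abs, Real.norm_eq_abs, Real.norm_eq_abs,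
      Nat.abs_cast]
    exact mul_le_mul_of_nonneg_left (ha k) (by positivity)
  have hF : HasDerivAt (fun s : ℝ => ∑' k : ℕ, (r * s) ^ k / k.factorial * g k)
      (r * ∑' k : ℕ, (r * t) ^ k / k.factorial * g (k + 1)) t := by
    -- The derivatives of the terms, and below a summable majorant `u` valid on the ball of radius
    -- |t| + 1, a connected neighbourhood of t.
    let g' : ℕ → ℝ → ℝ := fun k s => match k with
      | 0 => 0
      | k + 1 => r * ((r * s) ^ k / k.factorial * g (k + 1))
    let u : ℕ → ℝ := fun k => match k with
      | 0 => 0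
      | k + 1 => |r| * ((|r| * (|t| + 1)) ^ k / k.factorial * C)
    have hu : Summable u := by
      rw [← summable_nat_add_iff 1]
      exact ((Real.summable_pow_div_factorial _).mul_right C).mul_left _
    have hder : ∀ k y, y ∈ Metric.ball (0 : ℝ) (|t| + 1) →
        HasDerivAt (fun s : ℝ => (r * s) ^ k / k.factorial * g k) (g' k y) y := by
      intro k y _
      rcases k with _ | k
      · simpa [g'] using hasDerivAt_const y (g 0)
      · have h1 : HasDerivAt (fun s : ℝ => r * s) r y := by
          simpa using (hasDerivAt_id y).const_mul r
        refine (((h1.pow (k + 1)).div_const ((k + 1).factorial : ℝ)).mul_const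
          (g (k + 1))).congr_deriv ?_
        simp only [g', Nat.factorial_succ, Nat.cast_mul, add_tsub_cancel_right]
        have : ((k + 1 : ℕ) : ℝ) ≠ 0 := by positivity
        have : (k.factorial : ℝ) ≠ 0 := by positivity
        field_simp
    have hbd : ∀ k y, y ∈ Metric.ball (0 : ℝ) (|t| + 1) → ‖g' k y‖ ≤ u k := by
      intro k y hy
      have hy' : |y| ≤ |t| + 1 := by simpa using (mem_ball_zero_iff.1 hy).le
      rcases k with _ | k
      · simp [g', u]
      · simp only [g', u, norm_mul, norm_div, norm_pow, Real.norm_eq_abs, Nat.abs_cast]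
        gcongr
        exact hg _
    have ht : t ∈ Metric.ball (0 : ℝ) (|t| + 1) := by simp
    have h := hasDerivAt_tsum_of_isPreconnected hu Metric.isOpen_ball
      (convex_ball (0 : ℝ) (|t| + 1)).isPreconnected hder hbd ht (hsum (r * t) g hg) ht
    refine h.congr_deriv ?_
    rw [(hu.of_norm_bounded (fun k => hbd k t ht)).tsum_eq_zero_add]
    simp only [g', zero_add]
    rw [tsum_mul_left]
  have hE : HasDerivAt (fun s : ℝ => Real.exp (-(r * s))) (-r * Real.exp (-(r * t))) t := by
    have h1 : HasDerivAt (fun s : ℝ => -(r * s)) (-r) t := by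
      simpa using (hasDerivAt_id t).const_mul (-r)
    simpa [mul_comm] using h1.exp
  have hrw : ∀ (s : ℝ) (a : ℕ → ℝ),
      ∑' k : ℕ, Real.exp (-(r * s)) * (r * s) ^ k / k.factorial * a k =
        Real.exp (-(r * s)) * ∑' k : ℕ, (r * s) ^ k / k.factorial * a k := by
    intro s a
    rw [← tsum_mul_left]
    refine tsum_congr fun k => ?_
    ring
  rw [hrw t g, hrw t fun k => g (k + 1)]
  simp only [hrw _ g]
  refine (hE.mul hF).congr_deriv ?_
  ring

/-! ### Backward equation, uniqueness, and the semigroup property. -/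

section Backward

variable [IsMarkovKernel Q] (hσ : Measurable σ) (hQ : ∀ η, ∀ᵐ ξ ∂Q η, σ ξ = σ η)
include hσ hQ

theorem hasDerivWithinAt_poissonized {f : S → ℝ} (hf : LevelBdd σ f) (t : ℝ≥0) (η : S) :
    HasDerivWithinAt (fun s : ℝ => ∫ ξ, f ξ ∂poissonized hσ Q Λ s.toNNReal η)
      (Λ (σ η) * (∫ ζ, ∫ ξ, f ξ ∂poissonized hσ Q Λ t ζ ∂Q η -
        ∫ ξ, f ξ ∂poissonized hσ Q Λ t η)) (Ici 0) t := by
  obtain ⟨C, hC⟩ := hf.bounded (σ η)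
  have hg : ∀ k, |∫ ξ, f ξ ∂(Q ^ k) η| ≤ C := fun k =>
    abs_integral_le_of_level hC (ae_pow_level hσ hQ k η)
  have h := (hasDerivAt_poisson_series hg (Λ (σ η)) t).hasDerivWithinAt (s := Ici 0)
  have hrw : ∀ s : ℝ, 0 ≤ s → ∫ ξ, f ξ ∂poissonized hσ Q Λ s.toNNReal η =
      ∑' k : ℕ, Real.exp (-(Λ (σ η) * s)) * (Λ (σ η) * s) ^ k / k.factorial *
        ∫ ξ, f ξ ∂(Q ^ k) η := by
    intro s hs
    rw [integral_poissonized hσ hQ hf]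
    simp only [toReal_poissonWeight, NNReal.coe_mul, Real.coe_toNNReal s hs]
  rw [integral_integral_poissonized hσ hQ hf, integral_poissonized hσ hQ hf]
  simp only [toReal_poissonWeight, NNReal.coe_mul]
  exact h.congr (fun s hs => hrw s hs) (hrw t t.2)

omit hσ in
/-- Bounded solutions of the backward equation are determined by their initial values. -/
theorem backward_unique {u : ℝ≥0 → S → ℝ} (hb : ∀ n, ∃ C, ∀ t η, σ η = n → |u t η| ≤ C)
    (h0 : ∀ η, u 0 η = 0)
    (hu : ∀ t η, HasDerivWithinAt (fun s : ℝ => u s.toNNReal η)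
      (Λ (σ η) * (∫ ζ, u t ζ ∂Q η - u t η)) (Ici 0) (t : ℝ)) (t : ℝ≥0) (η : S) : u t η = 0 := by
  obtain ⟨C, hC⟩ := hb (σ η)
  -- Picard iteration on one level set: a bound on u there bounds its time derivative by 2Λ times as
  -- much, the 2 coming from the two terms of Q − 1, and integrating raises k by one. Letting k tend
  -- to infinity gives u = 0.
  have key : ∀ k : ℕ, ∀ (t : ℝ≥0) ξ, σ ξ = σ η →
      |u t ξ| ≤ C * ((2 * Λ (σ η) * t) ^ k / k.factorial) := by
    intro k
    induction k with
    | zero => intro t ξ hξ; simpa using hC t ξ hξ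
    | succ k ih =>
      intro t ξ hξ
      have hbound : ∀ x ∈ Ico (0 : ℝ) t, ‖(Λ (σ ξ) : ℝ) * (∫ ζ, u x.toNNReal ζ ∂Q ξ -
          u x.toNNReal ξ)‖ ≤ C * (2 * Λ (σ η)) * ((2 * Λ (σ η) * x) ^ k / k.factorial) := by
        intro x hx
        have h1 := ih x.toNNReal ξ hξ
        have h2 : |∫ ζ, u x.toNNReal ζ ∂Q ξ| ≤
            C * ((2 * Λ (σ η) * x.toNNReal) ^ k / k.factorial) :=
          abs_integral_le_of_level (n := σ η) (ih x.toNNReal) (by rw [← hξ]; exact hQ ξ)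
        rw [Real.coe_toNNReal x hx.1] at h1 h2
        rw [norm_mul, Real.norm_eq_abs, Real.norm_eq_abs, hξ, NNReal.abs_eq]
        calc (Λ (σ η) : ℝ) * |∫ ζ, u x.toNNReal ζ ∂Q ξ - u x.toNNReal ξ|
            ≤ Λ (σ η) * (C * ((2 * Λ (σ η) * x) ^ k / k.factorial) +
              C * ((2 * Λ (σ η) * x) ^ k / k.factorial)) := by
              gcongr
              exact (abs_sub _ _).trans (add_le_add h2 h1)
          _ = _ := by ring
      have hder : ∀ x : ℝ, 0 ≤ x → HasDerivWithinAt (fun s : ℝ => u s.toNNReal ξ)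
          (Λ (σ ξ) * (∫ ζ, u x.toNNReal ζ ∂Q ξ - u x.toNNReal ξ)) (Ici 0) x := by
        intro x hx
        have := hu x.toNNReal ξ
        rwa [Real.coe_toNNReal x hx] at this
      have hB : ∀ x : ℝ, HasDerivAt
          (fun s : ℝ => C * ((2 * Λ (σ η) * s) ^ (k + 1) / (k + 1).factorial))
          (C * (2 * Λ (σ η)) * ((2 * Λ (σ η) * x) ^ k / k.factorial)) x := by
        intro x
        have h1 : HasDerivAt (fun s : ℝ => 2 * (Λ (σ η) : ℝ) * s) (2 * Λ (σ η)) x := by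
          simpa using (hasDerivAt_id x).const_mul (2 * (Λ (σ η) : ℝ))
        refine (((h1.pow (k + 1)).div_const ((k + 1).factorial : ℝ)).const_mul C).congr_deriv ?_
        simp only [Nat.factorial_succ, Nat.cast_mul, add_tsub_cancel_right]
        have : ((k + 1 : ℕ) : ℝ) ≠ 0 := by positivity
        have : (k.factorial : ℝ) ≠ 0 := by positivity
        field_simp
      have h := image_norm_le_of_norm_deriv_right_le_deriv_boundary
        (f := fun s : ℝ => u s.toNNReal ξ) (a := 0) (b := t)
        (fun x hx => ((hder x hx.1).continuousWithinAt.mono Icc_subset_Ici_self))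
        (fun x hx => (hder x hx.1).mono (Ici_subset_Ici.2 hx.1))
        (by simp [h0]) hB hbound (right_mem_Icc.2 t.2)
      simpa using h
  have hlim : Filter.Tendsto (fun k : ℕ => C * ((2 * Λ (σ η) * t : ℝ) ^ k / k.factorial))
      Filter.atTop (nhds (C * 0)) :=
    (FloorSemiring.tendsto_pow_div_factorial_atTop _).const_mul C
  have := ge_of_tendsto' hlim fun k => key k t η rfl
  rw [mul_zero] at this
  exact abs_eq_zero.1 (le_antisymm this (abs_nonneg _))

/-- The difference of u and the Poisson mixture solves the equation with initial value 0 and is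
bounded on levels, so `backward_unique` applies. -/
theorem eq_poissonized_of_backward {f : S → ℝ} (hf : LevelBdd σ f) {u : ℝ≥0 → S → ℝ}
    (hm : ∀ t, Measurable (u t)) (hb : ∀ n, ∃ C, ∀ t η, σ η = n → |u t η| ≤ C)
    (h0 : ∀ η, u 0 η = f η)
    (hu : ∀ t η, HasDerivWithinAt (fun s : ℝ => u s.toNNReal η)
      (Λ (σ η) * (∫ ζ, u t ζ ∂Q η - u t η)) (Ici 0) (t : ℝ)) (t : ℝ≥0) (η : S) :
    u t η = ∫ ξ, f ξ ∂poissonized hσ Q Λ t η := by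
  have hub : ∀ t, LevelBdd σ (u t) := fun t =>
    ⟨hm t, fun n => (hb n).imp fun C hC η hη => hC t η hη⟩
  have := backward_unique (Λ := Λ) hQ
    (u := fun t η => u t η - ∫ ξ, f ξ ∂poissonized hσ Q Λ t η) ?_ ?_ ?_ t η
  · linarith
  · intro n
    obtain ⟨C, hC⟩ := hb n
    obtain ⟨D, hD⟩ := hf.bounded n
    refine ⟨C + D, fun t η hη => (abs_sub _ _).trans (add_le_add (hC t η hη) ?_)⟩
    subst hη
    exact abs_integral_le_of_level hD (ae_poissonized_level hσ hQ t η)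
  · intro η
    simp [h0, poissonized_zero, Kernel.id_apply, integral_dirac' _ _ hf.measurable.stronglyMeasurable]
  · intro t η
    refine ((hu t η).sub (hasDerivWithinAt_poissonized hσ hQ hf t η)).congr_deriv ?_
    rw [integral_sub ((hub t).integrable (hQ η))
      ((hf.poissonized (Λ := Λ) hσ hQ t).integrable (hQ η))]
    ring

/-- For fixed t, the family s ↦ P_{s+t} f solves the backward equation with initial value P_t f;
uniqueness identifies it with P_s(P_t f). -/
theorem integral_poissonized_add {f : S → ℝ} (hf : LevelBdd σ f) (s t : ℝ≥0) (η : S) :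
    ∫ ξ, f ξ ∂poissonized hσ Q Λ (s + t) η =
      ∫ ζ, ∫ ξ, f ξ ∂poissonized hσ Q Λ t ζ ∂poissonized hσ Q Λ s η := by
  refine eq_poissonized_of_backward hσ hQ (hf.poissonized hσ hQ t)
    (u := fun s η => ∫ ξ, f ξ ∂poissonized hσ Q Λ (s + t) η) (fun s =>
      (hf.poissonized hσ hQ (s + t)).measurable) ?_ (fun η => by rw [zero_add]) ?_ s η
  · intro n
    obtain ⟨D, hD⟩ := hf.bounded n
    refine ⟨D, fun s η hη => ?_⟩
    subst hη
    exact abs_integral_le_of_level hD (ae_poissonized_level hσ hQ (s + t) η)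
  · intro s η
    have h := hasDerivWithinAt_poissonized (Λ := Λ) hσ hQ hf (s + t) η
    have h2 : HasDerivWithinAt (fun r : ℝ => r + t) 1 (Ici 0) s :=
      ((hasDerivAt_id (s : ℝ)).add_const (t : ℝ)).hasDerivWithinAt
    have h3 := HasDerivWithinAt.comp (s : ℝ) (h₂ := fun r : ℝ =>
      ∫ ξ, f ξ ∂poissonized hσ Q Λ r.toNNReal η) (s' := Ici 0) (by simpa using h) h2
      (fun r hr => add_nonneg (mem_Ici.1 hr) t.2)
    rw [mul_one] at h3
    refine h3.congr (fun r hr => ?_) ?_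
    · simp only [Function.comp_apply]
      rw [Real.toNNReal_add (mem_Ici.1 hr) t.coe_nonneg, Real.toNNReal_coe]
    · simp only [Function.comp_apply]
      rw [Real.toNNReal_add s.coe_nonneg t.coe_nonneg, Real.toNNReal_coe,
        Real.toNNReal_coe]

theorem poissonized_add (s t : ℝ≥0) :
    poissonized hσ Q Λ (s + t) = poissonized hσ Q Λ t ∘ₖ poissonized hσ Q Λ s := by
  ext η B hB
  have hf : LevelBdd σ (B.indicator (1 : S → ℝ)) :=
    .of_bounded (measurable_one.indicator hB) ⟨1, fun η => by
      by_cases h : η ∈ B <;> simp [h]⟩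
  have h := integral_poissonized_add (Λ := Λ) hσ hQ hf s t η
  rw [← Kernel.integral_comp] at h
  · rw [integral_indicator_one hB, integral_indicator_one hB] at h
    exact (measureReal_eq_measureReal_iff).1 h
  · exact (integrable_indicator_iff hB).2 (integrable_const _).integrableOn

end Backward

end Poissonization

end GSIP

end

noncomputable section

namespace GSIP

universe u

variable {E : Type u} [MeasurableSpace E] [StandardBorelSpace E]

/-! ### The jump kernel of the generalized symmetric inclusion process -/

section Jump

variable (α : Measure E) [IsFiniteMeasure α] (c : E → E → ℝ≥0)

theorem measurable_move_config (η : Config E) : Measurable fun z : E × E => move η z.1 z.2 := by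
  have h : Measurable fun z : E × E => (η, z) := measurable_prodMk_left
  exact Measurable.comp (g := fun z : Config E × E × E => move z.1 z.2.1 z.2.2)
    (f := fun z : E × E => (η, z)) measurable_move h

/-- The measure of jump rates out of `η`. -/
def jumpMeasure (η : Config E) : Measure (Config E) :=
  ((η.1.prod (α + η.1)).withDensity fun z => c z.1 z.2).map fun z => move η z.1 z.2

variable {c} (hc : Measurable (Function.uncurry c))
include hc

theorem lintegral_jumpMeasure (η : Config E) {f : Config E → ℝ≥0∞} (hf : Measurable f) :
    ∫⁻ ξ, f ξ ∂jumpMeasure α c η = ∫⁻ x, ∫⁻ y, c x y * f (move η x y) ∂(α + η.1) ∂η.1 := by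
  have hm : Measurable fun z : E × E => move η z.1 z.2 := measurable_move_config η
  have hc' : Measurable fun z : E × E => (c z.1 z.2 : ℝ≥0∞) := hc.coe_nnreal_ennreal
  have hfm : Measurable fun z : E × E => f (move η z.1 z.2) := hf.comp hm
  have h1 := lintegral_prod (μ := η.1) (ν := α + η.1)
    (fun z : E × E => c z.1 z.2 * f (move η z.1 z.2)) (hc'.mul hfm).aemeasurable
  rw [jumpMeasure, lintegral_map hf hm, ← h1]
  exact lintegral_withDensity_eq_lintegral_mul _ hc' hfm

omit [StandardBorelSpace E] hc in
theorem measurable_lintegral_add_config {X : Type*} [MeasurableSpace X] {g : X → Config E}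
    (hg : Measurable g) {f : X → E → ℝ≥0∞} (hf : Measurable (Function.uncurry f)) :
    Measurable fun z => ∫⁻ y, f z y ∂(α + (g z).1) := by
  simp only [lintegral_add_measure]
  exact (hf.lintegral_prod_right' (ν := α)).add (measurable_lintegral_config hg hf)

theorem measurable_jumpMeasure : Measurable (jumpMeasure α c) := by
  refine Measure.measurable_of_measurable_coe _ fun B hB => ?_
  have h : ∀ η, jumpMeasure α c η B =
      ∫⁻ x, ∫⁻ y, c x y * B.indicator 1 (move η x y) ∂(α + η.1) ∂η.1 := fun η => by
    rw [← lintegral_jumpMeasure α hc η (measurable_one.indicator hB), lintegral_indicator_one hB]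
  simp only [h]
  refine measurable_lintegral_config measurable_id
    (f := fun η x => ∫⁻ y, c x y * B.indicator 1 (move η x y) ∂(α + η.1)) ?_
  refine measurable_lintegral_add_config α (g := fun z : Config E × E => z.1) measurable_fst
    (f := fun z y => c z.2 y * B.indicator 1 (move z.1 z.2 y)) ?_
  have h1 : Measurable fun w : (Config E × E) × E => (c w.1.2 w.2 : ℝ≥0∞) :=
    (hc.comp (measurable_fst.snd.prodMk measurable_snd)).coe_nnreal_ennreal
  have h2 : Measurable fun w : (Config E × E) × E => move w.1.1 w.1.2 w.2 :=
    measurable_move.comp (g := fun z : Config E × E × E => move z.1 z.2.1 z.2.2)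
      (f := fun w : (Config E × E) × E => (w.1.1, w.1.2, w.2))
      (measurable_fst.fst.prodMk (measurable_fst.snd.prodMk measurable_snd))
  exact h1.mul ((measurable_one.indicator hB).comp h2)

end Jump

/-- A rate bounding the total jump rate of configurations of `n` points. -/
def rateBound (α : Measure E) (K : ℝ≥0) (n : ℕ) : ℝ≥0 := K * (n * (α.real univ).toNNReal + n * n) + 1

-- The summand 1 in the rate allows division by it even for the empty configuration or K = 0.
omit [StandardBorelSpace E] in
theorem rateBound_pos (α : Measure E) (K : ℝ≥0) (n : ℕ) : 0 < rateBound α K n := by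
  unfold rateBound; positivity

variable (α : Measure E) [IsFiniteMeasure α] {c : E → E → ℝ≥0}
  (hc : Measurable (Function.uncurry c)) {K : ℝ≥0}

/-- Replacing c by K, a configuration of n points has total rate at most K n (α(E) + n). -/
theorem jumpMeasure_univ_le (hc : Measurable (Function.uncurry c)) (hK : ∀ x y, c x y ≤ K)
    (η : Config E) : jumpMeasure α c η univ ≤ rateBound α K (size η) := by
  rw [← lintegral_one, lintegral_jumpMeasure α hc η measurable_const]
  calc ∫⁻ x, ∫⁻ y, c x y * 1 ∂(α + η.1) ∂η.1
      ≤ ∫⁻ _, ∫⁻ _, K ∂(α + η.1) ∂η.1 := by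
        gcongr with x y
        rw [mul_one]
        exact_mod_cast hK x y
    _ = K * (size η * α univ + size η * size η) := by
        simp only [lintegral_const, Measure.add_apply, ← coe_size]
        ring
    _ ≤ rateBound α K (size η) := by
        rw [rateBound]
        push_cast
        have : ((α.real univ).toNNReal : ℝ≥0∞) = α univ := by
          rw [measureReal_def, ENNReal.toNNReal_toReal_eq]
          simp
        rw [this]
        exact le_self_add

/-- The uniformized jump chain. -/
def jumpKernel (α : Measure E) [IsFiniteMeasure α] {c : E → E → ℝ≥0}
    (hc : Measurable (Function.uncurry c)) (K : ℝ≥0) : Kernel (Config E) (Config E) where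
  -- Uniformization: the part of the rate not used by genuine jumps is spent on staying at η, which
  -- the generator does not see.
  toFun η := (rateBound α K (size η) : ℝ≥0∞)⁻¹ • (jumpMeasure α c η +
    ((rateBound α K (size η) : ℝ≥0∞) - jumpMeasure α c η univ) • Measure.dirac η)
  measurable' := by
    refine Measure.measurable_of_measurable_coe _ fun B hB => ?_
    simp only [Measure.smul_apply, Measure.add_apply, smul_eq_mul]
    have h1 : Measurable fun η : Config E => (rateBound α K (size η) : ℝ≥0∞) :=
      (measurable_of_countable fun n => (rateBound α K n : ℝ≥0∞)).comp measurable_size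
    have h2 : ∀ {B}, MeasurableSet B → Measurable fun η => jumpMeasure α c η B := fun hB =>
      (Measure.measurable_coe hB).comp (measurable_jumpMeasure α hc)
    exact h1.inv.mul ((h2 hB).add ((h1.sub (h2 MeasurableSet.univ)).mul
      ((Measure.measurable_coe hB).comp Measure.measurable_dirac)))

theorem jumpKernel_apply (η : Config E) : jumpKernel α hc K η =
    (rateBound α K (size η) : ℝ≥0∞)⁻¹ • (jumpMeasure α c η +
    ((rateBound α K (size η) : ℝ≥0∞) - jumpMeasure α c η univ) • Measure.dirac η) := rfl

theorem isMarkovKernel_jumpKernel (hK : ∀ x y, c x y ≤ K) :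
    IsMarkovKernel (jumpKernel α hc K) := by
  refine ⟨fun η => ⟨?_⟩⟩
  have h0 : (rateBound α K (size η) : ℝ≥0∞) ≠ 0 := by simpa using (rateBound_pos α K _).ne'
  simp only [jumpKernel_apply, Measure.smul_apply, Measure.add_apply, smul_eq_mul, measure_univ,
    mul_one]
  rw [add_tsub_cancel_of_le (jumpMeasure_univ_le α hc hK η),
    ENNReal.inv_mul_cancel h0 ENNReal.coe_ne_top]

theorem ae_jumpMeasure_size (hc : Measurable (Function.uncurry c)) (η : Config E) :
    ∀ᵐ ξ ∂jumpMeasure α c η, size ξ = size η := by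
  have hm : MeasurableSet {ξ : Config E | ¬ size ξ = size η} :=
    (measurableSet_eq_fun measurable_size measurable_const).compl
  rw [ae_iff, ← lintegral_indicator_one hm,
    lintegral_jumpMeasure α hc η (measurable_one.indicator hm)]
  rw [lintegral_congr_ae (g := fun _ => 0)]
  · simp
  · filter_upwards [ae_size_move η] with x hx
    simp [hx]

theorem ae_jumpKernel_size (η : Config E) : ∀ᵐ ξ ∂jumpKernel α hc K η, size ξ = size η := by
  refine Measure.ae_smul_measure ?_ _
  rw [ae_add_measure_iff]
  refine ⟨ae_jumpMeasure_size α hc η, Measure.ae_smul_measure ?_ _⟩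
  rw [ae_dirac_iff (measurableSet_eq_fun measurable_size measurable_const)]

/-- The atom of the jump kernel at η contributes (Λ − total rate) f(η), which together with −Λ f(η)
leaves the loss term of L. This reduces everything about L to the Poissonized chain. -/
theorem generator_eq (hK : ∀ x y, c x y ≤ K) {f : Config E → ℝ} (hf : LevelBdd size f)
    (η : Config E) :
    generator α c f η = rateBound α K (size η) * (∫ ξ, f ξ ∂jumpKernel α hc K η - f η) := by
  have hle := jumpMeasure_univ_le α hc hK η
  have hfin : IsFiniteMeasure (jumpMeasure α c η) := ⟨hle.trans_lt ENNReal.coe_lt_top⟩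
  have hfi : Integrable f (jumpMeasure α c η) := hf.integrable (ae_jumpMeasure_size α hc η)
  have h0 : (rateBound α K (size η) : ℝ) ≠ 0 := by simpa using (rateBound_pos α K _).ne'
  have hm : Measurable fun z : E × E => move η z.1 z.2 := measurable_move_config η
  have hR : ∀ g : Config E → ℝ, LevelBdd size g →
      Integrable (fun z : E × E => (c z.1 z.2 : ℝ) * g (move η z.1 z.2)) (η.1.prod (α + η.1)) ∧
      ∫ ξ, g ξ ∂jumpMeasure α c η =
        ∫ x, ∫ y, (c x y : ℝ) * g (move η x y) ∂(α + η.1) ∂η.1 := by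
    intro g hg
    have hgi : Integrable g (jumpMeasure α c η) := hg.integrable (ae_jumpMeasure_size α hc η)
    have h1 : Integrable (fun z : E × E => (c z.1 z.2 : ℝ) * g (move η z.1 z.2))
        (η.1.prod (α + η.1)) := by
      rw [jumpMeasure, integrable_map_measure hg.measurable.aestronglyMeasurable hm.aemeasurable,
        integrable_withDensity_iff_integrable_smul (f := fun z : E × E => c z.1 z.2) hc] at hgi
      exact hgi
    refine ⟨h1, ?_⟩
    rw [jumpMeasure, integral_map hm.aemeasurable hg.measurable.aestronglyMeasurable,
      integral_withDensity_eq_integral_smul (f := fun z : E × E => c z.1 z.2) hc,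
      ← integral_prod _ h1]
    rfl
  obtain ⟨hi1, he1⟩ := hR f hf
  obtain ⟨hi2, he2⟩ := hR (fun _ => f η) (LevelBdd.of_bounded measurable_const ⟨_, fun _ => le_rfl⟩)
  have hgen : generator α c f η = ∫ ξ, f ξ ∂jumpMeasure α c η -
      (jumpMeasure α c η).real univ * f η := by
    -- The loss term is the integral of a constant, so `hR` writes gain and loss as integrals over
    -- the same product measure.
    have h3 : (jumpMeasure α c η).real univ * f η = ∫ _, f η ∂jumpMeasure α c η := by simp
    have h4 := integral_prod (fun z : E × E => (c z.1 z.2 : ℝ) * f (move η z.1 z.2) -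
      (c z.1 z.2 : ℝ) * f η) (hi1.sub hi2)
    rw [h3, he1, he2, ← integral_prod _ hi1, ← integral_prod _ hi2, ← integral_sub hi1 hi2, h4]
    refine integral_congr_ae (.of_forall fun x => integral_congr_ae (.of_forall fun y => ?_))
    simp only [move]
    ring
  have hker : ∫ ξ, f ξ ∂jumpKernel α hc K η = (rateBound α K (size η) : ℝ)⁻¹ *
      (∫ ξ, f ξ ∂jumpMeasure α c η +
        (rateBound α K (size η) - (jumpMeasure α c η).real univ) * f η) := by
    rw [jumpKernel_apply, integral_smul_measure, integral_add_measure hfi, integral_smul_measure,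
      integral_dirac' _ _ hf.measurable.stronglyMeasurable, ENNReal.toReal_sub_of_le hle
        ENNReal.coe_ne_top]
    · simp [measureReal_def]
    · refine Integrable.smul_measure ?_ (ne_top_of_le_ne_top ENNReal.coe_ne_top tsub_le_self)
      exact hf.integrable (n := size η)
        (by rw [ae_dirac_iff (measurableSet_eq_fun measurable_size measurable_const)])
  rw [hgen, hker]
  field_simp
  ring

/-! ### The semigroup -/

/-- The transition kernels of the generalized symmetric inclusion process. -/
def gsip (α : Measure E) [IsFiniteMeasure α] {c : E → E → ℝ≥0}
    (hc : Measurable (Function.uncurry c)) (K : ℝ≥0) (t : ℝ≥0) : Kernel (Config E) (Config E) :=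
  poissonized measurable_size (jumpKernel α hc K) (rateBound α K) t

section Semigroup

variable (hK : ∀ x y, c x y ≤ K)
include hK

theorem isMarkovKernel_gsip (t : ℝ≥0) : IsMarkovKernel (gsip α hc K t) :=
  have := isMarkovKernel_jumpKernel α hc hK
  isMarkovKernel_poissonized measurable_size t

theorem isMarkovSemigroup_gsip : IsMarkovSemigroup (gsip α hc K) where
  isMarkovKernel := isMarkovKernel_gsip α hc hK
  zero := poissonized_zero measurable_size
  add s t :=
    have := isMarkovKernel_jumpKernel α hc hK
    poissonized_add measurable_size (ae_jumpKernel_size α hc) s t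

omit hK in
theorem ae_gsip_size (t : ℝ≥0) (η : Config E) : ∀ᵐ ξ ∂gsip α hc K t η, size ξ = size η :=
  ae_poissonized_level measurable_size (ae_jumpKernel_size α hc) t η

omit hK in
theorem isConservative_gsip : IsConservative (gsip α hc K) := fun t η =>
  (ae_gsip_size α hc t η).mono fun ξ hξ => by rw [← coe_size, ← coe_size, hξ]

theorem LevelBdd.gsip {f : Config E → ℝ} (hf : LevelBdd size f) (t : ℝ≥0) :
    LevelBdd size fun η => ∫ ξ, f ξ ∂gsip α hc K t η :=
  have := isMarkovKernel_jumpKernel α hc hK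
  hf.poissonized measurable_size (ae_jumpKernel_size α hc) t

theorem LevelBdd.integrable_gsip {f : Config E → ℝ} (hf : LevelBdd size f) (t : ℝ≥0)
    (η : Config E) : Integrable f (GSIP.gsip α hc K t η) :=
  have := isMarkovKernel_gsip α hc hK t
  hf.integrable (ae_gsip_size α hc t η)

theorem hasDerivWithinAt_gsip {f : Config E → ℝ} (hf : LevelBdd size f) (t : ℝ≥0)
    (η : Config E) :
    HasDerivWithinAt (fun s : ℝ => ∫ ξ, f ξ ∂gsip α hc K s.toNNReal η)
      (generator α c (fun ζ => ∫ ξ, f ξ ∂gsip α hc K t ζ) η) (Ici 0) t := by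
  have := isMarkovKernel_jumpKernel α hc hK
  rw [generator_eq α hc hK (hf.gsip α hc hK t)]
  exact hasDerivWithinAt_poissonized measurable_size (ae_jumpKernel_size α hc) hf t η

/-- A locally bounded solution of the backward equation with initial value `f` is `P_t f`. -/
theorem eq_gsip_of_backward {f : Config E → ℝ} (hf : LevelBdd size f) {u : ℝ≥0 → Config E → ℝ}
    (hm : ∀ t, Measurable (u t)) (hb : ∀ n, ∃ C, ∀ t η, size η = n → |u t η| ≤ C)
    (h0 : ∀ η, u 0 η = f η)
    (hu : ∀ t η, HasDerivWithinAt (fun s : ℝ => u s.toNNReal η)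
      (generator α c (u t) η) (Ici 0) (t : ℝ)) (t : ℝ≥0) (η : Config E) :
    u t η = ∫ ξ, f ξ ∂gsip α hc K t η := by
  have := isMarkovKernel_jumpKernel α hc hK
  refine eq_poissonized_of_backward measurable_size (ae_jumpKernel_size α hc) hf hm hb h0
    (fun t η => ?_) t η
  rw [← generator_eq α hc hK ⟨hm t, fun n => (hb n).imp fun C hC η hη => hC t η hη⟩]
  exact hu t η

omit [StandardBorelSpace E] hK in
theorem levelBdd_indicator {B : Set (Config E)} (hB : MeasurableSet B) :
    LevelBdd size (B.indicator (1 : Config E → ℝ)) :=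
  .of_bounded (measurable_one.indicator hB) ⟨1, fun η => by by_cases h : η ∈ B <;> simp [h]⟩

theorem isBackwardSolution_gsip : IsBackwardSolution α c (gsip α hc K) where
  le_one t η := by
    have := isMarkovKernel_gsip α hc hK t
    exact prob_le_one
  zero := (isMarkovSemigroup_gsip α hc hK).zero
  hasDeriv t η B hB := by
    have h := hasDerivWithinAt_gsip α hc hK (levelBdd_indicator hB) t η
    simpa only [integral_indicator_one hB] using h

/-- For fixed B the functions P_t(·, B) are bounded by 1, because the kernels are sub-Markov, so
uniqueness applies with the indicator of B as initial value. -/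
theorem eq_gsip_of_isBackwardSolution {P : ℝ≥0 → Kernel (Config E) (Config E)}
    (hP : IsBackwardSolution α c P) : P = gsip α hc K := by
  funext t
  ext η B hB
  have hreal : ∀ t η, (P t η).real B ≤ 1 := fun t η =>
    ENNReal.toReal_mono ENNReal.one_ne_top ((measure_mono (subset_univ B)).trans (hP.le_one t η))
  have h := eq_gsip_of_backward α hc hK (levelBdd_indicator hB) (u := fun t η => (P t η).real B)
    (fun t => ((P t).measurable_coe hB).ennreal_toReal)
    (fun n => ⟨1, fun t η _ => by rw [abs_of_nonneg measureReal_nonneg]; exact hreal t η⟩)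
    (fun η => by
      rw [hP.zero, Kernel.id_apply, measureReal_def, Measure.dirac_apply' _ hB]
      by_cases h : η ∈ B <;> simp [h])
    (fun t η => hP.hasDeriv t η B hB) t η
  rw [integral_indicator_one hB] at h
  have := isMarkovKernel_gsip α hc hK t
  exact (measureReal_eq_measureReal_iff (ne_top_of_le_ne_top ENNReal.one_ne_top
    ((measure_mono (subset_univ B)).trans (hP.le_one t η)))).1 h

end Semigroup

end GSIP

end

noncomputable section

namespace GSIP

universe u

variable {E : Type u} [MeasurableSpace E] [StandardBorelSpace E]

/-! ### Consistency -/

section Consistency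

variable (α : Measure E) [IsFiniteMeasure α] {c : E → E → ℝ≥0}
  (hc : Measurable (Function.uncurry c)) {K : ℝ≥0} (hK : ∀ x y, c x y ≤ K)

omit [StandardBorelSpace E] in
include hc hK in
theorem integrable_update {f : Config E → ℝ} (hf : LevelBdd size f) {n : ℕ} (x : Fin n → E)
    (i : Fin n) (b : ℝ) (z : E) :
    Integrable (fun y => (f (ofTuple (Function.update x i y)) - b) * (c z y : ℝ)) α := by
  obtain ⟨C, hC⟩ := hf.bounded n
  have h1 : Measurable fun y : E => ofTuple (Function.update x i y) :=
    measurable_ofTuple.comp (measurable_update x)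
  have h2 : Measurable fun y : E => (c z y : ℝ) :=
    (hc.comp (measurable_const.prodMk measurable_id)).coe_nnreal_real
  refine Integrable.of_bound (((hf.measurable.comp h1).sub_const b).mul h2).aestronglyMeasurable
    ((C + |b|) * K) (.of_forall fun y => ?_)
  rw [norm_mul, Real.norm_eq_abs, Real.norm_eq_abs, NNReal.abs_eq]
  have h3 := hC (ofTuple (Function.update x i y)) (size_ofTuple _)
  refine mul_le_mul ((abs_sub _ _).trans (add_le_add h3 le_rfl)) (by exact_mod_cast hK z y)
    (by positivity) ?_
  exact add_nonneg ((abs_nonneg _).trans h3) (abs_nonneg _)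

-- Coordinates for L: the i-th particle moves to a point chosen by α or to the site of the j-th one.
-- The terms with j = i vanish and are kept to have full sums.
include hc hK in
theorem generator_ofTuple {f : Config E → ℝ} (hf : LevelBdd size f) {n : ℕ} (x : Fin n → E) :
    generator α c f (ofTuple x) =
      ∑ i, (∫ y, (f (ofTuple (Function.update x i y)) - f (ofTuple x)) * (c (x i) y : ℝ) ∂α +
        ∑ j, (f (ofTuple (Function.update x i (x j))) - f (ofTuple x)) * (c (x i) (x j) : ℝ)) := by
  rw [generator, integral_ofTuple]
  refine Finset.sum_congr rfl fun i _ => ?_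
  have h : ∀ y, addPoint (removePoint (ofTuple x) (x i)) y = ofTuple (Function.update x i y) :=
    move_ofTuple x i
  simp only [h]
  rw [integral_add_measure (integrable_update α hc hK hf x i _ _) (integrable_ofTuple _ _),
    integral_ofTuple]

theorem lowering_ofTuple {n : ℕ} (f : Config E → ℝ) (x : Fin (n + 1) → E) :
    lowering f (ofTuple x) = ∑ k, f (ofTuple (x ∘ Fin.succAbove k)) := by
  rw [lowering, integral_ofTuple]
  exact Finset.sum_congr rfl fun k _ => by rw [removePoint_ofTuple]

theorem lowering_ofTuple_zero (f : Config E → ℝ) (x : Fin 0 → E) :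
    lowering f (ofTuple x) = 0 := by
  rw [lowering, integral_ofTuple]
  simp

theorem abs_lowering_le {f : Config E → ℝ} {n : ℕ} {C : ℝ}
    (hC : ∀ η, size η = n → |f η| ≤ C) {η : Config E} (hη : size η = n + 1) :
    |lowering f η| ≤ (n + 1) * C := by
  obtain ⟨x, rfl⟩ := exists_ofTuple_size η hη
  rw [lowering_ofTuple]
  refine (Finset.abs_sum_le_sum_abs _ _).trans ?_
  refine (Finset.sum_le_card_nsmul _ _ C fun k _ => hC _ (size_ofTuple _)).trans ?_
  simp

theorem lowering_of_size_eq_zero (f : Config E → ℝ) {η : Config E} (hη : size η = 0) :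
    lowering f η = 0 := by
  obtain ⟨x, rfl⟩ := exists_ofTuple_size η hη
  exact lowering_ofTuple_zero f x

theorem LevelBdd.lowering {f : Config E → ℝ} (hf : LevelBdd size f) :
    LevelBdd size (lowering f) := by
  refine ⟨measurable_of_ofTuple fun n => ?_, fun n => ?_⟩
  · rcases n with _ | n
    · simp only [lowering_ofTuple_zero]
      exact measurable_const
    · simp only [lowering_ofTuple]
      refine Finset.measurable_sum _ fun k _ => hf.measurable.comp (measurable_ofTuple.comp ?_)
      exact measurable_pi_lambda _ fun i => measurable_pi_apply _
  · rcases n with _ | n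
    · exact ⟨0, fun η hη => by rw [lowering_of_size_eq_zero f hη, abs_zero]⟩
    · obtain ⟨C, hC⟩ := hf.bounded n
      exact ⟨(n + 1) * C, fun η hη => abs_lowering_le hC hη⟩

omit [StandardBorelSpace E] in
theorem addPoint_injective (y : E) : Function.Injective fun η : Config E => addPoint η y := by
  intro η ξ h
  simp only at h
  rw [← removePoint_addPoint η y, h, removePoint_addPoint]

omit [StandardBorelSpace E] in
theorem addPoint_ofTuple_update {n : ℕ} (z : Fin n → E) (i : Fin n) (y : E) :
    addPoint (ofTuple (Function.update z i y)) (z i) = addPoint (ofTuple z) y := by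
  cases n with
  | zero => exact i.elim0
  | succ n =>
    rw [ofTuple_eq_addPoint (Function.update z i y) i, ofTuple_eq_addPoint z i,
      Function.update_self, Function.update_comp_eq_of_forall_ne _ _ (fun j => Fin.succAbove_ne i j),
      addPoint_comm]

-- Deleting the k-th particle and then moving another one to its site gives the same configuration
-- as deleting that other particle.
omit [StandardBorelSpace E] in
theorem ofTuple_update_succAbove {n : ℕ} (x : Fin (n + 1) → E) (k : Fin (n + 1)) (i : Fin n) :
    ofTuple (Function.update (x ∘ k.succAbove) i (x k)) =
      ofTuple (x ∘ (k.succAbove i).succAbove) := by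
  refine addPoint_injective (x (k.succAbove i)) ?_
  have h := addPoint_ofTuple_update (x ∘ k.succAbove) i (x k)
  simp only [Function.comp_apply] at h
  simp only [h, ← ofTuple_eq_addPoint]

-- Expanding both sides over the deleted particle k and the jumping particle i, all jumps match
-- except those from x_i onto the deleted x_k, which occur only in L𝒜f. These contribute (g i − g k)
-- c(x_i, x_k), antisymmetric in (i, k) because c is symmetric.
include hc hK in
theorem generator_lowering (hsymm : ∀ x y, c x y = c y x) {f : Config E → ℝ}
    (hf : LevelBdd size f) (η : Config E) :
    generator α c (lowering f) η = lowering (generator α c f) η := by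
  obtain ⟨n, x, rfl⟩ := exists_ofTuple_eq η
  rw [generator_ofTuple α hc hK hf.lowering]
  rcases n with _ | n
  · simp [lowering_ofTuple_zero]
  simp only [lowering_ofTuple]
  set g : Fin (n + 1) → ℝ := fun k => f (ofTuple (x ∘ k.succAbove)) with hg
  set D : Fin (n + 1) → Fin (n + 1) → E → ℝ := fun k i y =>
    f (ofTuple (Function.update x i y ∘ k.succAbove)) - g k with hD
  -- If the jumping particle is also the deleted one, its jump is invisible; this allows the sums
  -- over i to include i = k.
  have hDself : ∀ k y, D k k y = 0 := fun k y => by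
    simp only [hD, hg]
    rw [Function.update_comp_eq_of_forall_ne _ _ (fun j => Fin.succAbove_ne k j), sub_self]
  have hDsucc : ∀ k i y, D k (k.succAbove i) y =
      f (ofTuple (Function.update (x ∘ k.succAbove) i y)) - g k := fun k i y => by
    simp only [hD]
    rw [Function.update_comp_eq_of_injective _ Fin.succAbove_right_injective]
  have hint : ∀ k i, Integrable (fun y => D k i y * (c (x i) y : ℝ)) α := by
    intro k i
    rcases eq_or_ne i k with rfl | hik
    · simp [hDself]
    · obtain ⟨i', rfl⟩ := Fin.exists_succAbove_eq hik
      simp only [hDsucc]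
      exact integrable_update α hc hK hf _ _ _ _
  have h1 : ∀ i, ∫ y, (∑ k, f (ofTuple (Function.update x i y ∘ Fin.succAbove k)) - ∑ k, g k) *
      (c (x i) y : ℝ) ∂α = ∑ k, ∫ y, D k i y * (c (x i) y : ℝ) ∂α := by
    intro i
    rw [← integral_finsetSum _ fun k _ => hint k i]
    simp only [← Finset.sum_sub_distrib, Finset.sum_mul, hD]
  have h2 : ∀ i j, (∑ k, f (ofTuple (Function.update x i (x j) ∘ Fin.succAbove k)) - ∑ k, g k) *
      (c (x i) (x j) : ℝ) = ∑ k, D k i (x j) * (c (x i) (x j) : ℝ) := by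
    intro i j
    simp only [← Finset.sum_sub_distrib, Finset.sum_mul, hD]
  -- The first sum includes jumps onto the deleted particle x_k. By `ofTuple_update_succAbove` such
  -- a jump of x_i leads to the configuration without x_i, so the correction involves g i − g k.
  have h3 : ∀ k, generator α c f (ofTuple (x ∘ Fin.succAbove k)) =
      ∑ i, (∫ y, D k i y * (c (x i) y : ℝ) ∂α + ∑ j, D k i (x j) * (c (x i) (x j) : ℝ)) -
        ∑ i, (g i - g k) * (c (x i) (x k) : ℝ) := by
    intro k
    rw [generator_ofTuple α hc hK hf, Fin.sum_univ_succAbove _ k,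
      Fin.sum_univ_succAbove (fun i => (g i - g k) * (c (x i) (x k) : ℝ)) k]
    simp only [hDself, zero_mul, integral_zero, Finset.sum_const_zero, zero_add, sub_self]
    rw [← Finset.sum_sub_distrib]
    refine Finset.sum_congr rfl fun i _ => ?_
    rw [Fin.sum_univ_succAbove _ k]
    simp only [hDsucc, ofTuple_update_succAbove, Function.comp_apply, hg]
    ring
  simp only [h1, h2, h3]
  rw [Finset.sum_sub_distrib, Finset.sum_comm (γ := Fin (n + 1)) (f := fun k i =>
    ∫ y, D k i y * (c (x i) y : ℝ) ∂α + ∑ j, D k i (x j) * (c (x i) (x j) : ℝ))]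
  have h4 : ∑ k, ∑ i, (g i - g k) * (c (x i) (x k) : ℝ) = 0 := by
    have h5 : ∑ k, ∑ i, (g i - g k) * (c (x i) (x k) : ℝ) =
        - ∑ k, ∑ i, (g i - g k) * (c (x i) (x k) : ℝ) := by
      conv_lhs => rw [Finset.sum_comm]
      rw [← Finset.sum_neg_distrib]
      refine Finset.sum_congr rfl fun i _ => ?_
      rw [← Finset.sum_neg_distrib]
      refine Finset.sum_congr rfl fun k _ => ?_
      rw [hsymm (x i) (x k)]
      ring
    linarith
  rw [h4, sub_zero]
  refine Finset.sum_congr rfl fun i _ => ?_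
  rw [Finset.sum_add_distrib, Finset.sum_comm (γ := Fin (n + 1))]

-- The family 𝒜 P_t f solves the backward equation with initial value 𝒜 f, since on each level 𝒜 is
-- a finite sum, hence passes through the time derivative, and it commutes with L.
include hK in
theorem integral_gsip_lowering (hsymm : ∀ x y, c x y = c y x) {f : Config E → ℝ}
    (hf : LevelBdd size f) (t : ℝ≥0) (η : Config E) :
    ∫ ξ, lowering f ξ ∂gsip α hc K t η =
      lowering (fun ζ => ∫ ξ, f ξ ∂gsip α hc K t ζ) η := by
  symm
  refine eq_gsip_of_backward α hc hK hf.lowering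
    (u := fun t => lowering fun ζ => ∫ ξ, f ξ ∂gsip α hc K t ζ)
    (fun t => (hf.gsip α hc hK t).lowering.measurable) ?_ ?_ ?_ t η
  · intro n
    rcases n with _ | n
    · exact ⟨0, fun t η hη => by rw [lowering_of_size_eq_zero _ hη, abs_zero]⟩
    · obtain ⟨C, hC⟩ := hf.bounded n
      refine ⟨(n + 1) * C, fun t η hη => abs_lowering_le (fun ζ hζ => ?_) hη⟩
      have := isMarkovKernel_gsip α hc hK t
      subst hζ
      exact abs_integral_le_of_level hC (ae_gsip_size α hc t ζ)
  · intro η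
    congr 1
    funext ζ
    rw [(isMarkovSemigroup_gsip α hc hK).zero, Kernel.id_apply,
      integral_dirac' _ _ hf.measurable.stronglyMeasurable]
  · intro t η
    rw [generator_lowering α hc hK hsymm (hf.gsip α hc hK t)]
    obtain ⟨n, x, rfl⟩ := exists_ofTuple_eq η
    rcases n with _ | n
    · simp only [lowering_ofTuple_zero]
      exact hasDerivWithinAt_const _ _ _
    · simp only [lowering_ofTuple]
      exact HasDerivWithinAt.fun_sum fun k _ => hasDerivWithinAt_gsip α hc hK hf t _

include hK in
theorem isConsistent_gsip (hsymm : ∀ x y, c x y = c y x) : IsConsistent (gsip α hc K) := by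
  intro t f hf hb η
  have hf' : LevelBdd size f := .of_bounded hf hb
  exact ⟨hf'.lowering.integrable_gsip α hc hK t η, integral_gsip_lowering α hc hK hsymm hf' t η⟩

end Consistency

/-! ### Falling factorials -/

section Factorial

/-- Two enumerations of a configuration differ by a permutation, which reindexes the embeddings; the
arbitrary choice in `points` is therefore harmless. -/
theorem sum_embedding_eq_of_ofTuple_eq {n m m' : ℕ} {x : Fin m → E} {y : Fin m' → E}
    (h : ofTuple y = ofTuple x) (f : (Fin n → E) → ℝ) :
    ∑ i : Fin n ↪ Fin m', f (y ∘ i) = ∑ i : Fin n ↪ Fin m, f (x ∘ i) := by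
  have hm : m' = m := by rw [← size_ofTuple y, h, size_ofTuple]
  subst hm
  obtain ⟨σ, rfl⟩ := exists_perm_of_ofTuple_eq h.symm
  exact Equiv.sum_comp ((Equiv.refl (Fin n)).embeddingCongr σ) fun i => f (x ∘ i)

theorem fallingFactorial_ofTuple {n m : ℕ} (f : (Fin n → E) → ℝ) (x : Fin m → E) :
    fallingFactorial f (ofTuple x) = ∑ i : Fin n ↪ Fin m, f (x ∘ i) := by
  rw [fallingFactorial, factorialMeasure, integral_finsetSum_measure
    fun i _ => integrable_dirac enorm_lt_top]
  simp only [integral_dirac]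
  exact sum_embedding_eq_of_ofTuple_eq (exists_ofTuple_eq (ofTuple x)).choose_spec.choose_spec f

theorem levelBdd_fallingFactorial {n : ℕ} {f : (Fin n → E) → ℝ} (hf : Measurable f)
    (hb : ∃ C, ∀ x, |f x| ≤ C) : LevelBdd size (fallingFactorial f) := by
  refine ⟨measurable_of_ofTuple fun m => ?_, fun m => ?_⟩
  · simp only [fallingFactorial_ofTuple]
    refine Finset.measurable_sum _ fun i _ => hf.comp ?_
    exact measurable_pi_lambda _ fun j => measurable_pi_apply _
  · obtain ⟨C, hC⟩ := hb
    refine ⟨(Fintype.card (Fin n ↪ Fin m)) • C, fun η hη => ?_⟩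
    obtain ⟨x, rfl⟩ := exists_ofTuple_size η hη
    rw [fallingFactorial_ofTuple]
    exact (Finset.abs_sum_le_sum_abs _ _).trans (Finset.sum_le_card_nsmul _ _ C fun i _ => hC _)

/-- An n-tuple of distinct indices survives the deletion of a particle exactly when that particle is
none of the n, that is, for m + 1 − n of the m + 1 deletions. -/
theorem lowering_fallingFactorial {n m : ℕ} (f : (Fin n → E) → ℝ) {η : Config E}
    (hη : size η = m + 1) :
    lowering (fallingFactorial f) η = ((m : ℝ) + 1 - n) * fallingFactorial f η := by
  classical
  obtain ⟨x, rfl⟩ := exists_ofTuple_size η hη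
  rw [lowering_ofTuple]
  simp only [fallingFactorial_ofTuple]
  have h1 : ∀ k : Fin (m + 1), ∑ i : Fin n ↪ Fin m, f ((x ∘ k.succAbove) ∘ i) =
      ∑ j : Fin n ↪ Fin (m + 1), if k ∉ Set.range j then f (x ∘ j) else 0 := by
    intro k
    rw [← Finset.sum_filter]
    refine Finset.sum_nbij (fun i => i.trans (Fin.succAboveEmb k)) ?_ ?_ ?_ ?_
    · intro i _
      simp only [Finset.mem_filter, Finset.mem_univ, true_and, Set.mem_range, not_exists]
      exact fun a => Fin.succAbove_ne k _
    · intro i _ j _ hij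
      ext a
      have := DFunLike.congr_fun hij a
      exact congrArg Fin.val (Fin.succAbove_right_injective this)
    · intro j hj
      simp only [Finset.coe_filter, Finset.mem_univ, true_and, Set.mem_ofPred_eq, Set.mem_range,
        not_exists] at hj
      choose i hi using fun a => Fin.exists_succAbove_eq (hj a)
      refine ⟨⟨i, fun a b hab => j.injective (by rw [← hi a, ← hi b, hab])⟩, by simp, ?_⟩
      ext a
      exact congrArg Fin.val (hi a)
    · intro i _
      rfl
  simp only [h1]
  rw [Finset.sum_comm, Finset.mul_sum]
  refine Finset.sum_congr rfl fun j _ => ?_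
  have hcard : (Finset.univ.filter fun k => k ∈ Set.range j).card = n := by
    have : (Finset.univ.filter fun k => k ∈ Set.range j) = Finset.univ.map j := by
      ext k; simp
    rw [this, Finset.card_map, Finset.card_fin]
  have hcard' := Finset.card_filter_add_card_filter_not (s := (Finset.univ : Finset (Fin (m + 1))))
    (fun k => k ∈ Set.range j)
  rw [hcard, Finset.card_fin] at hcard'
  rw [← Finset.sum_filter, Finset.sum_const, nsmul_eq_mul]
  congr 1
  have : (n : ℝ) + ((Finset.univ.filter fun k => ¬ k ∈ Set.range j).card : ℝ) = m + 1 := by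
    exact_mod_cast hcard'
  linarith

theorem descend_ofTuple {n : ℕ} {f : (Fin n → E) → ℝ} (hf : IsSymmBdd f) (x : Fin n → E) :
    descend f (ofTuple x) = f x := by
  have h : ∃ y : Fin n → E, ofTuple y = ofTuple x := ⟨x, rfl⟩
  rw [descend, dif_pos h]
  obtain ⟨σ, hσ⟩ := exists_perm_of_ofTuple_eq h.choose_spec.symm
  rw [← hσ, hf.symm]

omit [StandardBorelSpace E] in
theorem descend_of_size_ne {n : ℕ} (f : (Fin n → E) → ℝ) {η : Config E} (h : size η ≠ n) :
    descend f η = 0 := by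
  rw [descend, dif_neg]
  rintro ⟨x, rfl⟩
  exact h (size_ofTuple x)

theorem levelBdd_descend {n : ℕ} {f : (Fin n → E) → ℝ} (hf : IsSymmBdd f) :
    LevelBdd size (descend f) := by
  obtain ⟨C, hC⟩ := hf.bounded
  refine .of_bounded (measurable_of_ofTuple fun m => ?_) ⟨|C|, fun η => ?_⟩
  · rcases eq_or_ne m n with rfl | h
    · simp only [descend_ofTuple hf]
      exact hf.measurable
    · have : (fun x : Fin m → E => descend f (ofTuple x)) = fun _ => 0 :=
        funext fun x => descend_of_size_ne f (by rwa [size_ofTuple])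
      rw [this]
      exact measurable_const
  · by_cases h : size η = n
    · obtain ⟨x, rfl⟩ := exists_ofTuple_size η h
      rw [descend_ofTuple hf]
      exact (hC x).trans (le_abs_self C)
    · rw [descend_of_size_ne f h, abs_zero]
      exact abs_nonneg C

theorem fallingFactorial_of_size_lt {n : ℕ} (f : (Fin n → E) → ℝ) {η : Config E}
    (h : size η < n) : fallingFactorial f η = 0 := by
  obtain ⟨m, x, rfl⟩ := exists_ofTuple_eq η
  rw [size_ofTuple] at h
  rw [fallingFactorial_ofTuple]
  have : IsEmpty (Fin n ↪ Fin m) := by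
    rw [← Fintype.card_eq_zero_iff, Fintype.card_embedding_eq]
    simp [Nat.descFactorial_eq_zero_iff_lt, h]
  exact Finset.sum_of_isEmpty _

theorem fallingFactorial_of_size_eq {n : ℕ} {f : (Fin n → E) → ℝ} (hf : IsSymmBdd f)
    (x : Fin n → E) : fallingFactorial f (ofTuple x) = n.factorial * f x := by
  rw [fallingFactorial_ofTuple]
  have : ∀ i : Fin n ↪ Fin n, f (x ∘ i) = f x := fun i =>
    hf.symm (Equiv.ofBijective i (Finite.injective_iff_bijective.1 i.injective)) x
  simp only [this, Finset.sum_const, nsmul_eq_mul, Finset.card_univ, Fintype.card_embedding_eq,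
    Fintype.card_fin, Nat.descFactorial_self]

variable (α : Measure E) [IsFiniteMeasure α] {c : E → E → ℝ≥0}
  (hc : Measurable (Function.uncurry c)) {K : ℝ≥0} (hK : ∀ x y, c x y ≤ K)

include hK

theorem isSymmBdd_labelled {n : ℕ} {f : (Fin n → E) → ℝ} (hf : IsSymmBdd f) (t : ℝ≥0) :
    IsSymmBdd (labelled (gsip α hc K) t f) := by
  have hd := (levelBdd_descend hf).gsip α hc hK t
  refine ⟨hd.measurable.comp measurable_ofTuple, ?_, fun σ x => ?_⟩
  · obtain ⟨C, hC⟩ := hd.bounded n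
    exact ⟨C, fun x => hC _ (size_ofTuple x)⟩
  · rw [labelled, ofTuple_comp_perm, labelled]

/-- Induction on the number of particles. With fewer than n of them both sides vanish, and with
exactly n the polynomial is n! f, so the claim is the definition of `labelled`. With more, the
eigenvalue relation introduces 𝒜, consistency moves it past P_t, and the induction hypothesis
applies after the deletion. -/
theorem integral_gsip_fallingFactorial (hsymm : ∀ x y, c x y = c y x) {n : ℕ}
    {f : (Fin n → E) → ℝ} (hf : IsSymmBdd f) (t : ℝ≥0) (η : Config E) :
    ∫ ξ, fallingFactorial f ξ ∂gsip α hc K t η =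
      fallingFactorial (labelled (gsip α hc K) t f) η := by
  have hJ := levelBdd_fallingFactorial hf.measurable hf.bounded
  obtain ⟨m, hm⟩ : ∃ m, size η = m := ⟨_, rfl⟩
  induction m generalizing η with
  | zero =>
    rcases n with _ | n
    · obtain ⟨x, rfl⟩ := exists_ofTuple_size η hm
      rw [fallingFactorial_of_size_eq (isSymmBdd_labelled α hc hK hf t), labelled,
        ← integral_const_mul]
      refine integral_congr_ae ?_
      filter_upwards [ae_gsip_size α hc t (ofTuple x)] with ξ hξ
      rw [hm] at hξ
      obtain ⟨y, rfl⟩ := exists_ofTuple_size ξ hξ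
      rw [fallingFactorial_of_size_eq hf, descend_ofTuple hf]
    · rw [fallingFactorial_of_size_lt _ (by omega)]
      refine integral_eq_zero_of_ae ?_
      filter_upwards [ae_gsip_size α hc t η] with ξ hξ
      exact fallingFactorial_of_size_lt _ (by omega)
  | succ m ih =>
    rcases lt_trichotomy (m + 1) n with h | h | h
    · rw [fallingFactorial_of_size_lt _ (by omega)]
      refine integral_eq_zero_of_ae ?_
      filter_upwards [ae_gsip_size α hc t η] with ξ hξ
      exact fallingFactorial_of_size_lt _ (by omega)
    · rw [h] at hm
      obtain ⟨x, rfl⟩ := exists_ofTuple_size η hm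
      rw [fallingFactorial_of_size_eq (isSymmBdd_labelled α hc hK hf t), labelled,
        ← integral_const_mul]
      refine integral_congr_ae ?_
      filter_upwards [ae_gsip_size α hc t (ofTuple x)] with ξ hξ
      rw [hm] at hξ
      obtain ⟨y, rfl⟩ := exists_ofTuple_size ξ hξ
      rw [fallingFactorial_of_size_eq hf, descend_ofTuple hf]
    · have hne : (m : ℝ) + 1 - n ≠ 0 := by
        have : (n : ℝ) < m + 1 := by exact_mod_cast h
        linarith
      refine mul_left_cancel₀ hne ?_
      rw [← lowering_fallingFactorial _ hm, ← integral_const_mul]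
      have h1 : ∫ ξ, ((m : ℝ) + 1 - n) * fallingFactorial f ξ ∂gsip α hc K t η =
          ∫ ξ, lowering (fallingFactorial f) ξ ∂gsip α hc K t η := by
        refine integral_congr_ae ?_
        filter_upwards [ae_gsip_size α hc t η] with ξ hξ
        rw [lowering_fallingFactorial f (hξ.trans hm)]
      rw [h1, integral_gsip_lowering α hc hK hsymm hJ]
      obtain ⟨x, rfl⟩ := exists_ofTuple_size η hm
      rw [lowering_ofTuple, lowering_ofTuple]
      exact Finset.sum_congr rfl fun k _ => ih _ (size_ofTuple _)

theorem factorialIntertwining_gsip (hsymm : ∀ x y, c x y = c y x) :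
    FactorialIntertwining (gsip α hc K) := fun _ _ hf t =>
  ⟨isSymmBdd_labelled α hc hK hf t, fun η =>
    ⟨(levelBdd_fallingFactorial hf.measurable hf.bounded).integrable_gsip α hc hK t η,
      integral_gsip_fallingFactorial α hc hK hsymm hf t η⟩⟩

end Factorial

end GSIP

end

noncomputable section

namespace GSIP

universe u

variable {E : Type u} [MeasurableSpace E]

/-! ### Point processes with Papangelou kernel `q (α + θ η)` -/

section Mecke

/-- The measure `α + θ ξ`. For `θ = 0` it is the Papangelou kernel of a Poisson process, for `θ = 1`
it is, up to a factor, that of a Pascal process. -/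
def papangelou (α : Measure E) (θ : ℝ≥0) (ξ : Config E) : Measure E := α + θ • ξ.1

variable (α : Measure E) [IsFiniteMeasure α] (θ q : ℝ≥0)

instance (ξ : Config E) : IsFiniteMeasure (papangelou α θ ξ) := by
  unfold papangelou; infer_instance

omit [IsFiniteMeasure α] in
theorem lintegral_papangelou (ξ : Config E) (f : E → ℝ≥0∞) :
    ∫⁻ y, f y ∂papangelou α θ ξ = ∫⁻ y, f y ∂α + θ * ∫⁻ y, f y ∂ξ.1 := by
  rw [papangelou, lintegral_add_measure, lintegral_smul_measure]
  rfl

omit [IsFiniteMeasure α] in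
theorem lintegral_papangelou_addPoint (ξ : Config E) (z : E) {f : E → ℝ≥0∞} (hf : Measurable f) :
    ∫⁻ y, f y ∂papangelou α θ (addPoint ξ z) = ∫⁻ y, f y ∂papangelou α θ ξ + θ * f z := by
  rw [lintegral_papangelou, lintegral_papangelou, addPoint, lintegral_add_measure,
    lintegral_dirac' _ hf, mul_add, add_assoc]

theorem measurable_lintegral_papangelou {X : Type*} [MeasurableSpace X] {g : X → Config E}
    (hg : Measurable g) {f : X → E → ℝ≥0∞} (hf : Measurable (Function.uncurry f)) :
    Measurable fun z => ∫⁻ y, f z y ∂papangelou α θ (g z) := by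
  simp only [lintegral_papangelou]
  exact (hf.lintegral_prod_right' (ν := α)).add
    ((measurable_lintegral_config hg hf).const_mul _)

omit [IsFiniteMeasure α] in
theorem measurable_addPoint_config (ξ : Config E) : Measurable fun y => addPoint ξ y :=
  Measurable.comp (g := fun z : Config E × E => addPoint z.1 z.2) (f := fun y => (ξ, y))
    measurable_addPoint measurable_prodMk_left

/-- Adding a point according to the Papangelou kernel. -/
def addKernel : Kernel (Config E) (Config E) where
  toFun ξ := (papangelou α θ ξ).map fun y => addPoint ξ y
  measurable' := by
    refine Measure.measurable_of_measurable_coe _ fun B hB => ?_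
    have h : ∀ ξ, (papangelou α θ ξ).map (fun y => addPoint ξ y) B =
        ∫⁻ y, B.indicator 1 (addPoint ξ y) ∂papangelou α θ ξ := fun ξ => by
      rw [← lintegral_map (measurable_one.indicator hB) (measurable_addPoint_config ξ),
        lintegral_indicator_one hB]
    simp only [h]
    exact measurable_lintegral_papangelou α θ measurable_id
      (f := fun ξ y => B.indicator 1 (addPoint ξ y))
      ((measurable_one.indicator hB).comp measurable_addPoint)

theorem lintegral_addKernel (ξ : Config E) {f : Config E → ℝ≥0∞} (hf : Measurable f) :
    ∫⁻ η, f η ∂addKernel α θ ξ = ∫⁻ y, f (addPoint ξ y) ∂papangelou α θ ξ :=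
  lintegral_map hf (measurable_addPoint_config ξ)

/-- The configuration without points. -/
def emptyConfig (E : Type u) [MeasurableSpace E] : Config E := ofTuple Fin.elim0

@[simp] theorem coe_emptyConfig : (emptyConfig E).1 = 0 := by simp [emptyConfig, ofTuple]

/-- The `m`-point measures of the point process. -/
def pointMeasure : ℕ → Measure (Config E)
  | 0 => Measure.dirac (emptyConfig E)
  | m + 1 => (pointMeasure m).bind (addKernel α θ)

theorem lintegral_pointMeasure_succ (m : ℕ) {f : Config E → ℝ≥0∞} (hf : Measurable f) :
    ∫⁻ η, f η ∂pointMeasure α θ (m + 1) =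
      ∫⁻ ξ, ∫⁻ y, f (addPoint ξ y) ∂papangelou α θ ξ ∂pointMeasure α θ m := by
  rw [pointMeasure, Measure.lintegral_bind (Kernel.aemeasurable _) hf.aemeasurable]
  simp only [lintegral_addKernel α θ _ hf]

theorem measurable_lintegral_self {h : Config E → E → ℝ≥0∞}
    (hh : Measurable (Function.uncurry h)) : Measurable fun η : Config E => ∫⁻ x, h η x ∂η.1 :=
  measurable_lintegral_config measurable_id hh

theorem measurable_lintegral_papangelou_self {h : Config E → E → ℝ≥0∞}
    (hh : Measurable (Function.uncurry h)) :
    Measurable fun η : Config E => ∫⁻ x, h η x ∂papangelou α θ η :=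
  measurable_lintegral_papangelou α θ measurable_id hh

/-- The measure (α + θζ)(dz) (α + θζ + θδ_z)(dy) is a product with equal factors plus a measure on
the diagonal, hence symmetric. Both the Mecke equation and reversibility rest on this. -/
theorem lintegral_papangelou_swap (ζ : Config E) {k : E → E → ℝ≥0∞}
    (hk : Measurable (Function.uncurry k)) :
    ∫⁻ z, ∫⁻ y, k z y ∂papangelou α θ (addPoint ζ z) ∂papangelou α θ ζ =
      ∫⁻ z, ∫⁻ y, k y z ∂papangelou α θ (addPoint ζ z) ∂papangelou α θ ζ := by
  have h1 : ∀ z, Measurable (k z) := fun z => hk.comp measurable_prodMk_left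
  have h2 : ∀ z, Measurable fun y => k y z := fun z => hk.comp measurable_prodMk_right
  have h3 : Measurable fun z => (θ : ℝ≥0∞) * k z z :=
    (hk.comp (measurable_id.prodMk measurable_id)).const_mul _
  simp only [lintegral_papangelou_addPoint α θ ζ _ (h1 _),
    lintegral_papangelou_addPoint α θ ζ _ (h2 _)]
  rw [lintegral_add_right _ h3, lintegral_add_right _ h3, lintegral_lintegral_swap hk.aemeasurable]

omit [IsFiniteMeasure α] in
theorem measurable_uncurry_addPoint {h : Config E → E → ℝ≥0∞}
    (hh : Measurable (Function.uncurry h)) :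
    Measurable (Function.uncurry fun (ξ : Config E) (y : E) => h (addPoint ξ y) y) :=
  hh.comp (measurable_addPoint.prodMk measurable_snd)

theorem measurable_lintegral_addPoint {h : Config E → E → ℝ≥0∞}
    (hh : Measurable (Function.uncurry h)) :
    Measurable (Function.uncurry fun (ξ : Config E) (x : E) =>
      ∫⁻ y, h (addPoint ξ y) x ∂papangelou α θ ξ) := by
  refine measurable_lintegral_papangelou α θ (g := fun z : Config E × E => z.1) measurable_fst
    (f := fun z y => h (addPoint z.1 y) z.2) ?_
  have h1 : Measurable fun w : (Config E × E) × E => addPoint w.1.1 w.2 :=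
    Measurable.comp (g := fun z : Config E × E => addPoint z.1 z.2)
      (f := fun w : (Config E × E) × E => (w.1.1, w.2)) measurable_addPoint
      (measurable_fst.fst.prodMk measurable_snd)
  exact hh.comp (h1.prodMk measurable_fst.snd)

/-- In η = ξ + δ_y the marked point x is either one of the old points or the point y added last. -/
theorem lintegral_pointMeasure_succ_split (m : ℕ) {h : Config E → E → ℝ≥0∞}
    (hh : Measurable (Function.uncurry h)) :
    ∫⁻ η, ∫⁻ x, h η x ∂η.1 ∂pointMeasure α θ (m + 1) =
      ∫⁻ ξ, ∫⁻ x, ∫⁻ y, h (addPoint ξ y) x ∂papangelou α θ ξ ∂ξ.1 ∂pointMeasure α θ m +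
        ∫⁻ ξ, ∫⁻ y, h (addPoint ξ y) y ∂papangelou α θ ξ ∂pointMeasure α θ m := by
  rw [lintegral_pointMeasure_succ α θ m (measurable_lintegral_self hh),
    ← lintegral_add_right _
      (measurable_lintegral_papangelou_self α θ (measurable_uncurry_addPoint hh))]
  refine lintegral_congr fun ξ => ?_
  have hξ : Measurable fun w : E × E => h (addPoint ξ w.2) w.1 :=
    hh.comp (((measurable_addPoint_config ξ).comp measurable_snd).prodMk measurable_fst)
  have hξ' : Measurable fun y : E => h (addPoint ξ y) y :=
    hh.comp ((measurable_addPoint_config ξ).prodMk measurable_id)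
  rw [lintegral_lintegral_swap hξ.aemeasurable, ← lintegral_add_right _ hξ']
  refine lintegral_congr fun y => ?_
  have h1 : Measurable (h (addPoint ξ y)) := hh.comp measurable_prodMk_left
  exact (lintegral_add_measure _ _ _).trans (by rw [lintegral_dirac' _ h1])

theorem mecke_pointMeasure (m : ℕ) {h : Config E → E → ℝ≥0∞}
    (hh : Measurable (Function.uncurry h)) :
    ∫⁻ η, ∫⁻ x, h η x ∂η.1 ∂pointMeasure α θ (m + 1) =
      (m + 1) * ∫⁻ ξ, ∫⁻ y, h (addPoint ξ y) y ∂papangelou α θ ξ ∂pointMeasure α θ m := by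
  induction m generalizing h with
  | zero =>
    rw [lintegral_pointMeasure_succ_split α θ 0 hh]
    simp only [pointMeasure]
    rw [lintegral_dirac' _ (measurable_lintegral_self (measurable_lintegral_addPoint α θ hh))]
    simp
  | succ m ih =>
    rw [lintegral_pointMeasure_succ_split α θ (m + 1) hh, ih (measurable_lintegral_addPoint α θ hh)]
    -- Exchangeability of the last two added points: marking the earlier one, as the induction
    -- hypothesis does, gives the same as marking the later one. So its m + 1 copies join the
    -- remaining summand.
    have key : ∫⁻ ξ, ∫⁻ z, ∫⁻ y, h (addPoint (addPoint ξ z) y) z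
          ∂papangelou α θ (addPoint ξ z) ∂papangelou α θ ξ ∂pointMeasure α θ m =
        ∫⁻ ξ, ∫⁻ y, h (addPoint ξ y) y ∂papangelou α θ ξ ∂pointMeasure α θ (m + 1) := by
      rw [lintegral_pointMeasure_succ α θ m
        (measurable_lintegral_papangelou_self α θ (measurable_uncurry_addPoint hh))]
      refine lintegral_congr fun ξ => ?_
      rw [lintegral_papangelou_swap α θ ξ (k := fun z y => h (addPoint (addPoint ξ z) y) z)]
      · refine lintegral_congr fun z => lintegral_congr fun y => ?_
        rw [addPoint_comm]
      · have h1 : Measurable fun w : E × E => addPoint (addPoint ξ w.1) w.2 :=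
          Measurable.comp (g := fun z : Config E × E => addPoint z.1 z.2)
            (f := fun w : E × E => (addPoint ξ w.1, w.2)) measurable_addPoint
            (((measurable_addPoint_config ξ).comp measurable_fst).prodMk measurable_snd)
        exact hh.comp (h1.prodMk measurable_fst)
    rw [key]
    push_cast
    ring

/-- The Mecke equation with Papangelou kernel `q (α + θ η)`. -/
def IsMecke (ρ : Measure (Config E)) : Prop :=
  ∀ h : Config E → E → ℝ≥0∞, Measurable (Function.uncurry h) →
    ∫⁻ η, ∫⁻ x, h η x ∂η.1 ∂ρ = q * ∫⁻ ξ, ∫⁻ y, h (addPoint ξ y) y ∂papangelou α θ ξ ∂ρ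

/-- The unnormalized law of the point process with Papangelou kernel `q (α + θ η)`. -/
def gibbsMeasure : Measure (Config E) :=
  Measure.sum fun m : ℕ => (q ^ m / m.factorial : ℝ≥0) • pointMeasure α θ m

theorem lintegral_gibbsMeasure (f : Config E → ℝ≥0∞) : ∫⁻ η, f η ∂gibbsMeasure α θ q =
    ∑' m : ℕ, ((q ^ m / m.factorial : ℝ≥0) : ℝ≥0∞) * ∫⁻ η, f η ∂pointMeasure α θ m := by
  rw [gibbsMeasure, lintegral_sum_measure]
  refine tsum_congr fun m => ?_
  rw [lintegral_smul_measure]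
  rfl

/-- The weights q^m/m! turn the factor m + 1 of `mecke_pointMeasure` into q when the sum is shifted
by one. -/
theorem isMecke_gibbsMeasure : IsMecke α θ q (gibbsMeasure α θ q) := by
  intro h hh
  rw [lintegral_gibbsMeasure, lintegral_gibbsMeasure, tsum_eq_zero_add' ENNReal.summable,
    ← ENNReal.tsum_mul_left]
  · have h0 : ∫⁻ η, ∫⁻ x, h η x ∂η.1 ∂pointMeasure α θ 0 = 0 := by
      rw [pointMeasure, lintegral_dirac' _ (measurable_lintegral_self hh)]
      simp
    rw [h0, mul_zero, zero_add]
    refine tsum_congr fun m => ?_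
    rw [mecke_pointMeasure α θ m hh, ← mul_assoc, ← mul_assoc]
    congr 1
    have : ((m : ℝ≥0∞) + 1) = ((m + 1 : ℝ≥0) : ℝ≥0∞) := by push_cast; rfl
    rw [this, ← ENNReal.coe_mul, ← ENNReal.coe_mul]
    congr 1
    rw [Nat.factorial_succ]
    push_cast
    have : (m.factorial : ℝ≥0) ≠ 0 := by positivity
    field_simp
    ring

variable {α θ q}

omit [IsFiniteMeasure α] in
theorem IsMecke.smul {ρ : Measure (Config E)} (hρ : IsMecke α θ q ρ) (r : ℝ≥0∞) :
    IsMecke α θ q (r • ρ) := by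
  intro h hh
  rw [lintegral_smul_measure, lintegral_smul_measure, hρ h hh]
  simp only [smul_eq_mul]
  ring

/-- The weights `w_k` with `(k + 1) w_{k + 1} = q (a + θ k) w_k` and `w_0 = 1`. -/
def countWeight (θ q a : ℝ≥0) : ℕ → ℝ≥0
  | 0 => 1
  | k + 1 => q * (a + θ * k) / (k + 1) * countWeight θ q a k

/-- The total mass of a set, as a nonnegative real number. -/
def mass (α : Measure E) (B : Set E) : ℝ≥0 := (α B).toNNReal

theorem coe_mass (B : Set E) : (mass α B : ℝ≥0∞) = α B := ENNReal.coe_toNNReal (measure_ne_top _ _)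

/-! ### Joint law of the counts in disjoint sets. -/

section Joint

variable {ι : Type*} {B : ι → Set E}

theorem measurableSet_counts [Finite ι] (hB : ∀ i, MeasurableSet (B i)) (k : ι → ℕ) :
    MeasurableSet {η : Config E | ∀ i, count (B i) η = k i} := by
  simp only [ofPred_forall]
  exact MeasurableSet.iInter fun i => measurable_count (hB i) (measurableSet_singleton _)

/-- Mecke equation for the test function 1_{S'}(η) 1_{B_i}(x): on S' there are k_i + 1 choices of x
in B_i, and adding a point of B_i leads into S' exactly from S, where the Papangelou mass of B_i is
q(α(B_i) + θ k_i). -/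
theorem IsMecke.measure_counts_update [Finite ι] [DecidableEq ι] {ρ : Measure (Config E)}
    (hρ : IsMecke α θ q ρ) (hB : ∀ i, MeasurableSet (B i))
    (hd : Pairwise fun i j => Disjoint (B i) (B j)) (k : ι → ℕ) (i : ι) :
    ((k i : ℝ≥0∞) + 1) * ρ {η | ∀ j, count (B j) η = Function.update k i (k i + 1) j} =
      q * ((mass α (B i) + θ * k i : ℝ≥0) * ρ {η | ∀ j, count (B j) η = k j}) := by
  set k' := Function.update k i (k i + 1) with hk'
  set S := {η : Config E | ∀ j, count (B j) η = k j} with hS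
  set S' := {η : Config E | ∀ j, count (B j) η = k' j} with hS'
  have hSm : MeasurableSet S := measurableSet_counts hB k
  have hSm' : MeasurableSet S' := measurableSet_counts hB k'
  have hmem : ∀ ξ, ∀ y ∈ B i, (addPoint ξ y ∈ S' ↔ ξ ∈ S) := by
    classical
    intro ξ y hy
    refine forall_congr' fun j => ?_
    rw [count_addPoint (hB j), hk']
    rcases eq_or_ne j i with rfl | hji
    · simp [hy]
    · have : y ∉ B j := fun h => Set.disjoint_left.1 (hd hji) h hy
      simp [this, hji]
  have h := hρ (fun η x => S'.indicator 1 η * (B i).indicator 1 x)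
    (((measurable_one.indicator hSm').comp measurable_fst).mul
      ((measurable_one.indicator (hB i)).comp measurable_snd))
  have h1 : ∀ η : Config E, ∫⁻ x, S'.indicator 1 η * (B i).indicator 1 x ∂η.1 =
      ((k i : ℝ≥0∞) + 1) * S'.indicator 1 η := by
    intro η
    rw [lintegral_const_mul _ (measurable_one.indicator (hB i)), lintegral_indicator_one (hB i)]
    by_cases hη : η ∈ S'
    · have := hη i
      rw [← coe_count (hB i), this, hk']
      simp [hη]
    · simp [hη]
  have h2 : ∀ ξ : Config E, ∫⁻ y, S'.indicator 1 (addPoint ξ y) * (B i).indicator 1 y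
      ∂papangelou α θ ξ = (mass α (B i) + θ * k i : ℝ≥0) * S.indicator 1 ξ := by
    intro ξ
    have h3 : ∀ y, S'.indicator (1 : Config E → ℝ≥0∞) (addPoint ξ y) *
        (B i).indicator (1 : E → ℝ≥0∞) y = S.indicator 1 ξ * (B i).indicator 1 y := by
      intro y
      by_cases hy : y ∈ B i
      · by_cases hξ : ξ ∈ S
        · simp [hy, hξ, (hmem ξ y hy).2 hξ]
        · simp [hξ, mt (hmem ξ y hy).1 hξ]
      · simp [hy]
    simp only [h3]
    rw [lintegral_const_mul _ (measurable_one.indicator (hB i)), lintegral_indicator_one (hB i),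
      papangelou, Measure.add_apply, Measure.smul_apply]
    by_cases hξ : ξ ∈ S
    · rw [← coe_count (hB i), hξ i, ← coe_mass]
      simp [hξ, ENNReal.smul_def]
    · simp [hξ]
  simp only [h1, h2] at h
  rw [lintegral_const_mul _ (measurable_one.indicator hSm'),
    lintegral_const_mul _ (measurable_one.indicator hSm), lintegral_indicator_one hSm',
    lintegral_indicator_one hSm] at h
  exact h

theorem IsMecke.measure_counts [Fintype ι] {ρ : Measure (Config E)}
    (hρ : IsMecke α θ q ρ) (hB : ∀ i, MeasurableSet (B i))
    (hd : Pairwise fun i j => Disjoint (B i) (B j)) (k : ι → ℕ) :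
    ρ {η | ∀ i, count (B i) η = k i} =
      (∏ i, countWeight θ q (mass α (B i)) (k i) : ℝ≥0) * ρ {η | ∀ i, count (B i) η = 0} := by
  classical
  obtain ⟨s, hs⟩ : ∃ s, ∑ i, k i = s := ⟨_, rfl⟩
  induction s generalizing k with
  | zero =>
    have : ∀ i, k i = 0 := by simpa using hs
    simp [this, countWeight]
  | succ s ih =>
    obtain ⟨i, hi⟩ : ∃ i, k i ≠ 0 := by
      by_contra! h
      simp [h] at hs
    obtain ⟨l, hl⟩ := Nat.exists_eq_succ_of_ne_zero hi
    set k₀ := Function.update k i l with hk₀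
    have hk : k = Function.update k₀ i (k₀ i + 1) := by
      simp only [hk₀, Function.update_self, Function.update_idem]
      rw [← Nat.succ_eq_add_one, ← hl, Function.update_eq_self]
    have hsum : ∑ j, k₀ j = s := by
      have h1 := Finset.sum_update_of_mem (Finset.mem_univ i) k l
      have h2 := Finset.add_sum_erase Finset.univ k (Finset.mem_univ i)
      rw [← Finset.erase_eq] at h1
      rw [hk₀, h1]
      omega
    have h := hρ.measure_counts_update hB hd k₀ i
    rw [ih k₀ hsum, ← hk] at h
    have hne : ((k₀ i : ℝ≥0∞) + 1) ≠ 0 := by simp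
    have hnt : ((k₀ i : ℝ≥0∞) + 1) ≠ ∞ := by finiteness
    have hw : (k₀ i + 1 : ℝ≥0) * ∏ j, countWeight θ q (mass α (B j)) (k j) =
        q * ((mass α (B i) + θ * k₀ i) * ∏ j, countWeight θ q (mass α (B j)) (k₀ j)) := by
      rw [← Finset.mul_prod_erase _ _ (Finset.mem_univ i),
        ← Finset.mul_prod_erase _ (fun j => countWeight θ q (mass α (B j)) (k₀ j))
          (Finset.mem_univ i)]
      have h1 : ∏ j ∈ Finset.univ.erase i, countWeight θ q (mass α (B j)) (k j) =
          ∏ j ∈ Finset.univ.erase i, countWeight θ q (mass α (B j)) (k₀ j) := by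
        refine Finset.prod_congr rfl fun j hj => ?_
        rw [hk₀, Function.update_of_ne (Finset.ne_of_mem_erase hj)]
      have h2 : k₀ i = l := by simp [hk₀]
      rw [h1, h2, hl, Nat.succ_eq_add_one, countWeight]
      have : (l + 1 : ℝ≥0) ≠ 0 := by positivity
      field_simp
    refine (ENNReal.mul_right_inj hne hnt).1 ?_
    rw [h, ← mul_assoc, ← mul_assoc, ← mul_assoc]
    congr 1
    have : ((k₀ i : ℝ≥0∞) + 1) = ((k₀ i + 1 : ℝ≥0) : ℝ≥0∞) := by push_cast; rfl
    rw [this, ← ENNReal.coe_mul, ← ENNReal.coe_mul, ← ENNReal.coe_mul, hw, mul_assoc]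

theorem IsMecke.measure_count {ρ : Measure (Config E)} (hρ : IsMecke α θ q ρ) {B : Set E}
    (hB : MeasurableSet B) (k : ℕ) :
    ρ {η | count B η = k} = countWeight θ q (mass α B) k * ρ {η | count B η = 0} := by
  have h := hρ.measure_counts (ι := Unit) (B := fun _ => B) (fun _ => hB)
    (fun i j hij => (hij rfl).elim) fun _ => k
  simpa using h

theorem tsum_measure_count (ρ : Measure (Config E)) {B : Set E} (hB : MeasurableSet B) :
    ∑' k : ℕ, ρ {η | count B η = k} = ρ univ := by
  have : (univ : Set (Config E)) = ⋃ k : ℕ, {η | count B η = k} := by ext; simp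
  rw [this, measure_iUnion]
  · intro i j hij
    rw [Function.onFun, Set.disjoint_left]
    rintro η hi hj
    exact hij (hi.symm.trans hj)
  · exact fun k => measurable_count hB (measurableSet_singleton k)

/-- The numbers of points in disjoint sets are independent. -/
theorem IsMecke.iIndepFun_count [Fintype ι] {ρ : Measure (Config E)} [IsProbabilityMeasure ρ]
    (hρ : IsMecke α θ q ρ) (hB : ∀ i, MeasurableSet (B i))
    (hd : Pairwise fun i j => Disjoint (B i) (B j)) :
    iIndepFun (fun i η => count (B i) η) ρ := by
  have hm : ∀ i, Measurable fun η : Config E => count (B i) η := fun i => measurable_count (hB i)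
  rw [iIndepFun_iff_map_fun_eq_pi_map fun i => (hm i).aemeasurable]
  let W : (ι → ℕ) → ℝ≥0∞ := fun k => (∏ i, countWeight θ q (mass α (B i)) (k i) : ℝ≥0)
  have hmap : Measurable fun (η : Config E) i => count (B i) η := measurable_pi_lambda _ hm
  have : IsProbabilityMeasure (ρ.map fun η i => count (B i) η) :=
    Measure.isProbabilityMeasure_map hmap.aemeasurable
  have : ∀ i, IsProbabilityMeasure (ρ.map fun η => count (B i) η) := fun i =>
    Measure.isProbabilityMeasure_map (hm i).aemeasurable
  have h1 : ∀ k, (ρ.map fun η i => count (B i) η) {k} =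
      W k * ρ {η | ∀ i, count (B i) η = 0} := by
    intro k
    rw [Measure.map_apply hmap (measurableSet_singleton k), ← hρ.measure_counts hB hd]
    congr 1
    ext η
    simp [funext_iff]
  have h2 : ∀ k, (Measure.pi fun i => ρ.map fun η => count (B i) η) {k} =
      W k * ∏ i, ρ {η | count (B i) η = 0} := by
    intro k
    rw [Measure.pi_singleton]
    simp only [W]
    push_cast
    rw [← Finset.prod_mul_distrib]
    refine Finset.prod_congr rfl fun i _ => ?_
    rw [Measure.map_apply (hm i) (measurableSet_singleton _), ← hρ.measure_count (hB i)]
    rfl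
  -- The joint law and the product of the marginals are both constant multiples of the weights W.
  -- Total mass one forces the constants to agree, without computing the sum of W.
  have htot : ∀ (μ : Measure (ι → ℕ)) [IsProbabilityMeasure μ] (r : ℝ≥0∞),
      (∀ k, μ {k} = W k * r) → (∑' k, W k) * r = 1 := by
    intro μ _ r hμ
    rw [← ENNReal.tsum_mul_right, ← measure_univ (μ := μ)]
    simp only [← hμ]
    have h := Measure.tsum_indicator_apply_singleton μ univ MeasurableSet.univ
    simpa using h
  have e1 := htot _ _ h1
  have e2 := htot _ _ h2
  have hr : ρ {η | ∀ i, count (B i) η = 0} = ∏ i, ρ {η | count (B i) η = 0} := by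
    have hz : (∑' k, W k) ≠ 0 := fun h => by simp [h] at e1
    have ht : (∑' k, W k) ≠ ∞ := fun h => by
      rw [h] at e1
      have : ρ {η | ∀ i, count (B i) η = 0} ≠ 0 := fun h0 => by simp [h0] at e1
      simp [ENNReal.top_mul this] at e1
    exact (ENNReal.mul_right_inj hz ht).1 (e1.trans e2.symm)
  refine Measure.ext_of_singleton fun k => ?_
  rw [h1, h2, hr]

end Joint

end Mecke

end GSIP

end

noncomputable section

namespace GSIP

universe u

variable {E : Type u} [MeasurableSpace E]

/-! ### Normalization -/

section Normalization

variable (α : Measure E) [IsFiniteMeasure α] (θ q : ℝ≥0)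

theorem pointMeasure_size_eq_zero (m : ℕ) :
    pointMeasure α θ m {η : Config E | size η = 0} = if m = 0 then 1 else 0 := by
  have hm : MeasurableSet {η : Config E | size η = 0} :=
    measurable_size (measurableSet_singleton 0)
  rcases m with _ | m
  · rw [pointMeasure, Measure.dirac_apply' _ hm]
    simp [emptyConfig]
  · rw [← lintegral_indicator_one hm,
      lintegral_pointMeasure_succ α θ m (measurable_one.indicator hm)]
    simp

theorem gibbsMeasure_size_eq_zero : gibbsMeasure α θ q {η : Config E | size η = 0} = 1 := by
  have hm : MeasurableSet {η : Config E | size η = 0} :=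
    measurable_size (measurableSet_singleton 0)
  rw [gibbsMeasure, Measure.sum_apply _ hm, tsum_eq_single 0]
  · simp [pointMeasure_size_eq_zero]
  · intro m hm
    simp [pointMeasure_size_eq_zero, hm]

/-- The normalizing constant is read off from the Mecke recursion for the total count, since the
empty configuration has mass 1 in `gibbsMeasure`. -/
theorem gibbsMeasure_univ :
    gibbsMeasure α θ q univ = ∑' k, (countWeight θ q (mass α univ) k : ℝ≥0∞) := by
  rw [← tsum_measure_count _ MeasurableSet.univ]
  refine tsum_congr fun k => ?_
  rw [(isMecke_gibbsMeasure α θ q).measure_count MeasurableSet.univ, gibbsMeasure_size_eq_zero,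
    mul_one]

theorem exists_isMecke (h : Summable (countWeight θ q (mass α univ))) :
    ∃ ρ : Measure (Config E), IsProbabilityMeasure ρ ∧ IsMecke α θ q ρ := by
  have ht : gibbsMeasure α θ q univ ≠ ∞ := by
    rw [gibbsMeasure_univ]
    exact ENNReal.tsum_coe_ne_top_iff_summable.2 h
  have h0 : gibbsMeasure α θ q univ ≠ 0 := fun h0 => by
    have := measure_mono_null (subset_univ {η : Config E | size η = 0}) h0
    rw [gibbsMeasure_size_eq_zero] at this
    exact one_ne_zero this
  refine ⟨(gibbsMeasure α θ q univ)⁻¹ • gibbsMeasure α θ q, ⟨?_⟩,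
    (isMecke_gibbsMeasure α θ q).smul _⟩
  simp [ENNReal.inv_mul_cancel h0 ht]

variable {α θ q}

theorem IsMecke.measure_count_of_tsum {ρ : Measure (Config E)} [IsProbabilityMeasure ρ]
    (hρ : IsMecke α θ q ρ) {B : Set E} (hB : MeasurableSet B) {r : ℝ}
    (hr : 0 < r) (hs : HasSum (fun k => (countWeight θ q (mass α B) k : ℝ)) r⁻¹) (k : ℕ) :
    ρ {η | count B η = k} = ENNReal.ofReal (r * countWeight θ q (mass α B) k) := by
  have h1 : ∑' k, (countWeight θ q (mass α B) k : ℝ≥0∞) = ENNReal.ofReal r⁻¹ := by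
    rw [← hs.tsum_eq, ENNReal.ofReal_tsum_of_nonneg (fun k => NNReal.coe_nonneg _) hs.summable]
    exact tsum_congr fun k => (ENNReal.ofReal_coe_nnreal).symm
  have h2 : ∑' k, (countWeight θ q (mass α B) k : ℝ≥0∞) * ρ {η | count B η = 0} = ρ univ := by
    rw [← tsum_measure_count ρ hB]
    exact tsum_congr fun k => (hρ.measure_count hB k).symm
  rw [ENNReal.tsum_mul_right, h1, measure_univ, ENNReal.ofReal_inv_of_pos hr] at h2
  have h3 : ρ {η | count B η = 0} = ENNReal.ofReal r := by
    have := ENNReal.eq_inv_of_mul_eq_one_left (a := ρ {η | count B η = 0})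
      (b := (ENNReal.ofReal r)⁻¹) (by rw [mul_comm]; exact h2)
    rwa [inv_inv] at this
  rw [hρ.measure_count hB, h3, mul_comm, ENNReal.ofReal_mul hr.le, ENNReal.ofReal_coe_nnreal]

end Normalization

/-! ### The Pascal process -/

section Pascal

theorem countWeight_one (q a : ℝ≥0) (k : ℕ) : (countWeight 1 q a k : ℝ) =
    (ascPochhammer ℝ k).eval (a : ℝ) * ((q : ℝ) ^ k / (k.factorial : ℝ)) := by
  induction k with
  | zero => simp [countWeight]
  | succ k ih =>
    rw [countWeight, NNReal.coe_mul, ih, ascPochhammer_succ_right, Nat.factorial_succ]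
    push_cast
    simp only [Polynomial.eval_mul, Polynomial.eval_add, Polynomial.eval_X, Polynomial.eval_natCast]
    have : (k.factorial : ℝ) ≠ 0 := by positivity
    have : (k + 1 : ℝ) ≠ 0 := by positivity
    field_simp
    ring

/-- The binomial series of (1 − p)^{-a}; its coefficients are rising factorials divided by k!. -/
theorem hasSum_countWeight_one {p : ℝ≥0} (hp : p < 1) (a : ℝ≥0) :
    HasSum (fun k => (countWeight 1 p a k : ℝ)) (((1 : ℝ) - p) ^ (a : ℝ))⁻¹ := by
  have hp' : (p : ℝ) < 1 := by exact_mod_cast hp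
  have h := (Real.one_div_one_sub_rpow_hasFPowerSeriesOnBall_zero (a : ℝ)).hasSum (y := (p : ℝ))
    (by simpa [enorm_eq_nnnorm] using hp)
  simp only [zero_add, one_div] at h
  have hk : (fun k => (countWeight 1 p a k : ℝ)) = fun n => (FormalMultilinearSeries.ofScalars ℝ
      (fun n : ℕ => Ring.choose ((a : ℝ) + n - 1) n) n) fun _ => (p : ℝ) := by
    funext k
    rw [countWeight_one, FormalMultilinearSeries.ofScalars_apply_eq, Ring.choose]
    have h1 := Ring.factorial_nsmul_multichoose_eq_ascPochhammer (a : ℝ) k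
    rw [Polynomial.ascPochhammer_smeval_eq_eval, nsmul_eq_mul] at h1
    have h2 : (a : ℝ) + k - 1 - k + 1 = a := by ring
    have : (k.factorial : ℝ) ≠ 0 := by positivity
    rw [h2, ← h1, smul_eq_mul]
    field_simp
  rw [hk]
  exact h

variable {α : Measure E} {p : ℝ}

theorem isPascal_of_isMecke [IsFiniteMeasure α] (hp : p ∈ Ioo (0 : ℝ) 1) {ρ : Measure (Config E)}
    [IsProbabilityMeasure ρ] (hρ : IsMecke α 1 p.toNNReal ρ) : IsPascal α p ρ where
  isProbabilityMeasure := inferInstance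
  indep m B hB hd := by
    have h := (hρ.iIndepFun_count hB hd).comp (fun _ (n : ℕ) => (n : ℝ≥0∞))
      (fun _ => measurable_of_countable _)
    convert h using 2 with i
    funext η
    exact (coe_count (hB i) η).symm
  negBinomial B hB k := by
    have hp1 : p.toNNReal < 1 := by
      rw [← NNReal.coe_lt_coe, Real.coe_toNNReal p hp.1.le]
      exact hp.2
    have hs := hasSum_countWeight_one hp1 (mass α B)
    rw [Real.coe_toNNReal p hp.1.le] at hs
    have h := hρ.measure_count_of_tsum hB (Real.rpow_pos_of_pos (sub_pos.2 hp.2) _) hs k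
    rw [countWeight_one, Real.coe_toNNReal p hp.1.le] at h
    simp only [count_eq_iff hB] at h
    rw [h, mul_assoc]
    rfl

theorem exists_isMecke_pascal (α : Measure E) [IsFiniteMeasure α] (hp : p ∈ Ioo (0 : ℝ) 1) :
    ∃ ρ : Measure (Config E), IsProbabilityMeasure ρ ∧ IsMecke α 1 p.toNNReal ρ := by
  have hp1 : p.toNNReal < 1 := by
    rw [← NNReal.coe_lt_coe, Real.coe_toNNReal p hp.1.le]
    exact hp.2
  exact exists_isMecke α 1 _ (NNReal.summable_coe.1 (hasSum_countWeight_one hp1 _).summable)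

theorem tendsto_pow_mul_pow_nnreal_bounded {r : ℝ} (hr0 : 0 ≤ r) (hr1 : r < 1) (n : ℕ) :
    ∃ C, ∀ k : ℕ, (k : ℝ) ^ n * r ^ k ≤ C := by
  have h := tendsto_pow_const_mul_const_pow_of_abs_lt_one n (r := r) (by rwa [abs_of_nonneg hr0])
  obtain ⟨C, hC⟩ := h.bddAbove_range
  exact ⟨C, fun k => hC ⟨k, rfl⟩⟩

/-- For p < r < 1 the weights for p are those for r times (p/r)^k, and this geometric factor absorbs
k^n. -/
theorem summable_pow_mul_countWeight {p : ℝ≥0} (hp : p < 1) (a : ℝ≥0) (n : ℕ) :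
    Summable fun k : ℕ => (k : ℝ) ^ n * (countWeight 1 p a k : ℝ) := by
  obtain ⟨r, hpr, hr1⟩ := exists_between hp
  have hr0 : (0 : ℝ) < r := by exact_mod_cast pos_of_gt hpr
  have hpr' : (p : ℝ) < r := by exact_mod_cast hpr
  obtain ⟨C, hC⟩ := tendsto_pow_mul_pow_nnreal_bounded (r := p / r) (by positivity)
    ((div_lt_one hr0).2 hpr') n
  refine Summable.of_nonneg_of_le (fun k => by positivity) (fun k => ?_)
    ((hasSum_countWeight_one hr1 a).summable.mul_left C)
  have h : (countWeight 1 p a k : ℝ) = (p / r : ℝ) ^ k * countWeight 1 r a k := by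
    rw [countWeight_one, countWeight_one, div_pow]
    field_simp
  rw [h, ← mul_assoc]
  exact mul_le_mul_of_nonneg_right (hC k) (NNReal.coe_nonneg _)

theorem IsPascal.finiteMoments [IsFiniteMeasure α] (hp : p ∈ Ioo (0 : ℝ) 1)
    {ρ : Measure (Config E)} (hρ : IsPascal α p ρ) : FiniteMoments ρ := by
  intro n
  have hp1 : p.toNNReal < 1 := by
    rw [← NNReal.coe_lt_coe, Real.coe_toNNReal p hp.1.le]
    exact hp.2
  have h1 : ∫⁻ η, η.1 univ ^ n ∂ρ = ∑' k : ℕ, (k : ℝ≥0∞) ^ n * ρ {η | size η = k} := by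
    simp only [← coe_size]
    rw [← lintegral_map (f := fun k : ℕ => (k : ℝ≥0∞) ^ n) (measurable_of_countable _)
      measurable_size, lintegral_countable']
    refine tsum_congr fun k => ?_
    rw [Measure.map_apply measurable_size (measurableSet_singleton k)]
    rfl
  have hC : 0 ≤ (1 - p) ^ α.real univ := Real.rpow_nonneg (sub_nonneg.2 hp.2.le) _
  have h2 : ∀ k : ℕ, (k : ℝ≥0∞) ^ n * ρ {η | size η = k} = ENNReal.ofReal
      ((1 - p) ^ α.real univ * ((k : ℝ) ^ n * countWeight 1 p.toNNReal (mass α univ) k)) := by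
    intro k
    have h3 : {η : Config E | size η = k} = {η : Config E | η.1 univ = (k : ℝ≥0∞)} := by
      ext η
      exact count_eq_iff MeasurableSet.univ
    rw [h3, hρ.negBinomial univ MeasurableSet.univ k, countWeight_one,
      Real.coe_toNNReal p hp.1.le]
    have h4 : ((mass α univ : ℝ≥0) : ℝ) = α.real univ := rfl
    have h5 : (k : ℝ≥0∞) ^ n = ENNReal.ofReal ((k : ℝ) ^ n) := by
      rw [ENNReal.ofReal_pow (by positivity), ENNReal.ofReal_natCast]
    rw [h4, h5, ← ENNReal.ofReal_mul (by positivity)]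
    congr 1
    ring
  rw [h1]
  simp only [h2]
  rw [← ENNReal.ofReal_tsum_of_nonneg]
  · exact ENNReal.ofReal_lt_top
  · intro k
    positivity
  · exact (summable_pow_mul_countWeight hp1 _ n).mul_left _

end Pascal

/-! ### Cylinders -/

section Cylinder

variable [MeasurableSpace.CountablyGenerated E]

open MeasurableSpace (countablePartition)

/-- The configurations with prescribed numbers of points in the atoms of a partition. -/
def cylinder (n : ℕ) (k : Set E → ℕ) : Set (Config E) :=
  {η | ∀ B ∈ countablePartition E n, count B η = k B}

/-- The collection of all cylinders. -/
def cylinders (E : Type u) [MeasurableSpace E] [MeasurableSpace.CountablyGenerated E] :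
    Set (Set (Config E)) := {C | ∃ n k, C = cylinder n k}

theorem measurableSet_cylinder (n : ℕ) (k : Set E → ℕ) : MeasurableSet (cylinder n k) := by
  have : cylinder n k = ⋂ B ∈ countablePartition E n, {η | count B η = k B} := by
    ext η; simp [cylinder]
  rw [this]
  refine MeasurableSet.biInter (MeasurableSpace.finite_countablePartition E n).countable
    fun B hB => ?_
  exact measurable_count (MeasurableSpace.measurableSet_countablePartition n hB)
    (measurableSet_singleton _)

/-- A coarse atom is a finite disjoint union of finer ones, so the counts in the fine atoms
determine its count. -/
theorem count_eq_of_cylinder {n m : ℕ} (hnm : n ≤ m) {k : Set E → ℕ} {η ξ : Config E}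
    (hη : η ∈ cylinder m k) (hξ : ξ ∈ cylinder m k) {B : Set E}
    (hB : B ∈ countablePartition E n) : count B η = count B ξ := by
  have hmono : Monotone fun n => MeasurableSpace.generateFrom (countablePartition E n) :=
    monotone_nat_of_le_succ fun n => MeasurableSpace.generateFrom_countablePartition_le_succ E n
  have h := hmono hnm B (MeasurableSpace.measurableSet_generateFrom hB)
  rw [MeasurableSpace.measurableSet_generateFrom_countablePartition_iff] at h
  obtain ⟨S, hS, rfl⟩ := h
  have hSm : MeasurableSet (⋃₀ (S : Set (Set E))) :=
    MeasurableSpace.measurableSet_countablePartition n hB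
  have hsum : ∀ ζ : Config E, ζ.1 (⋃₀ (S : Set (Set E))) = ∑ A ∈ S, ζ.1 A := by
    intro ζ
    rw [sUnion_eq_biUnion]
    exact measure_biUnion_finset
      (fun A hA A' hA' hne => MeasurableSpace.disjoint_countablePartition (hS hA) (hS hA') hne)
      fun A hA => MeasurableSpace.measurableSet_countablePartition m (hS hA)
  rw [count_eq_iff hSm, coe_count hSm, hsum, hsum]
  refine Finset.sum_congr rfl fun A hA => ?_
  have hAm := MeasurableSpace.measurableSet_countablePartition m (hS hA)
  rw [← coe_count hAm, ← coe_count hAm, hη A (hS hA), hξ A (hS hA)]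

/-- Of two cylinders that meet, the one of the finer partition is contained in the other. -/
theorem isPiSystem_cylinders : IsPiSystem (cylinders E) := by
  have key : ∀ n m (k l : Set E → ℕ), n ≤ m → (cylinder n k ∩ cylinder m l).Nonempty →
      cylinder n k ∩ cylinder m l = cylinder m l := by
    rintro n m k l hnm ⟨η, hηk, hηl⟩
    refine inter_eq_right.2 fun ξ hξ B hB => ?_
    rw [count_eq_of_cylinder hnm hξ hηl hB]
    exact hηk B hB
  rintro _ ⟨n, k, rfl⟩ _ ⟨m, l, rfl⟩ hne
  rcases le_total n m with h | h
  · rw [key n m k l h hne]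
    exact ⟨m, l, rfl⟩
  · rw [inter_comm] at hne ⊢
    rw [key m n l k h hne]
    exact ⟨n, k, rfl⟩

/-- Counts in partition atoms are measurable for the cylinders, and a π-λ argument extends this to
all measurable sets. The empty space is separate because `univ_mem_partitionSets` needs a point. -/
theorem generateFrom_cylinders :
    MeasurableSpace.generateFrom (cylinders E) = (inferInstance : MeasurableSpace (Config E)) := by
  refine le_antisymm (MeasurableSpace.generateFrom_le ?_) ?_
  · rintro _ ⟨n, k, rfl⟩
    exact measurableSet_cylinder n k
  have hpart : ∀ B ∈ partitionSets E,
      Measurable[MeasurableSpace.generateFrom (cylinders E)] fun η : Config E => η.1 B := by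
    classical
    intro B hB
    have hBm := measurableSet_partitionSets hB
    obtain ⟨n, hn⟩ := mem_iUnion.1 hB
    have : Finite (countablePartition E n) := MeasurableSpace.finite_countablePartition E n
    have hcount : Measurable[MeasurableSpace.generateFrom (cylinders E)]
        fun η : Config E => count B η := by
      refine @measurable_to_countable' _ _ _ _ (MeasurableSpace.generateFrom (cylinders E)) _ ?_
      intro j
      have hU : (fun η : Config E => count B η) ⁻¹' {j} =
          ⋃ k : {k : countablePartition E n → ℕ // k ⟨B, hn⟩ = j},
            cylinder n fun A => if h : A ∈ countablePartition E n then k.1 ⟨A, h⟩ else 0 := by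
        ext η
        simp only [mem_preimage, mem_singleton_iff, mem_iUnion]
        constructor
        · rintro rfl
          exact ⟨⟨fun A => count A.1 η, rfl⟩, fun A hA => by simp [hA]⟩
        · rintro ⟨k, hk⟩
          exact (hk B hn).trans ((dif_pos hn).trans k.2)
      rw [hU]
      exact @MeasurableSet.iUnion _ _ (MeasurableSpace.generateFrom (cylinders E)) _ _ fun k =>
        MeasurableSpace.measurableSet_generateFrom ⟨n, _, rfl⟩
    have h2 : (fun η : Config E => η.1 B) = (fun n : ℕ => (n : ℝ≥0∞)) ∘ fun η => count B η :=
      funext fun η => (coe_count hBm η).symm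
    rw [h2]
    exact (measurable_of_countable _).comp hcount
  have hall : ∀ B, MeasurableSet B →
      Measurable[MeasurableSpace.generateFrom (cylinders E)] fun η : Config E => η.1 B := by
    rcases isEmpty_or_nonempty E with hE | hE
    · intro B _
      have : (fun η : Config E => η.1 B) = fun _ => 0 := by
        funext η
        rw [eq_empty_of_isEmpty B, measure_empty]
      rw [this]
      exact measurable_const
    have huniv := hpart univ univ_mem_partitionSets
    intro B hB
    refine MeasurableSpace.induction_on_inter
      (C := fun B _ => Measurable[MeasurableSpace.generateFrom (cylinders E)]
        fun η : Config E => η.1 B)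
      generateFrom_partitionSets.symm isPiSystem_partitionSets ?_ hpart ?_ ?_ B hB
    · simp only [measure_empty]
      exact measurable_const
    · intro B hB ih
      have : (fun η : Config E => η.1 Bᶜ) = fun η => η.1 univ - η.1 B :=
        funext fun η => measure_compl hB (measure_ne_top _ _)
      rw [this]
      exact (Measurable.comp (g := fun z : ℝ≥0∞ × ℝ≥0∞ => z.1 - z.2)
        (measurable_fst.sub measurable_snd) (huniv.prodMk ih))
    · intro f hd hm ih
      have : (fun η : Config E => η.1 (⋃ i, f i)) = fun η => ∑' i, η.1 (f i) :=
        funext fun η => measure_iUnion hd hm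
      rw [this]
      exact @Measurable.tsum _ _ _ (MeasurableSpace.generateFrom (cylinders E)) _ _ _ _ _ _ _ _ _ _ _ _ ih
  have hid := (@measurable_config_iff E _ (Config E) (MeasurableSpace.generateFrom (cylinders E))
    id).2 hall
  exact fun s hs => hid hs

theorem measure_ext_of_cylinder {μ ν : Measure (Config E)} [IsProbabilityMeasure μ]
    [IsProbabilityMeasure ν] (h : ∀ n k, μ (cylinder n k) = ν (cylinder n k)) : μ = ν := by
  refine ext_of_generate_finite _ generateFrom_cylinders.symm isPiSystem_cylinders ?_ (by simp)
  rintro _ ⟨n, k, rfl⟩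
  exact h n k

/-- A cylinder prescribes the counts in finitely many disjoint sets, so independence and the
negative binomial law give its probability as an explicit product. -/
theorem IsPascal.unique {α : Measure E} {p : ℝ} {ρ ρ' : Measure (Config E)} (h : IsPascal α p ρ)
    (h' : IsPascal α p ρ') : ρ = ρ' := by
  have := h.isProbabilityMeasure
  have := h'.isProbabilityMeasure
  refine measure_ext_of_cylinder fun n k => ?_
  have hfin := MeasurableSpace.finite_countablePartition E n
  have : Finite (countablePartition E n) := hfin
  obtain ⟨m, ⟨e⟩⟩ := Finite.exists_equiv_fin (countablePartition E n)
  have hBm : ∀ i, MeasurableSet (e.symm i).1 := fun i =>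
    MeasurableSpace.measurableSet_countablePartition n (e.symm i).2
  have hd : Pairwise fun i j => Disjoint (e.symm i).1 (e.symm j).1 := fun i j hij =>
    MeasurableSpace.disjoint_countablePartition (e.symm i).2 (e.symm j).2 fun heq =>
      hij (e.symm.injective (Subtype.ext heq))
  have key : ∀ {μ : Measure (Config E)}, IsPascal α p μ → μ (cylinder n k) =
      ∏ i, μ {η | η.1 (e.symm i).1 = (k (e.symm i).1 : ℕ)} := by
    intro μ hμ
    have := (hμ.indep m (fun i => (e.symm i).1) hBm hd).measure_inter_preimage_eq_mul Finset.univ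
      (sets := fun i => {(k (e.symm i).1 : ℝ≥0∞)}) fun i _ => measurableSet_singleton _
    have hcyl : cylinder n k = ⋂ i ∈ (Finset.univ : Finset (Fin m)),
        (fun η : Config E => η.1 (e.symm i).1) ⁻¹' {(k (e.symm i).1 : ℝ≥0∞)} := by
      ext η
      simp only [cylinder, Finset.mem_univ, iInter_true, mem_iInter, mem_preimage,
        mem_singleton_iff]
      constructor
      · intro hη i
        exact (count_eq_iff (hBm i)).1 (hη _ (e.symm i).2)
      · intro hη B hB
        have := hη (e ⟨B, hB⟩)
        rw [Equiv.symm_apply_apply] at this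
        exact (count_eq_iff (MeasurableSpace.measurableSet_countablePartition n hB)).2 this
    rw [hcyl, this]
    rfl
  rw [key h, key h']
  exact Finset.prod_congr rfl fun i _ => by
    rw [h.negBinomial _ (hBm i), h'.negBinomial _ (hBm i)]

/-- By uniqueness ρ is the law constructed from the Mecke equation. -/
theorem IsPascal.isMecke {α : Measure E} [IsFiniteMeasure α] {p : ℝ} (hp : p ∈ Ioo (0 : ℝ) 1)
    {ρ : Measure (Config E)} (h : IsPascal α p ρ) : IsMecke α 1 p.toNNReal ρ := by
  obtain ⟨ρ', _, hρ'⟩ := exists_isMecke_pascal α hp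
  rw [h.unique (isPascal_of_isMecke hp hρ')]
  exact hρ'

end Cylinder

end GSIP

end

noncomputable section

namespace GSIP

universe u

/-! ### Reversibility -/

section KernelSymm

variable {S : Type*} [MeasurableSpace S] {σ : S → ℕ} {Q : Kernel S S} {Λ : ℕ → ℝ≥0}
  {ρ : Measure S}

/-- The kernel `Q` is symmetric with respect to `ρ`. -/
def KernelSymm (Q : Kernel S S) (ρ : Measure S) : Prop :=
  ∀ f g : S → ℝ≥0∞, Measurable f → Measurable g →
    ∫⁻ η, f η * ∫⁻ ξ, g ξ ∂Q η ∂ρ = ∫⁻ η, g η * ∫⁻ ξ, f ξ ∂Q η ∂ρ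

theorem KernelSymm.isReversible (h : KernelSymm Q ρ) : Q.IsReversible ρ := by
  intro A B hA hB
  have key : ∀ {A B : Set S}, MeasurableSet A → MeasurableSet B →
      ∫⁻ x in A, Q x B ∂ρ = ∫⁻ η, A.indicator 1 η * ∫⁻ ξ, B.indicator 1 ξ ∂Q η ∂ρ := by
    intro A B hA hB
    rw [← lintegral_indicator hA]
    refine lintegral_congr fun η => ?_
    rw [lintegral_indicator_one hB]
    by_cases h : η ∈ A <;> simp [h]
  rw [key hA hB, key hB hA]
  exact h _ _ (measurable_one.indicator hA) (measurable_one.indicator hB)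

theorem KernelSymm.pow (h : KernelSymm Q ρ) (k : ℕ) : KernelSymm (Q ^ k) ρ := by
  induction k with
  | zero =>
    intro f g hf hg
    change ∫⁻ η, f η * ∫⁻ ξ, g ξ ∂(Kernel.id η) ∂ρ = ∫⁻ η, g η * ∫⁻ ξ, f ξ ∂(Kernel.id η) ∂ρ
    simp only [Kernel.id_apply, lintegral_dirac' _ hf, lintegral_dirac' _ hg, mul_comm]
  | succ k ih =>
    intro f g hf hg
    have h1 : ∀ η, ∫⁻ ξ, g ξ ∂(Q ^ (k + 1)) η = ∫⁻ ζ, ∫⁻ ξ, g ξ ∂(Q ^ k) ζ ∂Q η := fun η => by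
      rw [pow_succ_eq_comp, Kernel.lintegral_comp _ _ _ hg]
    have h2 : ∀ η, ∫⁻ ξ, f ξ ∂(Q ^ (k + 1)) η = ∫⁻ ζ, ∫⁻ ξ, f ξ ∂Q ζ ∂(Q ^ k) η := fun η => by
      rw [pow_succ']
      exact Kernel.lintegral_comp _ _ _ hf
    simp only [h1, h2]
    rw [h _ _ hf hg.lintegral_kernel, ← ih _ _ hf.lintegral_kernel hg]
    simp only [mul_comm]

/-- The weights depend only on the conserved σ, so they can be moved from the starting point to the
end point of Q^k, and each power of Q is symmetric. -/
theorem KernelSymm.poissonized (h : KernelSymm Q ρ) (hσ : Measurable σ)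
    (hQ : ∀ η, ∀ᵐ ξ ∂Q η, σ ξ = σ η) (t : ℝ≥0) : KernelSymm (poissonized hσ Q Λ t) ρ := by
  intro f g hf hg
  have hw : ∀ k, Measurable fun η => poissonWeight (Λ (σ η) * t) k := fun k =>
    (measurable_of_countable fun n => poissonWeight (Λ n * t) k).comp hσ
  have hexp : ∀ {f g : S → ℝ≥0∞}, Measurable f → Measurable g →
      ∫⁻ η, f η * ∫⁻ ξ, g ξ ∂GSIP.poissonized hσ Q Λ t η ∂ρ =
      ∑' k, ∫⁻ η, (f η * poissonWeight (Λ (σ η) * t) k) * ∫⁻ ξ, g ξ ∂(Q ^ k) η ∂ρ := by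
    intro f g hf hg
    rw [← lintegral_tsum (f := fun k η => f η * poissonWeight (Λ (σ η) * t) k *
      ∫⁻ ξ, g ξ ∂(Q ^ k) η) fun k => ((hf.mul (hw k)).mul hg.lintegral_kernel).aemeasurable]
    refine lintegral_congr fun η => ?_
    rw [lintegral_poissonized, ← ENNReal.tsum_mul_left]
    simp only [mul_assoc]
  rw [hexp hf hg, hexp hg hf]
  refine tsum_congr fun k => ?_
  rw [h.pow k (fun η => f η * poissonWeight (Λ (σ η) * t) k) _ (hf.mul (hw k)) hg]
  refine lintegral_congr fun η => ?_
  rw [mul_assoc, ← lintegral_const_mul _ hf]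
  congr 1
  refine lintegral_congr_ae ?_
  filter_upwards [ae_pow_level hσ hQ k η] with ξ hξ
  rw [hξ, mul_comm]

end KernelSymm

/-! ### Detailed balance for the jump kernel. -/

section Jump

variable {E : Type u} [MeasurableSpace E] [StandardBorelSpace E]
  (α : Measure E) [IsFiniteMeasure α] {c : E → E → ℝ≥0}
  (hc : Measurable (Function.uncurry c)) {K : ℝ≥0}

omit [StandardBorelSpace E] [IsFiniteMeasure α] in
theorem papangelou_one (ξ : Config E) : papangelou α 1 ξ = α + ξ.1 := by
  rw [papangelou, one_smul]

/-- The Mecke equation removes the jumping particle: with η = ξ + δ_x the jump becomes ξ + δ_x → ξ +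
δ_y, and the arrival measure α + η is the Papangelou kernel at ξ + δ_x. -/
theorem IsMecke.lintegral_mul_jumpMeasure {α : Measure E} [IsFiniteMeasure α]
    (hc : Measurable (Function.uncurry c)) {q : ℝ≥0} {ρ : Measure (Config E)}
    (hρ : IsMecke α 1 q ρ) {f g : Config E → ℝ≥0∞} (hf : Measurable f) (hg : Measurable g) :
    ∫⁻ η, f η * ∫⁻ ξ, g ξ ∂jumpMeasure α c η ∂ρ =
      q * ∫⁻ ξ, ∫⁻ x, ∫⁻ y, c x y * (f (addPoint ξ x) * g (addPoint ξ y))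
        ∂papangelou α 1 (addPoint ξ x) ∂papangelou α 1 ξ ∂ρ := by
  have hm : Measurable fun w : (Config E × E) × E =>
      (c w.1.2 w.2 : ℝ≥0∞) * g (move w.1.1 w.1.2 w.2) := by
    have h1 : Measurable fun w : (Config E × E) × E => (c w.1.2 w.2 : ℝ≥0∞) :=
      (hc.comp (measurable_fst.snd.prodMk measurable_snd)).coe_nnreal_ennreal
    have h2 : Measurable fun w : (Config E × E) × E => move w.1.1 w.1.2 w.2 :=
      measurable_move.comp (g := fun z : Config E × E × E => move z.1 z.2.1 z.2.2)
        (f := fun w : (Config E × E) × E => (w.1.1, w.1.2, w.2))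
        (measurable_fst.fst.prodMk (measurable_fst.snd.prodMk measurable_snd))
    exact h1.mul (hg.comp h2)
  have hinner : Measurable fun w : Config E × E =>
      ∫⁻ y, c w.2 y * g (move w.1 w.2 y) ∂papangelou α 1 w.1 :=
    measurable_lintegral_papangelou α 1 (g := fun w : Config E × E => w.1) measurable_fst
      (f := fun w y => c w.2 y * g (move w.1 w.2 y)) hm
  have h0 : ∀ η, f η * ∫⁻ ξ, g ξ ∂jumpMeasure α c η =
      ∫⁻ x, f η * ∫⁻ y, c x y * g (move η x y) ∂papangelou α 1 η ∂η.1 := fun η => by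
    rw [lintegral_jumpMeasure α hc η hg, papangelou_one, lintegral_const_mul]
    have := hinner.comp (measurable_prodMk_left (x := η))
    simp only [papangelou_one] at this
    exact this
  simp only [h0]
  rw [hρ (fun η x => f η * ∫⁻ y, c x y * g (move η x y) ∂papangelou α 1 η)
    ((hf.comp measurable_fst).mul hinner)]
  congr 1
  refine lintegral_congr fun ξ => lintegral_congr fun x => ?_
  have hmy : Measurable fun y => (c x y : ℝ≥0∞) * g (addPoint ξ y) := by
    refine Measurable.mul ?_ (hg.comp (measurable_addPoint_config ξ))
    exact (hc.comp (measurable_prodMk_left (x := x))).coe_nnreal_ennreal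
  simp only [move_addPoint]
  rw [← lintegral_const_mul _ hmy]
  refine lintegral_congr fun y => ?_
  ring

theorem IsMecke.lintegral_jumpMeasure_symm {α : Measure E} [IsFiniteMeasure α]
    (hc : Measurable (Function.uncurry c)) (hsymm : ∀ x y, c x y = c y x) {q : ℝ≥0}
    {ρ : Measure (Config E)} (hρ : IsMecke α 1 q ρ) {f g : Config E → ℝ≥0∞} (hf : Measurable f)
    (hg : Measurable g) :
    ∫⁻ η, f η * ∫⁻ ξ, g ξ ∂jumpMeasure α c η ∂ρ =
      ∫⁻ η, g η * ∫⁻ ξ, f ξ ∂jumpMeasure α c η ∂ρ := by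
  rw [hρ.lintegral_mul_jumpMeasure hc hf hg, hρ.lintegral_mul_jumpMeasure hc hg hf]
  congr 1
  refine lintegral_congr fun ξ => ?_
  rw [lintegral_papangelou_swap α 1 ξ
    (k := fun x y => c x y * (f (addPoint ξ x) * g (addPoint ξ y)))]
  · refine lintegral_congr fun x => lintegral_congr fun y => ?_
    rw [hsymm, mul_comm (f _)]
  · refine Measurable.mul hc.coe_nnreal_ennreal (Measurable.mul ?_ ?_)
    · exact (hf.comp (measurable_addPoint_config ξ)).comp measurable_fst
    · exact (hg.comp (measurable_addPoint_config ξ)).comp measurable_snd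

/-- The jump part is symmetric by the previous lemma, the rate being a function of the conserved
size; the atom at the current state multiplies f g pointwise, which is symmetric anyway. -/
theorem IsMecke.kernelSymm_jumpKernel {α : Measure E} [IsFiniteMeasure α]
    (hc : Measurable (Function.uncurry c)) (hsymm : ∀ x y, c x y = c y x) {q : ℝ≥0}
    {ρ : Measure (Config E)} (hρ : IsMecke α 1 q ρ) : KernelSymm (jumpKernel α hc K) ρ := by
  intro f g hf hg
  have hΛ : Measurable fun η : Config E => (rateBound α K (size η) : ℝ≥0∞)⁻¹ :=
    (measurable_of_countable fun n => (rateBound α K n : ℝ≥0∞)⁻¹).comp measurable_size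
  have hexp : ∀ {f g : Config E → ℝ≥0∞}, Measurable f → Measurable g →
      ∫⁻ η, f η * ∫⁻ ξ, g ξ ∂jumpKernel α hc K η ∂ρ =
      ∫⁻ η, ((rateBound α K (size η) : ℝ≥0∞)⁻¹ * f η) * ∫⁻ ξ, g ξ ∂jumpMeasure α c η ∂ρ +
      ∫⁻ η, (rateBound α K (size η) : ℝ≥0∞)⁻¹ * ((rateBound α K (size η) : ℝ≥0∞) -
        jumpMeasure α c η univ) * (f η * g η) ∂ρ := by
    intro f g hf hg
    rw [← lintegral_add_left]
    · refine lintegral_congr fun η => ?_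
      rw [jumpKernel_apply, lintegral_smul_measure, lintegral_add_measure, lintegral_smul_measure,
        lintegral_dirac' _ hg, smul_eq_mul, smul_eq_mul]
      ring
    · refine (hΛ.mul hf).mul ?_
      exact (Measure.measurable_lintegral hg).comp (measurable_jumpMeasure α hc)
  rw [hexp hf hg, hexp hg hf, hρ.lintegral_jumpMeasure_symm hc hsymm
    (f := fun η => (rateBound α K (size η) : ℝ≥0∞)⁻¹ * f η) (hΛ.mul hf) hg]
  congr 1
  · refine lintegral_congr fun η => ?_
    rw [mul_comm _ (g η), mul_assoc, ← lintegral_const_mul _ hf]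
    congr 1
    refine lintegral_congr_ae ?_
    filter_upwards [ae_jumpMeasure_size α hc η] with ξ hξ
    rw [hξ]
  · simp only [mul_comm (f _)]

theorem IsMecke.isReversible_gsip {α : Measure E} [IsFiniteMeasure α]
    (hc : Measurable (Function.uncurry c)) (hsymm : ∀ x y, c x y = c y x) {q : ℝ≥0}
    {ρ : Measure (Config E)} (hρ : IsMecke α 1 q ρ) (t : ℝ≥0) : (gsip α hc K t).IsReversible ρ :=
  ((hρ.kernelSymm_jumpKernel hc hsymm).poissonized measurable_size (ae_jumpKernel_size α hc)
    t).isReversible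

end Jump

end GSIP

end

noncomputable section

namespace GSIP

universe u

/-! ### The operator of a reversible Markov kernel on `L²` -/

section KernelOperator

variable {S : Type*} [MeasurableSpace S] {κ : Kernel S S} [IsMarkovKernel κ] {ρ : Measure S}
  [IsProbabilityMeasure ρ]

theorem map_swap_compProd_of_isReversible (h : κ.IsReversible ρ) :
    (ρ ⊗ₘ κ).map Prod.swap = ρ ⊗ₘ κ := by
  have : IsFiniteMeasure ((ρ ⊗ₘ κ).map Prod.swap) := inferInstance
  refine Measure.ext_prod fun {s t} hs ht => ?_
  rw [Measure.map_apply measurable_swap (hs.prod ht), preimage_swap_prod,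
    Measure.compProd_apply_prod ht hs, Measure.compProd_apply_prod hs ht]
  exact h ht hs

-- By invariance, integrating against κ does not depend on the representative of an L² class, up to
-- ρ-null sets of starting points.
omit [IsMarkovKernel κ] [IsProbabilityMeasure ρ] in
theorem ae_ae_of_invariant (h : κ.Invariant ρ) {p : S → Prop} (hp : ∀ᵐ ξ ∂ρ, p ξ) :
    ∀ᵐ η ∂ρ, ∀ᵐ ξ ∂κ η, p ξ := by
  rw [← h.def] at hp
  exact Measure.ae_ae_of_ae_comp hp

/-- Let U and V be the isometric embeddings of L²(ρ) into L² of ρ ⊗ κ as functions of the first and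
of the second coordinate. Then T = U*V is the conditional expectation of F(second) given the first
coordinate. It is symmetric because reversibility makes ρ ⊗ κ invariant under the swap. -/
theorem exists_kernelOperator (h : κ.IsReversible ρ) :
    ∃ T : Lp ℝ 2 ρ →L[ℝ] Lp ℝ 2 ρ, (∀ F G, inner ℝ (T F) G = inner ℝ F (T G)) ∧
      ∀ F : Lp ℝ 2 ρ, ∀ᵐ η ∂ρ, Integrable F (κ η) ∧ ∫ ξ, F ξ ∂κ η = T F η := by
  have hfst : MeasurePreserving Prod.fst (ρ ⊗ₘ κ) ρ :=
    ⟨measurable_fst, Measure.fst_compProd ρ κ⟩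
  have hsnd : MeasurePreserving Prod.snd (ρ ⊗ₘ κ) ρ :=
    ⟨measurable_snd, (Measure.snd_compProd ρ κ).trans h.invariant.def⟩
  have hswap : MeasurePreserving Prod.swap (ρ ⊗ₘ κ) (ρ ⊗ₘ κ) :=
    ⟨measurable_swap, map_swap_compProd_of_isReversible h⟩
  let U := (Lp.compMeasurePreservingₗᵢ (E := ℝ) (p := 2) ℝ Prod.fst hfst).toContinuousLinearMap
  let V := (Lp.compMeasurePreservingₗᵢ (E := ℝ) (p := 2) ℝ Prod.snd hsnd).toContinuousLinearMap
  have hU : ∀ F : Lp ℝ 2 ρ, U F =ᵐ[ρ ⊗ₘ κ] fun z => F z.1 := fun F =>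
    Lp.coeFn_compMeasurePreserving F hfst
  have hV : ∀ F : Lp ℝ 2 ρ, V F =ᵐ[ρ ⊗ₘ κ] fun z => F z.2 := fun F =>
    Lp.coeFn_compMeasurePreserving F hsnd
  have hinner : ∀ F G : Lp ℝ 2 ρ, inner ℝ (V F) (U G) = ∫ z, F z.2 * G z.1 ∂(ρ ⊗ₘ κ) := by
    intro F G
    rw [L2.inner_def]
    refine integral_congr_ae ?_
    filter_upwards [hU G, hV F] with z h1 h2
    rw [h1, h2]
    exact mul_comm _ _
  have hT : ∀ F G : Lp ℝ 2 ρ, inner ℝ ((U.adjoint ∘L V) F) G = inner ℝ (V F) (U G) :=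
    fun F G => ContinuousLinearMap.adjoint_inner_left U G (V F)
  refine ⟨U.adjoint ∘L V, fun F G => ?_, fun F => ?_⟩
  · rw [hT, real_inner_comm ((U.adjoint ∘L V) G) F, hT, hinner, hinner]
    have := hswap.integral_comp' (f := MeasurableEquiv.prodComm)
      (g := fun z : S × S => G z.2 * F z.1)
    rw [← this]
    refine integral_congr_ae (.of_forall fun z => mul_comm _ _)
  · have hFi : Integrable F ρ := (Lp.memLp F).integrable one_le_two
    have hFi' : Integrable (fun z : S × S => F z.2) (ρ ⊗ₘ κ) :=
      hsnd.integrable_comp_of_integrable hFi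
    have h1 := ((Measure.integrable_compProd_iff hFi'.1).1 hFi').1
    have h2 : Integrable (fun η => ∫ ξ, F ξ ∂κ η) ρ := by
      simpa using Integrable.integral_compProd (κ := Kernel.const Unit ρ)
        (η := Kernel.prodMkLeft Unit κ) (a := ()) hFi'
    have h3 : (fun η => ∫ ξ, F ξ ∂κ η) =ᵐ[ρ] (U.adjoint ∘L V) F := by
      -- The integral of T F over s is its inner product with the indicator of s, hence the integral
      -- of F(second) over the event that the first coordinate is in s.
      refine h2.ae_eq_of_forall_setIntegral_eq _ _ ((Lp.memLp _).integrable one_le_two)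
        fun s hs _ => ?_
      rw [← L2.inner_indicatorConstLp_one (𝕜 := ℝ) hs (measure_ne_top ρ s), real_inner_comm, hT,
        hinner]
      have h4 := Measure.setIntegral_compProd hs MeasurableSet.univ (μ := ρ) (κ := κ)
        (f := fun z => F z.2) hFi'.integrableOn
      simp only [Measure.restrict_univ] at h4
      rw [← h4, ← integral_indicator (hs.prod MeasurableSet.univ)]
      refine integral_congr_ae ?_
      filter_upwards [hfst.quasiMeasurePreserving.ae
        (indicatorConstLp_coeFn (p := 2) (hs := hs) (hμs := measure_ne_top ρ s) (c := (1 : ℝ)))]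
        with z hz
      rw [hz]
      by_cases hzs : z.1 ∈ s <;> simp [hzs]
    filter_upwards [h1, h3] with η h1 h3
    exact ⟨h1, h3⟩

end KernelOperator

/-- T preserves the closure of V, hence by symmetry its complement, so T maps the projection of m
into the complement. Its difference from m' is m' − T m plus the image of a vector of the closure,
so it lies in the closure of V. -/
theorem map_starProjection_orthogonal {H : Type*} [NormedAddCommGroup H] [InnerProductSpace ℝ H]
    [CompleteSpace H] {T : H →L[ℝ] H} (hT : ∀ x y, inner ℝ (T x) y = inner ℝ x (T y))
    {V : Submodule ℝ H} (hV : ∀ x ∈ V, T x ∈ V) {m m' : H} (hm : m' - T m ∈ V) :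
    T (V.topologicalClosureᗮ.starProjection m) = V.topologicalClosureᗮ.starProjection m' := by
  have hcl : ∀ x ∈ V.topologicalClosure, T x ∈ V.topologicalClosure := by
    intro x hx
    exact map_mem_closure (s := (V : Set H)) (t := (V : Set H)) T.continuous hx hV
  have horth : ∀ x ∈ V.topologicalClosureᗮ, T x ∈ V.topologicalClosureᗮ := by
    intro x hx
    rw [Submodule.mem_orthogonal] at hx ⊢
    intro y hy
    rw [← hT]
    exact hx _ (hcl y hy)
  have hproj : V.topologicalClosure.HasOrthogonalProjection := inferInstance
  symm
  refine Submodule.eq_starProjection_of_mem_orthogonal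
    (horth _ (Submodule.starProjection_apply_mem _ _)) ?_
  rw [Submodule.orthogonal_orthogonal]
  have h1 : V.topologicalClosureᗮ.starProjection m =
      m - V.topologicalClosure.starProjection m := by
    rw [Submodule.starProjection_orthogonal_val]
  have h2 : m' - T (V.topologicalClosureᗮ.starProjection m) =
      (m' - T m) + T (V.topologicalClosure.starProjection m) := by
    rw [h1, map_sub]; abel
  rw [h2]
  exact add_mem (V.le_topologicalClosure hm) (hcl _ (Submodule.starProjection_apply_mem _ _))

end GSIP

end

noncomputable section

namespace GSIP

universe u

variable {E : Type u} [MeasurableSpace E]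

/-! ### Generalized polynomials -/

section Polynomial

theorem pi_ofTuple (n : ℕ) {m : ℕ} (x : Fin m → E) :
    (Measure.pi fun _ : Fin n => (ofTuple x).1) =
      ∑ i : Fin n → Fin m, Measure.dirac (x ∘ i) := by
  classical
  refine Measure.pi_eq fun s hs => ?_
  have h1 : ∀ a, (ofTuple x).1 (s a) = ∑ j, if x j ∈ s a then 1 else 0 := by
    intro a
    rw [ofTuple, Measure.finsetSum_apply]
    refine Finset.sum_congr rfl fun j _ => ?_
    rw [Measure.dirac_apply' _ (hs a), indicator_apply]
    rfl
  simp only [h1]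
  rw [Finset.prod_univ_sum, Fintype.piFinset_univ, Measure.finsetSum_apply]
  refine Finset.sum_congr rfl fun i _ => ?_
  rw [Measure.dirac_apply' _ (MeasurableSet.univ_pi hs), Finset.prod_ite_zero]
  simp [indicator_apply, Set.mem_pi]

theorem monomial_ofTuple {n m : ℕ} {f : (Fin n → E) → ℝ} (hf : Measurable f) (x : Fin m → E) :
    monomial f (ofTuple x) = ∑ i : Fin n → Fin m, f (x ∘ i) := by
  rw [monomial, pi_ofTuple, integral_finsetSum_measure]
  · exact Finset.sum_congr rfl fun i _ => integral_dirac' _ _ hf.stronglyMeasurable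
  · intro i _
    refine (integrable_const (f (x ∘ i))).congr ?_
    rw [Filter.EventuallyEq, ae_dirac_iff (measurableSet_eq_fun measurable_const hf)]

/-- The map collapsing the arguments of a function along a partition of the index set. -/
def collapse {n : ℕ} (f : (Fin n → E) → ℝ) (s : Setoid (Fin n)) :
    (Fin (Nat.card (Quotient s)) → E) → ℝ :=
  fun z => f fun a => z (Finite.equivFin (Quotient s) ⟦a⟧)

theorem measurable_collapse {n : ℕ} {f : (Fin n → E) → ℝ} (hf : Measurable f)
    (s : Setoid (Fin n)) : Measurable (collapse f s) :=
  hf.comp (measurable_pi_lambda _ fun _ => measurable_pi_apply _)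

instance (n : ℕ) : Finite (Setoid (Fin n)) :=
  Finite.of_injective (fun s : Setoid (Fin n) => s.r) fun _ _ h => Setoid.ext fun a b => by
    exact iff_of_eq (congrFun (congrFun h a) b)

instance (n : ℕ) : Fintype (Setoid (Fin n)) := Fintype.ofFinite _

-- Every map i factors uniquely as the quotient by its kernel followed by an injection. This expands
-- ordinary powers of η in factorial measures, as Stirling numbers do for integers.
omit [MeasurableSpace E] in
theorem sum_collapse {n m : ℕ} (f : (Fin n → E) → ℝ) (x : Fin m → E) :
    ∑ i : Fin n → Fin m, f (x ∘ i) =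
      ∑ s : Setoid (Fin n), ∑ e : Fin (Nat.card (Quotient s)) ↪ Fin m, collapse f s (x ∘ e) := by
  rw [← Fintype.sum_sigma' (fun (s : Setoid (Fin n))
    (e : Fin (Nat.card (Quotient s)) ↪ Fin m) => collapse f s (x ∘ e))]
  symm
  refine Fintype.sum_bijective (fun p : Σ s : Setoid (Fin n),
    Fin (Nat.card (Quotient s)) ↪ Fin m => fun a => p.2 (Finite.equivFin (Quotient p.1) ⟦a⟧))
    ⟨?_, ?_⟩ _ _ fun p => rfl
  · rintro ⟨s, e⟩ ⟨s', e'⟩ h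
    have hs : ∀ a b, s a b ↔ s' a b := by
      intro a b
      have h1 := congrFun h a
      have h2 := congrFun h b
      simp only at h1 h2
      rw [← Quotient.eq (r := s), ← Quotient.eq (r := s'),
        ← (Finite.equivFin (Quotient s)).injective.eq_iff, ← e.injective.eq_iff, h1, h2,
        e'.injective.eq_iff, (Finite.equivFin (Quotient s')).injective.eq_iff]
    obtain rfl : s = s' := Setoid.ext hs
    have he : e = e' := by
      ext j
      obtain ⟨q, rfl⟩ := (Finite.equivFin (Quotient s)).surjective j
      obtain ⟨a, rfl⟩ := Quotient.exists_rep q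
      exact congrArg Fin.val (congrFun h a)
    rw [he]
  · intro i
    refine ⟨⟨Setoid.ker i, ((Finite.equivFin _).symm.toEmbedding.trans
      ⟨Setoid.kerLift i, Setoid.kerLift_injective i⟩)⟩, ?_⟩
    funext a
    simp

theorem card_quotient_lt {n : ℕ} {s : Setoid (Fin n)} (hs : s ≠ ⊥) :
    Nat.card (Quotient s) < n := by
  have h1 : Nat.card (Quotient s) ≤ n := by
    simpa using Nat.card_le_card_of_surjective (Quotient.mk s) Quotient.mk_surjective
  refine lt_of_le_of_ne h1 fun h => hs ?_
  have h2 : Function.Injective (Quotient.mk s) := by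
    have : Nat.card (Fin n) = Nat.card (Quotient s) := by simpa using h.symm
    exact ((Nat.bijective_iff_surjective_and_card _).2 ⟨Quotient.mk_surjective, this⟩).1
  exact Setoid.ext fun a b => ⟨fun hab => h2 (Quotient.sound hab), fun hab => by
    have : a = b := hab
    rw [this]⟩

variable [StandardBorelSpace E]

theorem fallingFactorial_collapse_bot {n : ℕ} (f : (Fin n → E) → ℝ) (η : Config E) :
    fallingFactorial (collapse f ⊥) η = fallingFactorial f η := by
  obtain ⟨m, x, rfl⟩ := exists_ofTuple_eq η
  rw [fallingFactorial_ofTuple, fallingFactorial_ofTuple]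
  let e : Fin n ≃ Fin (Nat.card (Quotient (⊥ : Setoid (Fin n)))) :=
    (Equiv.ofBijective (Quotient.mk ⊥) ⟨fun a b h => Quotient.exact h,
      Quotient.mk_surjective⟩).trans (Finite.equivFin _)
  refine Fintype.sum_equiv (Equiv.embeddingCongr e.symm (Equiv.refl _)) _ _ fun i => ?_
  rfl

theorem monomial_eq_sum {n : ℕ} {f : (Fin n → E) → ℝ} (hf : Measurable f) (η : Config E) :
    monomial f η = ∑ s : Setoid (Fin n), fallingFactorial (collapse f s) η := by
  obtain ⟨m, x, rfl⟩ := exists_ofTuple_eq η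
  rw [monomial_ofTuple hf, sum_collapse]
  exact Finset.sum_congr rfl fun s _ => (fallingFactorial_ofTuple _ x).symm

/-- The linear span of falling factorial polynomials of degree less than `n`. -/
def fallingSpan (E : Type u) [MeasurableSpace E] [StandardBorelSpace E] (n : ℕ) :
    Submodule ℝ (Config E → ℝ) :=
  Submodule.span ℝ {F | ∃ k < n, ∃ f : (Fin k → E) → ℝ,
    Measurable f ∧ (∃ C, ∀ x, |f x| ≤ C) ∧ F = fallingFactorial f}

omit [StandardBorelSpace E] in
/-- The linear span of monomials of degree less than `n`. -/
def monomialSpan (E : Type u) [MeasurableSpace E] (n : ℕ) : Submodule ℝ (Config E → ℝ) :=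
  Submodule.span ℝ {F | ∃ k < n, ∃ f : (Fin k → E) → ℝ,
    Measurable f ∧ (∃ C, ∀ x, |f x| ≤ C) ∧ F = monomial f}

/-- The discrete partition contributes the falling factorial itself; every other one has fewer than
n blocks and so gives lower degree. -/
theorem monomial_sub_fallingFactorial_mem {n : ℕ} {f : (Fin n → E) → ℝ} (hf : Measurable f)
    (hb : ∃ C, ∀ x, |f x| ≤ C) : monomial f - fallingFactorial f ∈ fallingSpan E n := by
  classical
  have h : monomial f - fallingFactorial f =
      ∑ s ∈ Finset.univ.erase (⊥ : Setoid (Fin n)), fallingFactorial (collapse f s) := by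
    funext η
    rw [Pi.sub_apply, monomial_eq_sum hf, ← fallingFactorial_collapse_bot f,
      ← Finset.add_sum_erase _ _ (Finset.mem_univ (⊥ : Setoid (Fin n))), add_sub_cancel_left,
      Finset.sum_apply]
  rw [h]
  refine Submodule.sum_mem _ fun s hs => Submodule.subset_span ?_
  exact ⟨_, card_quotient_lt (Finset.ne_of_mem_erase hs), collapse f s, measurable_collapse hf s,
    hb.imp fun C hC x => hC _, rfl⟩

omit [StandardBorelSpace E] in
theorem monomialSpan_mono {n m : ℕ} (h : n ≤ m) : monomialSpan E n ≤ monomialSpan E m :=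
  Submodule.span_mono fun _ ⟨k, hk, hf⟩ => ⟨k, hk.trans_le h, hf⟩

theorem fallingSpan_mono {n m : ℕ} (h : n ≤ m) : fallingSpan E n ≤ fallingSpan E m :=
  Submodule.span_mono fun _ ⟨k, hk, hf⟩ => ⟨k, hk.trans_le h, hf⟩

theorem monomialSpan_le_fallingSpan (n : ℕ) : monomialSpan E n ≤ fallingSpan E n := by
  refine Submodule.span_le.2 ?_
  rintro _ ⟨k, hk, f, hf, hb, rfl⟩
  have h1 := fallingSpan_mono hk.le (monomial_sub_fallingFactorial_mem hf hb)
  have h2 : fallingFactorial f ∈ fallingSpan E n := Submodule.subset_span ⟨k, hk, f, hf, hb, rfl⟩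
  simpa using add_mem h1 h2

theorem fallingSpan_le_monomialSpan (n : ℕ) : fallingSpan E n ≤ monomialSpan E n := by
  induction n with
  | zero =>
    refine Submodule.span_le.2 ?_
    rintro _ ⟨k, hk, -⟩
    exact absurd hk (Nat.not_lt_zero k)
  | succ n ih =>
    refine Submodule.span_le.2 ?_
    rintro _ ⟨k, hk, f, hf, hb, rfl⟩
    have h1 := monomialSpan_mono n.le_succ
      (ih (fallingSpan_mono (Nat.lt_succ_iff.1 hk) (monomial_sub_fallingFactorial_mem hf hb)))
    have h2 : monomial f ∈ monomialSpan E (n + 1) :=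
      Submodule.subset_span ⟨k, hk, f, hf, hb, rfl⟩
    simpa using sub_mem h2 h1

/-! ### Symmetrization -/

omit [MeasurableSpace E] [StandardBorelSpace E] in
/-- The symmetrization of a function. -/
def symmetrize {n : ℕ} (f : (Fin n → E) → ℝ) (x : Fin n → E) : ℝ :=
  (n.factorial : ℝ)⁻¹ * ∑ σ : Equiv.Perm (Fin n), f (x ∘ σ)

omit [StandardBorelSpace E] in
theorem isSymmBdd_symmetrize {n : ℕ} {f : (Fin n → E) → ℝ} (hf : Measurable f)
    (hb : ∃ C, ∀ x, |f x| ≤ C) : IsSymmBdd (symmetrize f) := by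
  refine ⟨?_, ?_, fun τ x => ?_⟩
  · refine (Finset.measurable_sum _ fun σ _ => hf.comp ?_).const_mul _
    exact measurable_pi_lambda _ fun j => measurable_pi_apply _
  · obtain ⟨C, hC⟩ := hb
    refine ⟨C, fun x => ?_⟩
    rw [symmetrize, abs_mul, abs_of_nonneg (by positivity)]
    have h1 : |∑ σ : Equiv.Perm (Fin n), f (x ∘ σ)| ≤ n.factorial * C := by
      refine (Finset.abs_sum_le_sum_abs _ _).trans ?_
      refine (Finset.sum_le_card_nsmul _ _ C fun σ _ => hC _).trans (le_of_eq ?_)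
      simp [Fintype.card_perm]
    calc (n.factorial : ℝ)⁻¹ * |∑ σ : Equiv.Perm (Fin n), f (x ∘ σ)|
        ≤ (n.factorial : ℝ)⁻¹ * (n.factorial * C) := by gcongr
      _ = C := by
        have : (n.factorial : ℝ) ≠ 0 := by positivity
        field_simp
  · rw [symmetrize, symmetrize]
    congr 1
    exact Equiv.sum_comp (Equiv.mulLeft τ) fun σ : Equiv.Perm (Fin n) => f (x ∘ σ)

/-- The factorial measure is permutation invariant. So every falling factorial has a symmetric
coefficient, to which the intertwining relation applies. -/
theorem fallingFactorial_symmetrize {n : ℕ} (f : (Fin n → E) → ℝ) :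
    fallingFactorial (symmetrize f) = fallingFactorial f := by
  funext η
  obtain ⟨m, x, rfl⟩ := exists_ofTuple_eq η
  rw [fallingFactorial_ofTuple, fallingFactorial_ofTuple]
  simp only [symmetrize]
  rw [← Finset.mul_sum, Finset.sum_comm]
  have h : ∀ σ : Equiv.Perm (Fin n), ∑ i : Fin n ↪ Fin m, f ((x ∘ i) ∘ σ) =
      ∑ i : Fin n ↪ Fin m, f (x ∘ i) := fun σ =>
    Equiv.sum_comp (σ.symm.embeddingCongr (Equiv.refl (Fin m))) fun i => f (x ∘ i)
  simp only [h, Finset.sum_const, Finset.card_univ, Fintype.card_perm, Fintype.card_fin,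
    nsmul_eq_mul]
  have : (n.factorial : ℝ) ≠ 0 := by positivity
  field_simp

end Polynomial

end GSIP

end

noncomputable section

namespace GSIP

universe u

variable {E : Type u} [MeasurableSpace E] [StandardBorelSpace E]

/-! ### The orthogonal polynomial intertwining relation -/

/-! ### Square integrability of polynomials. -/

section Square

theorem measurable_monomial {n : ℕ} {f : (Fin n → E) → ℝ} (hf : Measurable f) :
    Measurable (monomial f) := by
  refine measurable_of_ofTuple fun m => ?_
  simp only [monomial_ofTuple hf]
  exact Finset.measurable_sum _ fun i _ =>
    hf.comp (measurable_pi_lambda _ fun j => measurable_pi_apply _)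

theorem abs_monomial_le {n : ℕ} {f : (Fin n → E) → ℝ} (hf : Measurable f) {C : ℝ}
    (hC : ∀ x, |f x| ≤ C) (η : Config E) : |monomial f η| ≤ C * (size η : ℝ) ^ n := by
  obtain ⟨m, x, rfl⟩ := exists_ofTuple_eq η
  rw [monomial_ofTuple hf, size_ofTuple]
  refine (Finset.abs_sum_le_sum_abs _ _).trans ?_
  refine (Finset.sum_le_card_nsmul _ _ C fun i _ => hC _).trans (le_of_eq ?_)
  simp [mul_comm]

theorem memLp_monomial {ρ : Measure (Config E)} (hρ : FiniteMoments ρ) {n : ℕ}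
    {f : (Fin n → E) → ℝ} (hf : Measurable f) (hb : ∃ C, ∀ x, |f x| ≤ C) :
    MemLp (monomial f) 2 ρ := by
  obtain ⟨C, hC⟩ := hb
  have hpow : Measurable fun η : Config E => (size η : ℝ) ^ n :=
    (measurable_of_countable fun k : ℕ => (k : ℝ) ^ n).comp measurable_size
  have hm : MemLp (fun η : Config E => (size η : ℝ) ^ n) 2 ρ := by
    refine ⟨hpow.aestronglyMeasurable, ?_⟩
    rw [eLpNorm_lt_top_iff_lintegral_rpow_enorm_lt_top two_ne_zero ENNReal.ofNat_ne_top]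
    refine lt_of_le_of_lt (le_of_eq ?_) (hρ (n * 2))
    refine lintegral_congr fun η => ?_
    rw [← coe_size, pow_mul]
    simp [enorm_pow]
  refine (hm.const_mul C).mono (measurable_monomial hf).aestronglyMeasurable (.of_forall fun η => ?_)
  rw [Real.norm_eq_abs]
  exact (abs_monomial_le hf hC η).trans (le_abs_self _)

theorem memLp_of_mem_monomialSpan {ρ : Measure (Config E)} (hρ : FiniteMoments ρ) {n : ℕ}
    {F : Config E → ℝ} (hF : F ∈ monomialSpan E n) :
    ∃ h : MemLp F 2 ρ, h.toLp F ∈ polyLT ρ n := by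
  induction hF using Submodule.span_induction with
  | mem F hF =>
    obtain ⟨k, hk, f, hf, hb, rfl⟩ := hF
    have h := memLp_monomial hρ hf hb
    exact ⟨h, Submodule.subset_span ⟨k, hk, f, hf, hb, h.coeFn_toLp⟩⟩
  | zero => exact ⟨MemLp.zero, by rw [MemLp.toLp_zero]; exact zero_mem _⟩
  | add F G _ _ hF hG =>
    obtain ⟨hF, hF'⟩ := hF
    obtain ⟨hG, hG'⟩ := hG
    exact ⟨hF.add hG, by rw [MemLp.toLp_add hF hG]; exact add_mem hF' hG'⟩
  | smul a F _ hF =>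
    obtain ⟨hF, hF'⟩ := hF
    exact ⟨hF.const_smul a, by rw [MemLp.toLp_const_smul a hF]; exact Submodule.smul_mem _ a hF'⟩

/-- Passage from polynomials as genuine functions, which can be integrated against every P_t(η, ·),
to their classes in L²(ρ). -/
theorem mem_polyLT_of_ae_eq {ρ : Measure (Config E)} (hρ : FiniteMoments ρ) {n : ℕ}
    {F : Config E → ℝ} (hF : F ∈ monomialSpan E n) {G : Lp ℝ 2 ρ} (hG : G =ᵐ[ρ] F) :
    G ∈ polyLT ρ n := by
  obtain ⟨h, hF'⟩ := memLp_of_mem_monomialSpan hρ hF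
  have : G = h.toLp F := Lp.ext (hG.trans h.coeFn_toLp.symm)
  rwa [this]

end Square

section Intertwining

variable (α : Measure E) [IsFiniteMeasure α] {c : E → E → ℝ≥0}
  (hc : Measurable (Function.uncurry c)) {K : ℝ≥0} (hK : ∀ x y, c x y ≤ K)
  (hsymm : ∀ x y, c x y = c y x)
include hK hsymm

theorem gsip_fallingSpan {n : ℕ} {F : Config E → ℝ} (hF : F ∈ fallingSpan E n) (t : ℝ≥0) :
    (∀ η, Integrable F (gsip α hc K t η)) ∧
      (fun η => ∫ ξ, F ξ ∂gsip α hc K t η) ∈ fallingSpan E n := by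
  induction hF using Submodule.span_induction with
  | mem F hF =>
    obtain ⟨k, hk, f, hf, hb, rfl⟩ := hF
    refine ⟨(levelBdd_fallingFactorial hf hb).integrable_gsip α hc hK t, ?_⟩
    have hs := isSymmBdd_symmetrize hf hb
    have hl := isSymmBdd_labelled α hc hK hs t
    rw [← fallingFactorial_symmetrize f]
    simp only [integral_gsip_fallingFactorial α hc hK hsymm hs t]
    exact Submodule.subset_span ⟨k, hk, _, hl.measurable, hl.bounded, rfl⟩
  | zero =>
    refine ⟨fun η => integrable_zero _ _ _, ?_⟩
    simp only [Pi.zero_apply, integral_zero]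
    exact zero_mem _
  | add F G _ _ hF hG =>
    refine ⟨fun η => (hF.1 η).add (hG.1 η), ?_⟩
    have h : (fun η => ∫ ξ, (F + G) ξ ∂gsip α hc K t η) =
        (fun η => ∫ ξ, F ξ ∂gsip α hc K t η) + fun η => ∫ ξ, G ξ ∂gsip α hc K t η :=
      funext fun η => integral_add (hF.1 η) (hG.1 η)
    rw [h]
    exact add_mem hF.2 hG.2
  | smul a F _ hF =>
    refine ⟨fun η => (hF.1 η).smul a, ?_⟩
    have h : (fun η => ∫ ξ, (a • F) ξ ∂gsip α hc K t η) =
        a • fun η => ∫ ξ, F ξ ∂gsip α hc K t η :=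
      funext fun η => integral_smul a F
    rw [h]
    exact Submodule.smul_mem _ a hF.2

/-- A monomial and the falling factorial with the same coefficient agree up to lower degree. The
falling factorials intertwine exactly, and P_t does not raise degrees, so the error has degree less
than n. -/
theorem gsip_monomial_sub_mem {n : ℕ} {f : (Fin n → E) → ℝ} (hf : IsSymmBdd f) (t : ℝ≥0) :
    monomial (labelled (gsip α hc K) t f) - (fun η => ∫ ξ, monomial f ξ ∂gsip α hc K t η) ∈
      monomialSpan E n := by
  have hl := isSymmBdd_labelled α hc hK hf t
  have h1 := monomial_sub_fallingFactorial_mem hf.measurable hf.bounded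
  have h2 := monomial_sub_fallingFactorial_mem hl.measurable hl.bounded
  obtain ⟨h3, h4⟩ := gsip_fallingSpan α hc hK hsymm h1 t
  refine fallingSpan_le_monomialSpan n ?_
  convert sub_mem h2 h4 using 1
  funext η
  have h5 : ∫ ξ, monomial f ξ ∂gsip α hc K t η =
      ∫ ξ, (monomial f - fallingFactorial f) ξ ∂gsip α hc K t η +
        fallingFactorial (labelled (gsip α hc K) t f) η := by
    rw [← integral_gsip_fallingFactorial α hc hK hsymm hf t, ← integral_add (h3 η)
      ((levelBdd_fallingFactorial hf.measurable hf.bounded).integrable_gsip α hc hK t η)]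
    simp
  simp only [Pi.sub_apply] at h5 ⊢
  rw [h5]
  ring

theorem orthogonalIntertwining_gsip {ρ : Measure (Config E)} [IsProbabilityMeasure ρ]
    (hρ : FiniteMoments ρ) (hrev : ∀ t, (gsip α hc K t).IsReversible ρ) :
    OrthogonalIntertwining (gsip α hc K) ρ := by
  intro n f hf t
  have := isMarkovKernel_gsip α hc hK t
  obtain ⟨T, hT, hTκ⟩ := exists_kernelOperator (hrev t)
  have hcongr : ∀ (F : Lp ℝ 2 ρ) (G : Config E → ℝ), F =ᵐ[ρ] G →
      T F =ᵐ[ρ] fun η => ∫ ξ, G ξ ∂gsip α hc K t η := by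
    intro F G hFG
    filter_upwards [hTκ F, ae_ae_of_invariant (hrev t).invariant hFG] with η h1 h2
    rw [← h1.2]
    exact integral_congr_ae h2
  have hpoly : ∀ F ∈ polyLT ρ n, T F ∈ polyLT ρ n := by
    intro F hF
    induction hF using Submodule.span_induction with
    | mem F hF =>
      obtain ⟨k, hk, g, hg, hb, hFg⟩ := hF
      have h1 : monomial g ∈ monomialSpan E n := Submodule.subset_span ⟨k, hk, g, hg, hb, rfl⟩
      exact mem_polyLT_of_ae_eq hρ (fallingSpan_le_monomialSpan n
        (gsip_fallingSpan α hc hK hsymm (monomialSpan_le_fallingSpan n h1) t).2) (hcongr F _ hFg)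
    | zero => rw [map_zero]; exact zero_mem _
    | add F G _ _ hF hG => rw [map_add]; exact add_mem hF hG
    | smul a F _ hF => rw [map_smul]; exact Submodule.smul_mem _ a hF
  have hl := isSymmBdd_labelled α hc hK hf t
  have hm := memLp_monomial hρ hf.measurable hf.bounded
  have hm' := memLp_monomial hρ hl.measurable hl.bounded
  have hdiff : hm'.toLp _ - T (hm.toLp _) ∈ polyLT ρ n := by
    refine mem_polyLT_of_ae_eq hρ (gsip_monomial_sub_mem α hc hK hsymm hf t) ?_
    filter_upwards [Lp.coeFn_sub (hm'.toLp _) (T (hm.toLp _)), hm'.coeFn_toLp,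
      hcongr _ _ hm.coeFn_toLp] with η h1 h2 h3
    rw [h1, Pi.sub_apply, Pi.sub_apply, h2, h3]
  have key : T (orthPoly ρ f) = orthPoly ρ (labelled (gsip α hc K) t f) := by
    rw [orthPoly, orthPoly, dif_pos hm, dif_pos hm']
    exact map_starProjection_orthogonal hT hpoly hdiff
  filter_upwards [hTκ (orthPoly ρ f)] with η hη
  rw [← key]
  exact hη

end Intertwining

end GSIP

end

noncomputable section

namespace GSIP

universe u

variable {E : Type u} [MeasurableSpace E]

/-! ### Poisson point processes -/

section Poisson

theorem countWeight_zero (a : ℝ≥0) (k : ℕ) :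
    (countWeight 0 1 a k : ℝ) = (a : ℝ) ^ k / (k.factorial : ℝ) := by
  induction k with
  | zero => simp [countWeight]
  | succ k ih =>
    rw [countWeight, NNReal.coe_mul, ih, Nat.factorial_succ]
    push_cast
    field_simp
    ring

theorem hasSum_countWeight_zero (a : ℝ≥0) :
    HasSum (fun k => (countWeight 0 1 a k : ℝ)) (Real.exp (-(a : ℝ)))⁻¹ := by
  simp only [countWeight_zero]
  rw [Real.exp_neg, inv_inv, Real.exp_eq_exp_ℝ]
  exact NormedSpace.expSeries_div_hasSum_exp (a : ℝ)

theorem exists_isMecke_poisson (α : Measure E) [IsFiniteMeasure α] :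
    ∃ ρ : Measure (Config E), IsProbabilityMeasure ρ ∧ IsMecke α 0 1 ρ :=
  exists_isMecke α 0 1 (NNReal.summable_coe.1 (hasSum_countWeight_zero _).summable)

theorem IsMecke.hasLaw_count {α : Measure E} [IsFiniteMeasure α] {ρ : Measure (Config E)}
    [IsProbabilityMeasure ρ] (hρ : IsMecke α 0 1 ρ) {B : Set E} (hB : MeasurableSet B) :
    HasLaw (count B) (poissonMeasure (mass α B)) ρ := by
  refine ⟨(measurable_count hB).aemeasurable, Measure.ext_of_singleton fun k => ?_⟩
  rw [Measure.map_apply (measurable_count hB) (measurableSet_singleton k),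
    poissonMeasure_singleton, mul_div_assoc, ← countWeight_zero]
  exact hρ.measure_count_of_tsum hB (Real.exp_pos _) (hasSum_countWeight_zero _) k

/-- The restriction of a configuration to a set. -/
def restrictConfig (A : Set E) (hA : MeasurableSet A) (η : Config E) : Config E :=
  ⟨η.1.restrict A, fun B hB => by rw [Measure.restrict_apply hB]; exact η.2 _ (hB.inter hA)⟩

theorem count_restrictConfig {A B : Set E} (hA : MeasurableSet A) (hB : MeasurableSet B)
    (η : Config E) : count B (restrictConfig A hA η) = count (B ∩ A) η := by
  rw [count_eq_iff hB, coe_count (hB.inter hA)]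
  exact Measure.restrict_apply hB

theorem measurable_restrictConfig {A : Set E} (hA : MeasurableSet A) :
    Measurable (restrictConfig A hA) := by
  refine measurable_config_iff.2 fun B hB => ?_
  simp only [restrictConfig, Measure.restrict_apply hB]
  exact measurable_eval (hB.inter hA)

open MeasurableSpace (countablePartition) in
/-- The restrictions to disjoint sets are independent. -/
theorem IsMecke.iIndepFun_restrictConfig [MeasurableSpace.CountablyGenerated E] {α : Measure E}
    [IsFiniteMeasure α] {θ q : ℝ≥0} {ρ : Measure (Config E)} [IsProbabilityMeasure ρ]
    (hρ : IsMecke α θ q ρ) {ι : Type*} [Fintype ι] {A : ι → Set E} (hA : ∀ i, MeasurableSet (A i))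
    (hd : Pairwise fun i j => Disjoint (A i) (A j)) :
    iIndepFun (fun i => restrictConfig (A i) (hA i)) ρ := by
  have hfin : ∀ n, Fintype (countablePartition E n) := fun n =>
    (MeasurableSpace.finite_countablePartition E n).fintype
  have hBm : ∀ {n} (B : countablePartition E n), MeasurableSet B.1 := fun B =>
    MeasurableSpace.measurableSet_countablePartition _ B.2
  have hBd : ∀ {n} {B B' : countablePartition E n}, B ≠ B' → Disjoint B.1 B'.1 := fun {n B B'} h =>
    MeasurableSpace.disjoint_countablePartition B.2 B'.2 fun heq => h (Subtype.ext heq)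
  refine iIndepSets.iIndep (fun i => (measurable_restrictConfig (hA i)).comap_le)
    (fun i => preimage (restrictConfig (A i) (hA i)) '' cylinders E)
    (fun i => isPiSystem_cylinders.comap _) (fun i => ?_) ?_
  · rw [← MeasurableSpace.comap_generateFrom, generateFrom_cylinders]
  · rw [iIndepSets_iff]
    intro s f hf
    choose! C hC hCf using hf
    choose! n k hnk using hC
    have hcyl : ∀ i ∈ s, f i = ⋂ B : countablePartition E (n i),
        (fun η => count (B.1 ∩ A i) η) ⁻¹' {k i B.1} := by
      intro i hi
      rw [← hCf i hi, hnk i hi]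
      ext η
      simp only [mem_preimage, cylinder, mem_iInter, mem_singleton_iff, Subtype.forall]
      refine forall₂_congr fun B hB => ?_
      rw [count_restrictConfig (hA i) (hBm ⟨B, hB⟩)]
    have hone : ∀ i ∈ s, ρ (f i) = ∏ B : countablePartition E (n i),
        ρ ((fun η => count (B.1 ∩ A i) η) ⁻¹' {k i B.1}) := by
      intro i hi
      have h := (hρ.iIndepFun_count (B := fun B : countablePartition E (n i) => B.1 ∩ A i)
        (fun B => (hBm B).inter (hA i)) fun B B' h =>
          (hBd h).mono inter_subset_left inter_subset_left).measure_inter_preimage_eq_mul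
        Finset.univ (sets := fun B => {k i B.1}) fun _ _ => measurableSet_singleton _
      rw [hcyl i hi, ← h]
      simp
    -- The sets B ∩ A_i, over all i and all atoms B of the i-th partition, are pairwise disjoint, so
    -- all these counts are jointly independent and the product regroups by i.
    have hall := (hρ.iIndepFun_count
      (B := fun p : Σ i : s, countablePartition E (n i) => p.2.1 ∩ A p.1)
      (fun p => (hBm p.2).inter (hA p.1)) (by
        rintro ⟨i, B⟩ ⟨j, B'⟩ h
        rcases eq_or_ne i j with rfl | hij
        · refine (hBd fun heq => h ?_).mono inter_subset_left inter_subset_left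
          exact Sigma.ext rfl (heq_of_eq heq)
        · exact (hd fun heq => hij (Subtype.ext heq)).mono inter_subset_right
            inter_subset_right)).measure_inter_preimage_eq_mul Finset.univ
      (sets := fun p => {k p.1 p.2.1}) fun _ _ => measurableSet_singleton _
    rw [Fintype.prod_sigma] at hall
    rw [Finset.prod_congr rfl hone, ← Finset.prod_coe_sort s fun i =>
      ∏ B : countablePartition E (n i), ρ ((fun η => count (B.1 ∩ A i) η) ⁻¹' {k i B.1}), ← hall]
    congr 1
    ext η
    simp only [mem_iInter, Finset.mem_univ, true_implies]
    constructor
    · rintro h ⟨i, B⟩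
      have := h i.1 i.2
      rw [hcyl i.1 i.2] at this
      exact mem_iInter.1 this B
    · intro h i hi
      rw [hcyl i hi]
      exact mem_iInter.2 fun B => h ⟨⟨i, hi⟩, B⟩

end Poisson

/-! ### The Poisson process -/

section Clock

theorem poissonMeasure_zero : poissonMeasure 0 = Measure.dirac 0 := by
  refine Measure.ext_of_singleton fun k => ?_
  rw [poissonMeasure_singleton]
  rcases k with _ | k <;> simp

/-- Configurations are finite, so the Poisson process on the half line is assembled from independent
unit intervals whose contributions are added. -/
theorem hasLaw_sum_poissonMeasure {Ω : Type*} [MeasurableSpace Ω] {P : Measure Ω}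
    [IsProbabilityMeasure P] {X : ℕ → Ω → ℕ} {r : ℕ → ℝ≥0} (hX : ∀ k, Measurable (X k))
    (hind : iIndepFun X P) (hlaw : ∀ k, HasLaw (X k) (poissonMeasure (r k)) P) (M : ℕ) :
    HasLaw (∑ k ∈ Finset.range M, X k) (poissonMeasure (∑ k ∈ Finset.range M, r k)) P := by
  induction M with
  | zero =>
    simp only [Finset.range_zero, Finset.sum_empty, poissonMeasure_zero]
    refine ⟨measurable_const.aemeasurable, ?_⟩
    change P.map (fun _ => 0) = _
    simp
  | succ M ih =>
    rw [Finset.sum_range_succ, Finset.sum_range_succ]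
    exact (hind.indepFun_sum_range_succ hX M).hasLaw_add_poissonMeasure ih (hlaw M)

/-- The distribution of the unit rate Poisson point process on `(k, k + 1]`. -/
def unitPoisson (k : ℕ) : Measure (Config ℝ) :=
  (exists_isMecke_poisson (volume.restrict (Ioc (k : ℝ) (k + 1)))).choose

instance (k : ℕ) : IsProbabilityMeasure (unitPoisson k) :=
  (exists_isMecke_poisson (volume.restrict (Ioc (k : ℝ) (k + 1)))).choose_spec.1

theorem isMecke_unitPoisson (k : ℕ) :
    IsMecke (volume.restrict (Ioc (k : ℝ) (k + 1))) 0 1 (unitPoisson k) :=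
  (exists_isMecke_poisson (volume.restrict (Ioc (k : ℝ) (k + 1)))).choose_spec.2

/-- The distribution of the unit rate Poisson point process on the half line, cut into unit
intervals. -/
def clockMeasure : Measure (ℕ → Config ℝ) := Measure.infinitePi unitPoisson

instance : IsProbabilityMeasure clockMeasure := by unfold clockMeasure; infer_instance

/-- The unit rate Poisson process. -/
def clock (r : ℝ≥0) (ω : ℕ → Config ℝ) : ℕ :=
  ∑ k ∈ Finset.range ⌈r⌉₊, count (Ioc (k : ℝ) r) (ω k)

/-- The number of points in `(u, b]`. -/
def clockIncrement (u b : ℝ≥0) (ω : ℕ → Config ℝ) : ℕ :=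
  ∑ k ∈ Finset.range ⌈b⌉₊, count (Ioc (max (k : ℝ) u) b) (ω k)

theorem measurable_clock (r : ℝ≥0) : Measurable (clock r) :=
  Finset.measurable_sum _ fun k _ => (measurable_count measurableSet_Ioc).comp (measurable_pi_apply k)

theorem clock_zero (ω : ℕ → Config ℝ) : clock 0 ω = 0 := by simp [clock]

theorem count_empty (η : Config E) : count ∅ η = 0 := by
  rw [count_eq_iff MeasurableSet.empty]; simp

theorem count_union {A B : Set E} (hA : MeasurableSet A) (hB : MeasurableSet B) (h : Disjoint A B)
    (η : Config E) : count (A ∪ B) η = count A η + count B η := by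
  rw [count_eq_iff (hA.union hB), measure_union h hB, Nat.cast_add, coe_count hA, coe_count hB]

theorem clock_eq_sum {r : ℝ≥0} {M : ℕ} (hM : ⌈r⌉₊ ≤ M) (ω : ℕ → Config ℝ) :
    clock r ω = ∑ k ∈ Finset.range M, count (Ioc (k : ℝ) r) (ω k) := by
  refine Finset.sum_subset (Finset.range_mono hM) fun k _ hk => ?_
  rw [Finset.mem_range, not_lt, Nat.ceil_le] at hk
  have hk' : (r : ℝ) ≤ k := by exact_mod_cast hk
  rw [Ioc_eq_empty (not_lt.2 hk'), count_empty]

theorem clock_add_clockIncrement {u b : ℝ≥0} (hub : u ≤ b) (ω : ℕ → Config ℝ) :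
    clock u ω + clockIncrement u b ω = clock b ω := by
  have hub' : (u : ℝ) ≤ b := by exact_mod_cast hub
  rw [clock_eq_sum (Nat.ceil_mono hub), clockIncrement, clock, ← Finset.sum_add_distrib]
  refine Finset.sum_congr rfl fun k _ => ?_
  rw [← count_union measurableSet_Ioc measurableSet_Ioc]
  · rcases le_total (k : ℝ) u with h | h
    · rw [max_eq_right h, Ioc_union_Ioc_eq_Ioc h hub']
    · rw [max_eq_left h, Ioc_eq_empty (not_lt.2 h), empty_union]
  · exact Ioc_disjoint_Ioc_of_le (le_max_right _ _)

theorem clock_mono (ω : ℕ → Config ℝ) : Monotone fun r => clock r ω := fun u b hub => by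
  simp only
  rw [← clock_add_clockIncrement hub]
  exact Nat.le_add_right _ _

theorem hasLaw_clockIncrement (u t : ℝ≥0) :
    HasLaw (clockIncrement u (u + t)) (poissonMeasure t) clockMeasure := by
  have hm : ∀ k : ℕ, Measurable (count (Ioc (max (k : ℝ) u) ((u + t : ℝ≥0) : ℝ))) := fun k =>
    measurable_count measurableSet_Ioc
  have h := hasLaw_sum_poissonMeasure (P := clockMeasure)
    (X := fun k ω => count (Ioc (max (k : ℝ) u) ((u + t : ℝ≥0) : ℝ)) (ω k))
    (r := fun k => mass (volume.restrict (Ioc (k : ℝ) (k + 1)))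
      (Ioc (max (k : ℝ) u) ((u + t : ℝ≥0) : ℝ)))
    (fun k => (hm k).comp (measurable_pi_apply k)) (iIndepFun_infinitePi hm)
    (fun k => ?_) ⌈u + t⌉₊
  -- The pieces of (u, u + t] in the intervals (k, k + 1] tile it, so their lengths add up to t; a
  -- point x lies in the piece with k = ⌈x⌉ − 1.
  · have hsum : ∑ k ∈ Finset.range ⌈u + t⌉₊, mass (volume.restrict (Ioc (k : ℝ) (k + 1)))
        (Ioc (max (k : ℝ) u) ((u + t : ℝ≥0) : ℝ)) = t := by
      rw [← ENNReal.coe_inj, ENNReal.ofNNReal_finsetSum]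
      simp only [coe_mass, Measure.restrict_apply measurableSet_Ioc]
      rw [← measure_biUnion_finset]
      · have : ⋃ k ∈ Finset.range ⌈u + t⌉₊, Ioc (max (k : ℝ) u) ((u + t : ℝ≥0) : ℝ) ∩
            Ioc (k : ℝ) (k + 1) = Ioc (u : ℝ) ((u + t : ℝ≥0) : ℝ) := by
          ext x
          simp only [mem_iUnion, mem_inter_iff, mem_Ioc, Finset.mem_range, exists_prop, max_lt_iff]
          constructor
          · rintro ⟨k, -, ⟨⟨-, h1⟩, h2⟩, -⟩
            exact ⟨h1, h2⟩
          · rintro ⟨h1, h2⟩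
            have hx : 0 < x := lt_of_le_of_lt u.coe_nonneg h1
            have hc : 0 < ⌈x⌉₊ := Nat.ceil_pos.2 hx
            have h3 : ((⌈x⌉₊ - 1 : ℕ) : ℝ) + 1 = ⌈x⌉₊ := by
              rw [Nat.cast_sub hc]; simp
            have h4 : ((⌈x⌉₊ - 1 : ℕ) : ℝ) < x := by
              have := Nat.ceil_lt_add_one hx.le
              linarith
            have h5 : x ≤ ((⌈x⌉₊ - 1 : ℕ) : ℝ) + 1 := by
              rw [h3]; exact Nat.le_ceil x
            refine ⟨⌈x⌉₊ - 1, ?_, ⟨⟨h4, h1⟩, h2⟩, h4, h5⟩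
            rw [Nat.lt_ceil, ← NNReal.coe_lt_coe]
            exact lt_of_lt_of_le (by exact_mod_cast h4) h2
        rw [this, Real.volume_Ioc, NNReal.coe_add, add_sub_cancel_left, ENNReal.ofReal_coe_nnreal]
      · intro k _ l _ hkl
        refine Disjoint.mono inter_subset_right inter_subset_right ?_
        rcases lt_or_gt_of_ne hkl with h | h
        · exact Ioc_disjoint_Ioc_of_le (by exact_mod_cast h)
        · exact (Ioc_disjoint_Ioc_of_le (by exact_mod_cast h)).symm
      · exact fun k _ => measurableSet_Ioc.inter measurableSet_Ioc
    rw [hsum] at h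
    convert h using 1
    funext ω
    simp [clockIncrement]
  · have h1 := (isMecke_unitPoisson k).hasLaw_count
      (measurableSet_Ioc (a := max (k : ℝ) u) (b := ((u + t : ℝ≥0) : ℝ)))
    exact ⟨((hm k).comp (measurable_pi_apply k)).aemeasurable, by
      rw [← h1.map_eq, ← Measure.infinitePi_map_eval unitPoisson k,
        Measure.map_map (hm k) (measurable_pi_apply k)]
      rfl⟩

/-- The part of the time axis before or after time `u`. -/
def side (u : ℝ≥0) (b : Bool) : Set ℝ := if b then Iic (u : ℝ) else Ioi (u : ℝ)

theorem measurableSet_side (u : ℝ≥0) (b : Bool) : MeasurableSet (side u b) := by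
  cases b
  · exact measurableSet_Ioi
  · exact measurableSet_Iic

/-- The `σ`-algebra of the points before or after time `u`. -/
abbrev sideAlgebra (u : ℝ≥0) (b : Bool) : MeasurableSpace (ℕ → Config ℝ) :=
  ⨆ p ∈ {p : ℕ × Bool | p.2 = b}, MeasurableSpace.comap
    (fun ω : ℕ → Config ℝ => restrictConfig (side u p.2) (measurableSet_side u p.2) (ω p.1))
    inferInstance

theorem measurable_sideAlgebra (u : ℝ≥0) (b : Bool) (k : ℕ) {B : Set ℝ} (hB : MeasurableSet B)
    (hs : B ⊆ side u b) : Measurable[sideAlgebra u b] fun ω : ℕ → Config ℝ => count B (ω k) := by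
  have h1 : Measurable[sideAlgebra u b] fun ω : ℕ → Config ℝ =>
      restrictConfig (side u b) (measurableSet_side u b) (ω k) := by
    refine Measurable.mono (comap_measurable _) ?_ le_rfl
    exact le_iSup₂_of_le (f := fun (p : ℕ × Bool) (_ : p ∈ {p : ℕ × Bool | p.2 = b}) =>
      MeasurableSpace.comap (fun ω : ℕ → Config ℝ =>
        restrictConfig (side u p.2) (measurableSet_side u p.2) (ω p.1)) inferInstance)
      (k, b) rfl le_rfl
  have h2 : (fun ω : ℕ → Config ℝ => count B (ω k)) = count B ∘ fun ω : ℕ → Config ℝ =>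
      restrictConfig (side u b) (measurableSet_side u b) (ω k) := by
    funext ω
    rw [Function.comp_apply, count_restrictConfig _ hB, inter_eq_left.2 hs]
  rw [h2]
  exact (measurable_count hB).comp h1

theorem sideAlgebra_le (u : ℝ≥0) (b : Bool) : sideAlgebra u b ≤ MeasurableSpace.pi :=
  iSup₂_le fun p _ => ((measurable_restrictConfig _).comp (measurable_pi_apply p.1)).comap_le

/-- The unit intervals are independent of each other, and within each of them the restrictions to
the two sides of u are independent. So the whole family indexed by interval and side is independent,
and it is grouped by side. -/
theorem indep_sideAlgebra (u : ℝ≥0) :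
    Indep (sideAlgebra u true) (sideAlgebra u false) clockMeasure := by
  have hX : ∀ (k : ℕ) (b : Bool), Measurable
      (restrictConfig (side u b) (measurableSet_side u b)) := fun _ b => measurable_restrictConfig _
  have h : iIndepFun (fun (p : ℕ × Bool) (ω : ℕ → Config ℝ) =>
      restrictConfig (side u p.2) (measurableSet_side u p.2) (ω p.1)) clockMeasure := by
    refine iIndepFun_uncurry' (X := fun (k : ℕ) (b : Bool) (ω : ℕ → Config ℝ) =>
      restrictConfig (side u b) (measurableSet_side u b) (ω k))
      (fun k b => (hX k b).comp (measurable_pi_apply k)) ?_ fun k => ?_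
    · exact iIndepFun_infinitePi (P := unitPoisson) (X := fun _ η b =>
        restrictConfig (side u b) (measurableSet_side u b) η)
        fun k => measurable_pi_lambda _ fun b => hX k b
    · have h1 := (isMecke_unitPoisson k).iIndepFun_restrictConfig (measurableSet_side u) (by
        intro b b' hb
        cases b <;> cases b' <;> simp_all [side, disjoint_comm])
      rw [iIndepFun_iff_measure_inter_preimage_eq_mul] at h1 ⊢
      intro s sets hs
      have h2 := h1 s hs
      have hmp : ∀ {S : Set (Config ℝ)}, MeasurableSet S →
          unitPoisson k S = clockMeasure ((fun ω => ω k) ⁻¹' S) := by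
        intro S hS
        rw [← Measure.map_apply (measurable_pi_apply k) hS]
        exact congrArg (fun μ => μ S) (Measure.infinitePi_map_eval unitPoisson k).symm
      rw [hmp (s.measurableSet_biInter fun b hb => hX k b (hs b hb))] at h2
      rw [Finset.prod_congr rfl fun b hb => hmp (hX k b (hs b hb))] at h2
      simp only [preimage_iInter] at h2
      exact h2
  exact indep_iSup_of_disjoint (m := fun p : ℕ × Bool => MeasurableSpace.comap
    (fun ω : ℕ → Config ℝ => restrictConfig (side u p.2) (measurableSet_side u p.2) (ω p.1))
    inferInstance) (S := {p : ℕ × Bool | p.2 = true})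
    (T := {p : ℕ × Bool | p.2 = false})
    (fun p => ((hX p.1 p.2).comp (measurable_pi_apply p.1)).comap_le) h.iIndep
    (disjoint_left.2 fun p h1 h2 => Bool.noConfusion (h1.symm.trans h2))

theorem measurable_clock_sideAlgebra {r u : ℝ≥0} (hr : r ≤ u) :
    Measurable[sideAlgebra u true] (clock r) := by
  have hr' : (r : ℝ) ≤ u := by exact_mod_cast hr
  exact Finset.measurable_sum _ fun k _ => measurable_sideAlgebra u true k measurableSet_Ioc
    fun x hx => hx.2.trans hr'

theorem measurable_clockIncrement_sideAlgebra (u b : ℝ≥0) :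
    Measurable[sideAlgebra u false] (clockIncrement u b) :=
  Finset.measurable_sum _ fun k _ => measurable_sideAlgebra u false k measurableSet_Ioc
    fun _ hx => lt_of_le_of_lt (le_max_right _ _) hx.1

/-- The increments of the Poisson process are independent of the past and Poisson distributed. -/
theorem clockMeasure_inter_increment {u : ℝ≥0} {F : Set (ℕ → Config ℝ)}
    (hF : MeasurableSet[sideAlgebra u true] F) (t : ℝ≥0) (j : ℕ) :
    clockMeasure (F ∩ {ω | clockIncrement u (u + t) ω = j}) =
      clockMeasure F * poissonWeight t j := by
  have hD : MeasurableSet[sideAlgebra u false] {ω | clockIncrement u (u + t) ω = j} :=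
    measurable_clockIncrement_sideAlgebra u (u + t) (measurableSet_singleton j)
  rw [(Indep_iff _ _ _).1 (indep_sideAlgebra u) F _ hF hD]
  congr 1
  have h := hasLaw_clockIncrement u t
  rw [poissonWeight, ← h.map_eq, Measure.map_apply_of_aemeasurable h.aemeasurable
    (measurableSet_singleton j)]
  rfl

end Clock

end GSIP

end

noncomputable section

namespace GSIP

universe u

/-! ### Markov chains -/

section Chain

variable {S : Type u} [MeasurableSpace S] (Q : Kernel S S) [IsMarkovKernel Q]

/-- The transition kernels of a Markov chain, as kernels depending on the past. -/
def chainStep (n : ℕ) : Kernel ((i : Finset.Iic n) → S) S :=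
  Q.comap (fun x => x ⟨n, Finset.mem_Iic.2 le_rfl⟩) (measurable_pi_apply _)

instance (n : ℕ) : IsMarkovKernel (chainStep Q n) := by unfold chainStep; infer_instance

/-- The law of the Markov chain with transition kernel `Q`, depending on the initial value. -/
def chainLaw : Kernel S (ℕ → S) :=
  (Kernel.traj (X := fun _ => S) (chainStep Q) 0).comap (fun η _ => η)
    (measurable_pi_lambda _ fun _ => measurable_id)

instance : IsMarkovKernel (chainLaw Q) := by unfold chainLaw; infer_instance

/-- The `σ`-algebra of the past of the chain. -/
abbrev chainPast (S : Type u) [MeasurableSpace S] (k : ℕ) : MeasurableSpace (ℕ → S) :=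
  MeasurableSpace.comap (Preorder.frestrictLe (π := fun _ => S) k) inferInstance

omit [IsMarkovKernel Q] in
theorem chainPast_le (k : ℕ) : chainPast S k ≤ MeasurableSpace.pi :=
  (Preorder.measurable_frestrictLe k).comap_le

omit [IsMarkovKernel Q] in
theorem measurable_eval_chainPast {i k : ℕ} (hik : i ≤ k) :
    Measurable[chainPast S k] fun y : ℕ → S => y i :=
  (measurable_pi_apply (⟨i, Finset.mem_Iic.2 hik⟩ : Finset.Iic k)).comp
    (comap_measurable (Preorder.frestrictLe (π := fun _ => S) k))

omit [IsMarkovKernel Q] in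
theorem chainPast_mono : Monotone (chainPast S) := by
  intro k l hkl
  have h : Preorder.frestrictLe (π := fun _ => S) k =
      Preorder.frestrictLe₂ (π := fun _ => S) hkl ∘ Preorder.frestrictLe (π := fun _ => S) l := rfl
  rw [chainPast, h, ← MeasurableSpace.comap_comp]
  exact MeasurableSpace.comap_mono (Preorder.measurable_frestrictLe₂ hkl).comap_le

theorem ae_chainLaw_zero (η : S) {B : Set S} (hB : MeasurableSet B) (hη : η ∈ B) :
    ∀ᵐ y ∂chainLaw Q η, y 0 ∈ B := by
  have h := Kernel.traj_map_frestrictLe_of_le (X := fun _ => S) (κ := chainStep Q) (le_refl 0)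
  have h1 : (chainLaw Q η).map (Preorder.frestrictLe (π := fun _ => S) 0) =
      Measure.dirac fun _ => η := by
    have := congrArg (fun κ : Kernel ((i : Finset.Iic 0) → S) ((i : Finset.Iic 0) → S) =>
      κ fun _ => η) h
    rw [Kernel.map_apply _ (Preorder.measurable_frestrictLe 0), Kernel.deterministic_apply] at this
    exact this
  have hm : MeasurableSet {x : (i : Finset.Iic 0) → S | x ⟨0, Finset.mem_Iic.2 le_rfl⟩ ∈ B} :=
    measurable_pi_apply _ hB
  have h2 : ∀ᵐ x ∂(chainLaw Q η).map (Preorder.frestrictLe (π := fun _ => S) 0),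
      x ⟨0, Finset.mem_Iic.2 le_rfl⟩ ∈ B := by
    rw [h1, ae_dirac_iff hm]
    exact hη
  exact ae_of_ae_map (Preorder.measurable_frestrictLe 0).aemeasurable h2

/-- By the Ionescu-Tulcea construction the joint law of the path up to k and the next state is the
law of the path composed with the step kernel. -/
theorem setLIntegral_chainLaw_succ (η : S) {k : ℕ} {D : Set (ℕ → S)}
    (hD : MeasurableSet[chainPast S k] D) {g : S → ℝ≥0∞} (hg : Measurable g) :
    ∫⁻ y in D, g (y (k + 1)) ∂chainLaw Q η = ∫⁻ y in D, ∫⁻ ξ, g ξ ∂Q (y k) ∂chainLaw Q η := by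
  obtain ⟨A, hA, rfl⟩ := hD
  have hr := Preorder.measurable_frestrictLe (X := fun _ : ℕ => S) k
  have h1 := Kernel.partialTraj_compProd_eq_map_traj (X := fun _ => S) (κ := chainStep Q)
    (Nat.zero_le k) (x₀ := fun _ => η)
  have h2 := Kernel.traj_map_frestrictLe_apply (X := fun _ => S) (κ := chainStep Q) 0 k fun _ => η
  have hpair : Measurable fun y : ℕ → S =>
      (Preorder.frestrictLe (π := fun _ => S) k y, y (k + 1)) :=
    hr.prodMk (measurable_pi_apply _)
  have hgs : Measurable fun z : ((i : Finset.Iic k) → S) × S => g z.2 := hg.comp measurable_snd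
  have hQg : Measurable fun x : (i : Finset.Iic k) → S => ∫⁻ ξ, g ξ ∂chainStep Q k x :=
    hg.lintegral_kernel
  calc ∫⁻ y in Preorder.frestrictLe (π := fun _ => S) k ⁻¹' A, g (y (k + 1)) ∂chainLaw Q η
      = ∫⁻ z in A ×ˢ univ, g z.2 ∂((chainLaw Q η).map fun y : ℕ → S =>
          (Preorder.frestrictLe (π := fun _ => S) k y, y (k + 1))) := by
        rw [setLIntegral_map (hA.prod MeasurableSet.univ) hgs hpair]
        congr 2
        ext y
        simp
    _ = ∫⁻ x in A, ∫⁻ ξ, g ξ ∂chainStep Q k x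
          ∂((chainLaw Q η).map (Preorder.frestrictLe (π := fun _ => S) k)) := by
        change ∫⁻ z in A ×ˢ univ, g z.2 ∂((Kernel.traj (X := fun _ => S) (chainStep Q) 0
          fun _ => η).map fun y : ℕ → S => (Preorder.frestrictLe (π := fun _ => S) k y, y (k + 1)))
          = ∫⁻ x in A, ∫⁻ ξ, g ξ ∂chainStep Q k x ∂((Kernel.traj (X := fun _ => S)
          (chainStep Q) 0 fun _ => η).map (Preorder.frestrictLe (π := fun _ => S) k))
        rw [← h1, h2, Measure.setLIntegral_compProd hgs hA MeasurableSet.univ]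
        simp
    _ = _ := by
        rw [setLIntegral_map hA hQg hr]
        rfl

theorem setLIntegral_chainLaw_add (η : S) {k : ℕ} {D : Set (ℕ → S)}
    (hD : MeasurableSet[chainPast S k] D) (j : ℕ) {g : S → ℝ≥0∞} (hg : Measurable g) :
    ∫⁻ y in D, g (y (k + j)) ∂chainLaw Q η =
      ∫⁻ y in D, ∫⁻ ξ, g ξ ∂(Q ^ j) (y k) ∂chainLaw Q η := by
  induction j generalizing g with
  | zero =>
    refine lintegral_congr fun y => ?_
    change g (y k) = ∫⁻ ξ, g ξ ∂Kernel.id (y k)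
    rw [Kernel.id_apply, lintegral_dirac' _ hg]
  | succ j ih =>
    rw [← add_assoc, setLIntegral_chainLaw_succ Q η (chainPast_mono (Nat.le_add_right k j) D hD) hg,
      ih hg.lintegral_kernel]
    refine lintegral_congr fun y => ?_
    rw [pow_succ']
    exact (Kernel.lintegral_comp _ _ _ hg).symm

theorem ae_chainLaw_level {σ : S → ℕ} (hσ : Measurable σ) (hQ : ∀ η, ∀ᵐ ξ ∂Q η, σ ξ = σ η) (η : S)
    (k : ℕ) : ∀ᵐ y ∂chainLaw Q η, σ (y k) = σ η := by
  have hm : MeasurableSet {ξ | ¬ σ ξ = σ η} := (measurableSet_eq_fun hσ measurable_const).compl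
  have h := setLIntegral_chainLaw_add Q η (k := 0) (D := univ) MeasurableSet.univ k
    (g := {ξ | ¬ σ ξ = σ η}.indicator 1) (measurable_one.indicator hm)
  have h0 := ae_chainLaw_zero Q η (measurableSet_eq_fun hσ (measurable_const (a := σ η))) rfl
  rw [Measure.restrict_univ, zero_add] at h
  rw [ae_iff]
  have hpre : MeasurableSet {y : ℕ → S | ¬ σ (y k) = σ η} := hm.preimage (measurable_pi_apply k)
  rw [← lintegral_indicator_one hpre]
  refine Eq.trans ?_ (h.trans ?_)
  · rfl
  · rw [lintegral_congr_ae (g := fun _ => 0), lintegral_zero]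
    filter_upwards [h0] with y hy
    rw [lintegral_indicator_one hm]
    have := ae_pow_level hσ hQ k (y 0)
    rw [ae_iff] at this
    have hy' : σ (y 0) = σ η := hy
    rwa [hy'] at this

end Chain

/-! ### Subordination of a Markov chain to a Poisson process -/

section Subordination

variable {S : Type u} [MeasurableSpace S] (Q : Kernel S S) [IsMarkovKernel Q] (σ : S → ℕ)
  (Λ : ℕ → ℝ≥0)

/-- The law of the chain and of an independent Poisson process. -/
def jointLaw : Kernel S ((ℕ → S) × (ℕ → Config ℝ)) := chainLaw Q ×ₖ Kernel.const S clockMeasure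

instance : IsMarkovKernel (jointLaw Q) := by unfold jointLaw; infer_instance

theorem jointLaw_apply (η : S) : jointLaw Q η = (chainLaw Q η).prod clockMeasure := by
  rw [jointLaw, Kernel.prod_apply, Kernel.const_apply]

/-- The Markov chain evaluated at the jump times of a Poisson process of rate `Λ (σ (Y 0))`. -/
def subordinated (t : ℝ≥0) (z : (ℕ → S) × (ℕ → Config ℝ)) : S := z.1 (clock (Λ (σ (z.1 0)) * t) z.2)

/-- The `σ`-algebra of the past of the chain until time `k` and of the clock until time `u`. -/
abbrev jointPast (S : Type u) [MeasurableSpace S] (k : ℕ) (u : ℝ≥0) :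
    MeasurableSpace ((ℕ → S) × (ℕ → Config ℝ)) :=
  (chainPast S k).prod (sideAlgebra u true)

variable {σ}

omit [IsMarkovKernel Q] in
theorem measurable_subordinated (hσ : Measurable σ) (t : ℝ≥0) :
    Measurable (subordinated (S := S) σ Λ t) := by
  intro B hB
  have h : subordinated (S := S) σ Λ t ⁻¹' B = ⋃ p : ℕ × ℕ, {z | σ (z.1 0) = p.1} ∩
      ({z | clock (Λ p.1 * t) z.2 = p.2} ∩ {z | z.1 p.2 ∈ B}) := by
    ext z
    simp only [mem_preimage, subordinated, mem_iUnion, mem_inter_iff, mem_ofPred_eq, Prod.exists]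
    constructor
    · exact fun h => ⟨_, _, rfl, rfl, h⟩
    · rintro ⟨n, k, rfl, rfl, h⟩
      exact h
  rw [h]
  refine MeasurableSet.iUnion fun p => MeasurableSet.inter ?_ (MeasurableSet.inter ?_ ?_)
  · exact (hσ.comp ((measurable_pi_apply 0).comp measurable_fst)) (measurableSet_singleton p.1)
  · exact ((measurable_clock _).comp measurable_snd) (measurableSet_singleton p.2)
  · exact ((measurable_pi_apply p.2).comp measurable_fst) hB

omit [IsMarkovKernel Q] in
theorem jointPast_le (k : ℕ) (u : ℝ≥0) : jointPast S k u ≤ Prod.instMeasurableSpace :=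
  sup_le_sup (MeasurableSpace.comap_mono (chainPast_le k))
    (MeasurableSpace.comap_mono (sideAlgebra_le u true))

/-- Markov property at chain time k and clock time u. On rectangles it combines the Markov property
of the chain with the independence of the clock increments; rectangles form a π-system generating
`jointPast`. -/
theorem jointLaw_inter (η : S) {k : ℕ} {u : ℝ≥0} {C : Set ((ℕ → S) × (ℕ → Config ℝ))}
    (hC : MeasurableSet[jointPast S k u] C) (t : ℝ≥0) (j : ℕ) {B : Set S} (hB : MeasurableSet B) :
    jointLaw Q η (C ∩ {z | z.1 (k + j) ∈ B ∧ clockIncrement u (u + t) z.2 = j}) =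
      ∫⁻ z in C, poissonWeight t j * (Q ^ j) (z.1 k) B ∂jointLaw Q η := by
  rw [jointLaw_apply]
  set μ := (chainLaw Q η).prod clockMeasure
  have hBm : MeasurableSet {y : ℕ → S | y (k + j) ∈ B} := measurable_pi_apply (k + j) hB
  have hIm : MeasurableSet {ω | clockIncrement u (u + t) ω = j} :=
    sideAlgebra_le u false _
      (measurable_clockIncrement_sideAlgebra u (u + t) (measurableSet_singleton j))
  have hset : {z : (ℕ → S) × (ℕ → Config ℝ) | z.1 (k + j) ∈ B ∧
      clockIncrement u (u + t) z.2 = j} =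
      {y | y (k + j) ∈ B} ×ˢ {ω | clockIncrement u (u + t) ω = j} := rfl
  have hden : Measurable fun y : ℕ → S => (Q ^ j) (y k) B :=
    ((Q ^ j).measurable_coe hB).comp (measurable_pi_apply k)
  have hden' : Measurable fun z : (ℕ → S) × (ℕ → Config ℝ) =>
      poissonWeight t j * (Q ^ j) (z.1 k) B := (hden.comp measurable_fst).const_mul _
  have hrect : ∀ D F, MeasurableSet[chainPast S k] D → MeasurableSet[sideAlgebra u true] F →
      μ.restrict ({y | y (k + j) ∈ B} ×ˢ {ω | clockIncrement u (u + t) ω = j}) (D ×ˢ F) =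
      μ.withDensity (fun z => poissonWeight t j * (Q ^ j) (z.1 k) B) (D ×ˢ F) := by
    intro D F hD hF
    have hD' := chainPast_le k D hD
    have hF' := sideAlgebra_le u true F hF
    have h1 : (chainLaw Q η) (D ∩ {y | y (k + j) ∈ B}) =
        ∫⁻ y in D, (Q ^ j) (y k) B ∂chainLaw Q η := by
      have h := setLIntegral_chainLaw_add Q η hD j (g := B.indicator 1) (measurable_one.indicator hB)
      simp only [lintegral_indicator_one hB] at h
      rw [← h, inter_comm, ← Measure.restrict_apply hBm, ← lintegral_indicator_one hBm]
      rfl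
    rw [Measure.restrict_apply (hD'.prod hF'), withDensity_apply _ (hD'.prod hF'), prod_inter_prod,
      Measure.prod_prod, clockMeasure_inter_increment hF, h1, ← Measure.prod_restrict,
      lintegral_prod _ hden'.aemeasurable]
    simp only [lintegral_const, Measure.restrict_apply MeasurableSet.univ, univ_inter]
    rw [lintegral_mul_const _ (hden.const_mul _), lintegral_const_mul _ hden]
    ring
  have hfin : IsFiniteMeasure
      (μ.restrict ({y | y (k + j) ∈ B} ×ˢ {ω | clockIncrement u (u + t) ω = j})) := inferInstance
  have hpi := @isPiSystem_prod _ _ (chainPast S k) (sideAlgebra u true)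
  have hgen := @generateFrom_prod _ _ (chainPast S k) (sideAlgebra u true)
  have key := ext_on_measurableSpace_of_generate_finite (m := jointPast S k u)
    Prod.instMeasurableSpace _ (μ := μ.restrict
      ({y | y (k + j) ∈ B} ×ˢ {ω | clockIncrement u (u + t) ω = j}))
    (ν := μ.withDensity fun z => poissonWeight t j * (Q ^ j) (z.1 k) B)
    (by rintro _ ⟨D, hD, F, hF, rfl⟩; exact hrect D F hD hF) (jointPast_le k u) hgen.symm hpi
    (by
      rw [← univ_prod_univ]
      exact hrect univ univ MeasurableSet.univ MeasurableSet.univ) hC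
  rw [Measure.restrict_apply (jointPast_le k u C hC),
    withDensity_apply _ (jointPast_le k u C hC)] at key
  rw [hset, key]

end Subordination

end GSIP

end

noncomputable section

namespace GSIP

universe u

/-! ### The Markov property of the subordinated chain -/

section MarkovProperty

variable {S : Type u} [MeasurableSpace S] (Q : Kernel S S) [IsMarkovKernel Q] {σ : S → ℕ}
  (hσ : Measurable σ) (Λ : ℕ → ℝ≥0)

/-- The event that the chain starts in level `n` and the clock shows `k` at time `u`. -/
def clockEvent (σ : S → ℕ) (n : ℕ) (u : ℝ≥0) (k : ℕ) : Set ((ℕ → S) × (ℕ → Config ℝ)) :=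
  {z | σ (z.1 0) = n ∧ clock u z.2 = k}

theorem measurable_fst_jointPast (u : ℝ≥0) {i k : ℕ} (hik : i ≤ k) :
    Measurable[jointPast S k u] fun z : (ℕ → S) × (ℕ → Config ℝ) => z.1 i :=
  (measurable_eval_chainPast hik).comp (@measurable_fst _ _ (chainPast S k) (sideAlgebra u true))

theorem measurable_clock_jointPast (k : ℕ) {r u : ℝ≥0} (hr : r ≤ u) :
    Measurable[jointPast S k u] fun z : (ℕ → S) × (ℕ → Config ℝ) => clock r z.2 :=
  (measurable_clock_sideAlgebra hr).comp
    (@measurable_snd _ _ (chainPast S k) (sideAlgebra u true))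

include hσ

theorem measurableSet_clockEvent (n : ℕ) (u : ℝ≥0) (k : ℕ) :
    MeasurableSet[jointPast S k u] (clockEvent σ n u k) :=
  @MeasurableSet.inter _ (jointPast S k u) _ _
    ((hσ.comp (measurable_fst_jointPast u (Nat.zero_le k))) (measurableSet_singleton n))
    ((measurable_clock_jointPast k le_rfl) (measurableSet_singleton k))

/-- If the level is n and the clock shows k at time Λ_n s, the path up to time s is a function of
the first k steps of the chain and of the clock up to Λ_n s. -/
theorem measurableSet_inter_clockEvent (n : ℕ) {s : ℝ≥0} {A : Set ((ℕ → S) × (ℕ → Config ℝ))}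
    (hA : MeasurableSet[⨆ r : Iic s, MeasurableSpace.comap (subordinated σ Λ r) inferInstance] A)
    (k : ℕ) : MeasurableSet[jointPast S k (Λ n * s)] (A ∩ clockEvent σ n (Λ n * s) k) := by
  have hR := measurableSet_clockEvent (S := S) hσ n (Λ n * s)
  -- As for the past of a stopping time, the sets with the required property form a σ-algebra; it
  -- then suffices to treat the events that generate the past of the process.
  let G : MeasurableSpace ((ℕ → S) × (ℕ → Config ℝ)) :=
    { MeasurableSet' := fun A => ∀ k,
        MeasurableSet[jointPast S k (Λ n * s)] (A ∩ clockEvent σ n (Λ n * s) k)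
      measurableSet_empty := fun k => by
        rw [empty_inter]
        exact @MeasurableSet.empty _ (jointPast S k (Λ n * s))
      measurableSet_compl := fun A hA k => by
        have : Aᶜ ∩ clockEvent σ n (Λ n * s) k =
            clockEvent σ n (Λ n * s) k \ (A ∩ clockEvent σ n (Λ n * s) k) := by
          ext z; simp only [mem_inter_iff, mem_compl_iff, Set.mem_sdiff]; tauto
        rw [this]
        exact @MeasurableSet.diff _ (jointPast S k (Λ n * s)) _ _ (hR k) (hA k)
      measurableSet_iUnion := fun A hA k => by
        rw [iUnion_inter]
        exact @MeasurableSet.iUnion _ _ (jointPast S k (Λ n * s)) _ _ fun i => hA i k }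
  have hle : (⨆ r : Iic s, MeasurableSpace.comap (subordinated (S := S) σ Λ r) inferInstance) ≤
      G := by
    refine iSup_le fun r => ?_
    rintro _ ⟨B, hB, rfl⟩ k
    have hrs : Λ n * (r : ℝ≥0) ≤ Λ n * s := mul_le_mul_of_nonneg_left r.2 bot_le
    have h : subordinated σ Λ r ⁻¹' B ∩ clockEvent σ n (Λ n * s) k =
        (⋃ j ∈ Finset.range (k + 1), {z | clock (Λ n * r) z.2 = j} ∩ {z | z.1 j ∈ B}) ∩
          clockEvent σ n (Λ n * s) k := by
      ext z
      simp only [mem_inter_iff, mem_preimage, subordinated, clockEvent, mem_ofPred_eq, mem_iUnion,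
        Finset.mem_range, exists_prop]
      refine and_congr_left fun ⟨h1, h2⟩ => ?_
      rw [h1]
      constructor
      · refine fun h => ⟨_, ?_, rfl, h⟩
        rw [Nat.lt_succ_iff, ← h2]
        exact clock_mono z.2 hrs
      · rintro ⟨j, -, rfl, h⟩
        exact h
    rw [h]
    refine @MeasurableSet.inter _ (jointPast S k (Λ n * s)) _ _ ?_ (hR k)
    refine @Finset.measurableSet_biUnion _ _ (jointPast S k (Λ n * s)) _ _ fun j hj => ?_
    exact @MeasurableSet.inter _ (jointPast S k (Λ n * s)) _ _
      ((measurable_clock_jointPast k hrs) (measurableSet_singleton j))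
      ((measurable_fst_jointPast _ (Nat.lt_succ_iff.1 (Finset.mem_range.1 hj))) hB)
  exact hle A hA k

variable (hQ : ∀ η, ∀ᵐ ξ ∂Q η, σ ξ = σ η)
include hQ

/-- On this event the process at time s is the chain at time k, and waiting another time t adds a
clock increment over an interval of length Λt. Summing over its value j gives the Poisson mixture
started from the k-th state, whose level is almost surely that of η. -/
theorem jointLaw_clockEvent_inter (η : S) (s t : ℝ≥0) {A : Set ((ℕ → S) × (ℕ → Config ℝ))}
    (hA : MeasurableSet[⨆ r : Iic s, MeasurableSpace.comap (subordinated σ Λ r) inferInstance] A)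
    {B : Set S} (hB : MeasurableSet B) (k : ℕ) :
    jointLaw Q η (A ∩ clockEvent σ (σ η) (Λ (σ η) * s) k ∩ subordinated σ Λ (s + t) ⁻¹' B) =
      ∫⁻ z in A ∩ clockEvent σ (σ η) (Λ (σ η) * s) k,
        poissonized hσ Q Λ t (subordinated σ Λ s z) B ∂jointLaw Q η := by
  set u := Λ (σ η) * s
  have hC := measurableSet_inter_clockEvent hσ Λ (σ η) hA k
  set C := A ∩ clockEvent σ (σ η) u k
  have hC' : MeasurableSet C := jointPast_le k u C hC
  have hsplit : C ∩ subordinated σ Λ (s + t) ⁻¹' B = ⋃ j, C ∩ {z | z.1 (k + j) ∈ B ∧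
      clockIncrement u (u + Λ (σ η) * t) z.2 = j} := by
    ext z
    simp only [mem_iUnion, mem_inter_iff, exists_and_left, mem_ofPred_eq, mem_preimage]
    refine and_congr_right fun hz => ?_
    have hz1 : σ (z.1 0) = σ η := hz.2.1
    have hz2 : clock u z.2 = k := hz.2.2
    have h3 : clock (Λ (σ η) * (s + t)) z.2 =
        k + clockIncrement u (u + Λ (σ η) * t) z.2 := by
      rw [← hz2, clock_add_clockIncrement le_self_add, mul_add]
    rw [subordinated, hz1, h3]
    constructor
    · exact fun h => ⟨_, h, rfl⟩
    · rintro ⟨j, h, rfl⟩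
      exact h
  have hmeas : ∀ j, MeasurableSet (C ∩ {z | z.1 (k + j) ∈ B ∧
      clockIncrement u (u + Λ (σ η) * t) z.2 = j}) := by
    intro j
    refine hC'.inter (MeasurableSet.inter ?_ ?_)
    · exact hB.preimage ((measurable_pi_apply (k + j)).comp measurable_fst)
    · exact (sideAlgebra_le u false _ (measurable_clockIncrement_sideAlgebra u _
        (measurableSet_singleton j))).preimage measurable_snd
  have hdisj : Pairwise (Function.onFun Disjoint fun j => C ∩ {z | z.1 (k + j) ∈ B ∧
      clockIncrement u (u + Λ (σ η) * t) z.2 = j}) := by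
    intro i j hij
    refine disjoint_left.2 fun z hz hz' => hij ?_
    exact hz.2.2.symm.trans hz'.2.2
  rw [hsplit, measure_iUnion hdisj hmeas]
  rw [tsum_congr fun j => jointLaw_inter Q η hC _ j hB, ← lintegral_tsum]
  · refine setLIntegral_congr_fun_ae hC' ?_
    have hlev : ∀ᵐ z ∂jointLaw Q η, σ (z.1 k) = σ η := by
      rw [jointLaw_apply]
      exact Measure.quasiMeasurePreserving_fst.ae (ae_chainLaw_level Q hσ hQ η k)
    filter_upwards [hlev] with z hz hzC
    have hz1 : σ (z.1 0) = σ η := hzC.2.1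
    have hz2 : clock u z.2 = k := hzC.2.2
    have h3 : subordinated σ Λ s z = z.1 k := by
      rw [subordinated, hz1]
      exact congrArg z.1 hz2
    rw [h3, poissonized_apply' hσ t _ hB, hz]
  · intro j
    exact ((((Q ^ j).measurable_coe hB).comp
      ((measurable_pi_apply k).comp measurable_fst)).const_mul _).aemeasurable

/-- Summation over the clock value k; the clock events cover everything up to the null set where the
chain does not start in the level of η. -/
theorem jointLaw_inter_subordinated (η : S) (s t : ℝ≥0) {A : Set ((ℕ → S) × (ℕ → Config ℝ))}
    (hA : MeasurableSet[⨆ r : Iic s, MeasurableSpace.comap (subordinated σ Λ r) inferInstance] A)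
    {B : Set S} (hB : MeasurableSet B) :
    jointLaw Q η (A ∩ subordinated σ Λ (s + t) ⁻¹' B) =
      ∫⁻ z in A, poissonized hσ Q Λ t (subordinated σ Λ s z) B ∂jointLaw Q η := by
  have hA' : MeasurableSet A := by
    refine (iSup_le fun r : Iic s => ?_ : (⨆ r : Iic s,
      MeasurableSpace.comap (subordinated (S := S) σ Λ r) inferInstance) ≤ _) A hA
    exact (measurable_subordinated Λ hσ r).comap_le
  let R := clockEvent σ (σ η) (Λ (σ η) * s)
  have hR : ∀ k, MeasurableSet (R k) := fun k =>
    jointPast_le k _ _ (measurableSet_clockEvent hσ (σ η) _ k)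
  have hRd : Pairwise (Function.onFun Disjoint R) := fun i j hij =>
    disjoint_left.2 fun z hz hz' => hij (hz.2.symm.trans hz'.2)
  have hRu : ∀ᵐ z ∂jointLaw Q η, z ∈ ⋃ k, R k := by
    have h0 : ∀ᵐ z ∂jointLaw Q η, σ (z.1 0) = σ η := by
      rw [jointLaw_apply]
      exact Measure.quasiMeasurePreserving_fst.ae (ae_chainLaw_level Q hσ hQ η 0)
    filter_upwards [h0] with z hz
    exact mem_iUnion.2 ⟨_, hz, rfl⟩
  have hAR : (⋃ k, A ∩ R k : Set _) =ᵐ[jointLaw Q η] A := by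
    rw [← inter_iUnion]
    filter_upwards [hRu] with z hz
    exact propext ⟨fun h => h.1, fun h => ⟨h, hz⟩⟩
  have hd : Pairwise (Function.onFun Disjoint fun k => A ∩ R k) := fun i j hij =>
    (hRd hij).mono inter_subset_right inter_subset_right
  have h1 : jointLaw Q η (A ∩ subordinated σ Λ (s + t) ⁻¹' B) =
      ∑' k, jointLaw Q η (A ∩ R k ∩ subordinated σ Λ (s + t) ⁻¹' B) := by
    have hm := (measurable_subordinated Λ hσ (s + t)) hB
    rw [← measure_iUnion, ← iUnion_inter]
    · refine measure_congr ?_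
      exact (hAR.symm.inter (ae_eq_refl _))
    · exact fun i j hij => (hd hij).mono inter_subset_left inter_subset_left
    · exact fun k => (hA'.inter (hR k)).inter hm
  rw [h1, ← setLIntegral_congr hAR, lintegral_iUnion (fun k => hA'.inter (hR k)) hd]
  exact tsum_congr fun k => jointLaw_clockEvent_inter Q hσ Λ hQ η s t hA hB k

omit hσ hQ in
theorem ae_subordinated_zero (η : S) {B : Set S} (hB : MeasurableSet B) (hη : η ∈ B) :
    ∀ᵐ z ∂jointLaw Q η, subordinated σ Λ 0 z ∈ B := by
  have h : ∀ᵐ z ∂jointLaw Q η, z.1 0 ∈ B := by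
    rw [jointLaw_apply]
    exact Measure.quasiMeasurePreserving_fst.ae (ae_chainLaw_zero Q η hB hη)
  filter_upwards [h] with z hz
  rwa [subordinated, mul_zero, clock_zero]

/-- The case s = 0 with trivial past event, since the process starts almost surely at η. -/
theorem jointLaw_map_subordinated (t : ℝ≥0) :
    (jointLaw Q).map (subordinated σ Λ t) = poissonized hσ Q Λ t := by
  ext η B hB
  rw [Kernel.map_apply' _ (measurable_subordinated Λ hσ t) _ hB]
  have h := jointLaw_inter_subordinated Q hσ Λ hQ η 0 t (A := univ) MeasurableSet.univ hB
  rw [univ_inter, zero_add, Measure.restrict_univ] at h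
  rw [h]
  have hm : MeasurableSet {ξ | poissonized hσ Q Λ t ξ B = poissonized hσ Q Λ t η B} :=
    measurableSet_eq_fun ((poissonized hσ Q Λ t).measurable_coe hB) measurable_const
  rw [lintegral_congr_ae (ae_subordinated_zero Q Λ η hm rfl)]
  simp

/-- The right side is a function of the state at time s, hence measurable for the past, and its
integrals over past events are given by `jointLaw_inter_subordinated`. -/
theorem condExp_subordinated (η : S) (s t : ℝ≥0) {B : Set S} (hB : MeasurableSet B) :
    (jointLaw Q η)⟦subordinated σ Λ (s + t) ⁻¹' B | ⨆ r : Iic s,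
      MeasurableSpace.comap (subordinated σ Λ r) inferInstance⟧ =ᵐ[jointLaw Q η]
      fun z => (jointLaw Q (subordinated σ Λ s z)).real (subordinated σ Λ t ⁻¹' B) := by
  have hle : (⨆ r : Iic s, MeasurableSpace.comap (subordinated (S := S) σ Λ r) inferInstance) ≤
      Prod.instMeasurableSpace := iSup_le fun r => (measurable_subordinated Λ hσ r).comap_le
  have hP : ∀ ξ, (jointLaw Q ξ).real (subordinated σ Λ t ⁻¹' B) =
      (poissonized hσ Q Λ t ξ).real B := by
    intro ξ
    rw [measureReal_def, measureReal_def, ← jointLaw_map_subordinated Q hσ Λ hQ t,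
      Kernel.map_apply' _ (measurable_subordinated Λ hσ t) _ hB]
  simp only [hP]
  have hmP : Measurable fun ξ => (poissonized hσ Q Λ t ξ).real B :=
    ((poissonized hσ Q Λ t).measurable_coe hB).ennreal_toReal
  have hmB := (measurable_subordinated (S := S) Λ hσ (s + t)) hB
  have hint : Integrable (fun z => (poissonized hσ Q Λ t (subordinated σ Λ s z)).real B)
      (jointLaw Q η) := by
    refine Integrable.of_bound (hmP.comp (measurable_subordinated Λ hσ s)).aestronglyMeasurable 1
      (.of_forall fun z => ?_)
    rw [Real.norm_eq_abs, abs_of_nonneg measureReal_nonneg]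
    exact measureReal_le_one
  symm
  refine ae_eq_condExp_of_forall_setIntegral_eq hle ?_ (fun A _ _ => hint.integrableOn)
    (fun A hA _ => ?_) ?_
  · exact (integrable_const (1 : ℝ)).indicator hmB
  · have h := jointLaw_inter_subordinated Q hσ Λ hQ η s t hA hB
    rw [setIntegral_indicator hmB, setIntegral_const, smul_eq_mul, mul_one, measureReal_def, h]
    refine integral_toReal ?_ (.of_forall fun z => measure_lt_top _ _)
    exact (((poissonized hσ Q Λ t).measurable_coe hB).comp
      (measurable_subordinated Λ hσ s)).aemeasurable
  · refine Measurable.aestronglyMeasurable ?_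
    refine hmP.comp (Measurable.mono (comap_measurable (subordinated σ Λ s)) ?_ le_rfl)
    exact le_iSup (fun r : Iic s =>
      MeasurableSpace.comap (subordinated (S := S) σ Λ r) inferInstance) ⟨s, self_mem_Iic⟩

end MarkovProperty

/-! ### The generalized symmetric inclusion process -/

variable {E : Type u} [MeasurableSpace E] [StandardBorelSpace E]

/-- The generalized symmetric inclusion process. -/
def gsipProcess (α : Measure E) [IsFiniteMeasure α] {c : E → E → ℝ≥0}
    (hc : Measurable (Function.uncurry c)) {K : ℝ≥0} (hK : ∀ x y, c x y ≤ K) : MarkovProcess E :=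
  have := isMarkovKernel_jumpKernel α hc hK
  have : MeasurableSingletonClass (Config E) :=
    MeasurableSpace.measurableSingletonClass_of_countablySeparated
  { Ω := (ℕ → Config E) × (ℕ → Config ℝ)
    X := subordinated size (rateBound α K)
    measurable_X := measurable_subordinated (rateBound α K) measurable_size
    law := jointLaw (jumpKernel α hc K)
    law_start := fun η => ae_subordinated_zero (jumpKernel α hc K) (rateBound α K) η
      (measurableSet_singleton η) rfl
    markov := fun η s t _ hB => condExp_subordinated (jumpKernel α hc K) measurable_size
      (rateBound α K) (ae_jumpKernel_size α hc) η s t hB }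

theorem transition_gsipProcess (α : Measure E) [IsFiniteMeasure α] {c : E → E → ℝ≥0}
    (hc : Measurable (Function.uncurry c)) {K : ℝ≥0} (hK : ∀ x y, c x y ≤ K) :
    (gsipProcess α hc hK).transition = gsip α hc K := by
  have := isMarkovKernel_jumpKernel α hc hK
  funext t
  exact jointLaw_map_subordinated (jumpKernel α hc K) measurable_size (rateBound α K)
    (ae_jumpKernel_size α hc) t

end GSIP

end

theorem mainTheorem3 {E : Type*} [MeasurableSpace E] [StandardBorelSpace E]
    (α : MeasureTheory.Measure E) [MeasureTheory.IsFiniteMeasure α]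
    (c : E → E → ℝ≥0) (hc_meas : Measurable (Function.uncurry c))
    (hc_symm : ∀ x y, c x y = c y x) (hc_bdd : ∃ K : ℝ≥0, ∀ x y, c x y ≤ K) :
    ∃ P : ℝ≥0 → Kernel (GSIP.Config E) (GSIP.Config E),
      -- `P` is the transition function of the process with generator `L`
      GSIP.IsMarkovSemigroup P ∧
      GSIP.IsBackwardSolution α c P ∧
      (∀ P', GSIP.IsBackwardSolution α c P' → P' = P) ∧
      (∃ X : GSIP.MarkovProcess E, X.transition = P) ∧
      -- (i)
      GSIP.IsConservative P ∧
      GSIP.IsConsistent P ∧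
      GSIP.FactorialIntertwining P ∧
      -- (ii)
      ∀ p ∈ Set.Ioo (0 : ℝ) 1,
        (∃ ρ, GSIP.IsPascal α p ρ) ∧
        ∀ ρ, GSIP.IsPascal α p ρ →
          (∀ t, (P t).IsReversible ρ) ∧
          GSIP.FiniteMoments ρ ∧
          GSIP.OrthogonalIntertwining P ρ := by
  obtain ⟨K, hK⟩ := hc_bdd
  refine ⟨GSIP.gsip α hc_meas K, GSIP.isMarkovSemigroup_gsip α hc_meas hK,
    GSIP.isBackwardSolution_gsip α hc_meas hK,
    fun _ hP => GSIP.eq_gsip_of_isBackwardSolution α hc_meas hK hP,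
    ⟨GSIP.gsipProcess α hc_meas hK, GSIP.transition_gsipProcess α hc_meas hK⟩,
    GSIP.isConservative_gsip α hc_meas, GSIP.isConsistent_gsip α hc_meas hK hc_symm,
    GSIP.factorialIntertwining_gsip α hc_meas hK hc_symm, fun p hp => ⟨?_, fun ρ hρ => ?_⟩⟩
  · obtain ⟨ρ, _, hρ⟩ := GSIP.exists_isMecke_pascal α hp
    exact ⟨ρ, GSIP.isPascal_of_isMecke hp hρ⟩
  · have := hρ.isProbabilityMeasure
    have hrev : ∀ t, (GSIP.gsip α hc_meas K t).IsReversible ρ :=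
      (hρ.isMecke hp).isReversible_gsip hc_meas hc_symm
    exact ⟨hrev, hρ.finiteMoments hp, GSIP.orthogonalIntertwining_gsip α hc_meas hK hc_symm
      (hρ.finiteMoments hp) hrev⟩
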